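/- Let $G_{\mathbb C}\subset \mathrm{GL}(N,{\mathbb C})$ be a connected linear algebraic group defined over ${\mathbb R}$, let $V_{\mathbb C}={\mathbb C}^n$ with ${\mathbb R}$-structure $V_{\mathbb R}={\mathbb R}^n$, and let $\rho:G_{\mathbb C}\to \mathrm{GL}(V_{\mathbb C})$ be an ${\mathbb R}$-rational representation with a Zariski-dense orbit, so that $(G_{\mathbb C},\rho,V_{\mathbb C})$ is a prehomogeneous vector space over ${\mathbb R}$. Let $S_{\mathbb C}$ be the complement of the dense orbit, $S_{\mathbb R}=S_{\mathbb C}\cap V_{\mathbb R}$, $G_{\mathbb R}=G_{\mathbb C}\cap \mathrm{GL}(N,{\mathbb R})$, $G$ the identity component of $G_{\mathbb R}$, $dg$ a left Haar measure on $G$, and write $gm=\rho(g)m$. Put $|g|=d(g,e)$, where $d$ is the Riemannian distance on $G$ of a left invariant Riemannian metric. Let $\mathcal S(G)$ be the space of smooth functions $f:G\to{\mathbb C}$ such that, for all $\kappa\ge 0$ and all $X$ in the universal enveloping algebra of the complexified Lie algebra of $G$, $e^{\kappa|g|}\,|dL(X)f(g)|$ is bounded on $G$ and $dL(X)f\in L^1(G,e^{\kappa|g|}dg)$;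 here $dL$ is the derivative of the left regular representation $(L(h)f)(g)=f(h^{-1}g)$. Let $\pi$ be the left regular representation of $G$ on the Banach space $C_0(V_{\mathbb R})$ of continuous complex-valued functions on $V_{\mathbb R}$ vanishing at infinity, $(\pi(g)\phi)(m)=\phi(g^{-1}m)$. For $f\in\mathcal S(G)$ let $\pi(f)=\int_G f(g)\pi(g)\,dg$ and, for $m\in V_{\mathbb R}$ and $\xi\in V_{\mathbb R}^*\cong{\mathbb R}^n$, $$\hat f(m,\xi)=\int_G f(g)\,e^{i(g^{-1}m)\cdot\xi}\,dg,\qquad a_f(m,\xi)=e^{-im\cdot\xi}\hat f(m,\xi).$$ For an open set $U\subset{\mathbb R}^n$ and $l\in{\mathbb R}$, let $S^l(U\times{\mathbb R}^n)$ be the set of all $a\in C^\infty(U\times{\mathbb R}^n)$ such that for all multi-indices $\alpha,\beta$ and every compact $K\subset U$ there is a constant $C$ with $|\partial_\xi^\alpha\partial_x^\beta a(x,\xi)|\le C(1+|\xi|^2)^{(l-|\alpha|)/2}$ for $x\in K$, $\xi\in{\mathbb R}^n$, and put $S^{-\infty}=\bigcap_l S^l$. Let $L^l(U)$ be the class of the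 operators $Au(x)=(2\pi)^{-n}\int e^{ix\cdot\xi}a(x,\xi)\hat u(\xi)\,d\xi$, $u\in C_c^\infty(U)$, $x\in U$, with $a\in S^l(U\times{\mathbb R}^n)$ and $\hat u(\xi)=\int e^{-iy\cdot\xi}u(y)\,dy$, and put $L^{-\infty}(U)=\bigcap_l L^l(U)$. Then, for every $f\in\mathcal S(G)$: 1. $V_{\mathbb R}-S_{\mathbb R}$ is open in $V_{\mathbb R}$, and for all $\phi\in C_c^\infty(V_{\mathbb R})$ and $m\in V_{\mathbb R}$, $$(\pi(f)\phi)(m)=(2\pi)^{-n}\int\Big(\int e^{i(m-m')\cdot\xi}a_f(m,\xi)\phi(m')\,dm'\Big)d\xi,$$ where the inner integral is an integrable function of $\xi$; for $m\in V_{\mathbb R}-S_{\mathbb R}$ the double integral over $(m',\xi)$ is absolutely convergent. 2. $a_f\in S^{-\infty}((V_{\mathbb R}-S_{\mathbb R})\times V_{\mathbb R}^*)$. 3. On $V_{\mathbb R}-S_{\mathbb R}$, $\pi(f)$ is a pseudodifferential operator of class $L^{-\infty}(V_{\mathbb R}-S_{\mathbb R})$, and it is smoothing: there is $K\in C^\infty((V_{\mathbb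 R}-S_{\mathbb R})\times(V_{\mathbb R}-S_{\mathbb R}))$ with $(\pi(f)u)(m)=\int K(m,m')u(m')\,dm'$ for all $u\in C_c^\infty(V_{\mathbb R}-S_{\mathbb R})$ and $m\in V_{\mathbb R}-S_{\mathbb R}$. -/

import Mathlib

open MeasureTheory Topology
open scoped ContDiff ZeroAtInfty

/-- The Zariski topology on the affine space `ℂ^σ`: the sets `{p ≠ 0}`, for polynomials `p`,
are a base of open sets. -/
abbrev zariskiTopology (σ : Type) : TopologicalSpace (σ → ℂ) :=
  TopologicalSpace.generateFrom
    (Set.range fun p : MvPolynomial σ ℂ => {x : σ → ℂ | MvPolynomial.eval x p ≠ 0})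

/-- The matrix entries of an invertible matrix, as a point of the affine space `K^(N × N)`. -/
def entries {N : ℕ} {K : Type} [CommRing K] (g : GL (Fin N) K) : Fin N × Fin N → K :=
  fun ij => (g : Matrix (Fin N) (Fin N) K) ij.1 ij.2

/-- The exponential of a matrix, as an invertible matrix. -/
noncomputable def expGL {N : ℕ} (X : Matrix (Fin N) (Fin N) ℝ) : GL (Fin N) ℝ where
  val := NormedSpace.exp X
  inv := NormedSpace.exp (-X)
  val_inv := by
    rw [← Matrix.exp_add_of_commute _ _ (Commute.refl X).neg_right, add_neg_cancel,
      NormedSpace.exp_zero]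
  inv_val := by
    rw [← Matrix.exp_add_of_commute _ _ (Commute.refl X).neg_left, neg_add_cancel,
      NormedSpace.exp_zero]

theorem continuous_expGL_smul {N : ℕ} (X : Matrix (Fin N) (Fin N) ℝ) :
    Continuous fun t : ℝ => expGL (t • X) := by
  have h : ∀ Y : Matrix (Fin N) (Fin N) ℝ,
      Continuous fun t : ℝ => (NormedSpace.exp (t • Y) : Matrix (Fin N) (Fin N) ℝ) := by
    intro Y
    let _ : NormedRing (Matrix (Fin N) (Fin N) ℝ) := Matrix.linftyOpNormedRing
    let _ : NormedAlgebra ℚ (Matrix (Fin N) (Fin N) ℝ) := Matrix.linftyOpNormedAlgebra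
    let _ : NormedAlgebra ℝ (Matrix (Fin N) (Fin N) ℝ) := Matrix.linftyOpNormedAlgebra
    have _ : CompleteSpace (Matrix (Fin N) (Fin N) ℝ) := FiniteDimensional.complete ℝ _
    exact (NormedSpace.exp_continuous (𝔸 := Matrix (Fin N) (Fin N) ℝ)).comp
      (continuous_id.smul continuous_const)
  refine Units.continuous_iff.2 ⟨h X, ?_⟩
  simpa [expGL, Function.comp_def, ← smul_neg] using h (-X)

/-- A prehomogeneous vector space over `ℝ`, in coordinates: a connected linear algebraic group
`GC ⊆ GL(N, ℂ)` defined over `ℝ`, and an `ℝ`-rational representation `ρ` of `GC` on `V_ℂ = ℂ^n`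
(with the `ℝ`-structure `V_ℝ = ℝ^n`) that has a Zariski-dense orbit. -/
structure PrehomogeneousSpace (N n : ℕ) where
  /-- The complex group. -/
  GC : Subgroup (GL (Fin N) ℂ)
  /-- `GC` is the zero set, in `GL(N, ℂ)`, of polynomials with real coefficients. -/
  defined_over_real : ∃ I : Set (MvPolynomial (Fin N × Fin N) ℝ), ∀ g : GL (Fin N) ℂ,
    g ∈ GC ↔ ∀ p ∈ I, MvPolynomial.aeval (entries g) p = 0
  /-- `GC` is connected in the Zariski topology. -/
  connected : @IsConnected _ (zariskiTopology (Fin N × Fin N)) (entries '' (GC : Set (GL (Fin N) ℂ)))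
  /-- The representation. -/
  ρ : GC →* GL (Fin n) ℂ
  /-- The matrix coefficients of `ρ` are of the form `p / det ^ r`, where `p` is a polynomial with
  real coefficients in the matrix entries. -/
  rational : ∀ i j, ∃ (p : MvPolynomial (Fin N × Fin N) ℝ) (r : ℕ), ∀ g : GC,
    (ρ g : Matrix (Fin n) (Fin n) ℂ) i j
      * ((g : GL (Fin N) ℂ) : Matrix (Fin N) (Fin N) ℂ).det ^ r
      = MvPolynomial.aeval (entries (g : GL (Fin N) ℂ)) p
  /-- There is a Zariski-dense orbit. -/
  prehomogeneous : ∃ v : Fin n → ℂ, @Dense _ (zariskiTopology (Fin n))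
    (Set.range fun g : GC => (ρ g : Matrix (Fin n) (Fin n) ℂ).mulVec v)

/-- `V_ℝ = ℝ^n` with its Euclidean structure. The dual `V_ℝ^*` is identified with it through
`m · ξ = ∑ j, m j * ξ j`, which is `inner ℝ m ξ`. -/
abbrev VR (n : ℕ) : Type := EuclideanSpace ℝ (Fin n)

namespace PrehomogeneousSpace

variable {N n : ℕ} (P : PrehomogeneousSpace N n)

/-- The singular set `S_ℂ`: the complement of the dense orbit, that is, the set of all points whose
orbit is not Zariski-dense. -/
def singularSet : Set (Fin n → ℂ) :=
  {v | ¬ @Dense _ (zariskiTopology (Fin n))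
    (Set.range fun g : P.GC => (P.ρ g : Matrix (Fin n) (Fin n) ℂ).mulVec v)}

/-- `V_ℝ - S_ℝ`, where `S_ℝ = S_ℂ ∩ V_ℝ`. -/
def regularSet : Set (VR n) :=
  {m | (fun j => (m j : ℂ)) ∉ P.singularSet}

/-- The group `G_ℝ = GC ∩ GL(N, ℝ)` of real points. -/
noncomputable def GR : Subgroup (GL (Fin N) ℝ) :=
  P.GC.comap (Matrix.GeneralLinearGroup.map (algebraMap ℝ ℂ))

/-- The inclusion of `G_ℝ` in `GC`. -/
noncomputable def toGC : P.GR →* P.GC where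
  toFun g := ⟨Matrix.GeneralLinearGroup.map (algebraMap ℝ ℂ) (g : GL (Fin N) ℝ), g.2⟩
  map_one' := Subtype.ext (map_one _)
  map_mul' _ _ := Subtype.ext (map_mul _ _ _)

/-- The identity component `G` of `G_ℝ`. -/
noncomputable abbrev G : Subgroup P.GR := Subgroup.connectedComponentOfOne P.GR

/-- The matrix of an element of `G`. -/
def mat (g : P.G) : Matrix (Fin N) (Fin N) ℝ := ((g : P.GR) : GL (Fin N) ℝ)

theorem toGC_real (g : P.GR) (i j : Fin n) :
    ((P.ρ (P.toGC g) : Matrix (Fin n) (Fin n) ℂ) i j).im = 0 := by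
  obtain ⟨p, r, h⟩ := P.rational i j
  have h1 := h (P.toGC g)
  have hd : (((P.toGC g : P.GC) : GL (Fin N) ℂ) : Matrix (Fin N) (Fin N) ℂ)
      = ((g : GL (Fin N) ℝ) : Matrix (Fin N) (Fin N) ℝ).map (algebraMap ℝ ℂ) := rfl
  have he : entries ((P.toGC g : P.GC) : GL (Fin N) ℂ)
      = algebraMap ℝ ℂ ∘ entries (g : GL (Fin N) ℝ) := rfl
  rw [hd, he, MvPolynomial.aeval_algebraMap_apply, ← RingHom.mapMatrix_apply,
    ← RingHom.map_det, ← map_pow] at h1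
  have hne : ((g : GL (Fin N) ℝ) : Matrix (Fin N) (Fin N) ℝ).det ^ r ≠ 0 :=
    pow_ne_zero _ ((Matrix.isUnit_iff_isUnit_det _).1 (Units.isUnit _)).ne_zero
  have h2 := congrArg Complex.im h1
  simpa [hne, -map_pow, -Complex.ofReal_pow] using h2

/-- The real representation of `G_ℝ` on `V_ℝ`; `realRep_map` says that it is the restriction
of `ρ`. -/
noncomputable def realRep (g : P.GR) : Matrix (Fin n) (Fin n) ℝ :=
  Matrix.of fun i j => ((P.ρ (P.toGC g) : Matrix (Fin n) (Fin n) ℂ) i j).re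

theorem realRep_map (g : P.GR) :
    (P.realRep g).map (algebraMap ℝ ℂ) = (P.ρ (P.toGC g) : Matrix (Fin n) (Fin n) ℂ) := by
  ext i j
  exact Complex.ext (by simp [realRep]) (by simp [P.toGC_real g i j])

theorem realRep_mul (g h : P.GR) : P.realRep (g * h) = P.realRep g * P.realRep h := by
  have : Function.Injective
      fun M : Matrix (Fin n) (Fin n) ℝ => M.map (algebraMap ℝ ℂ) :=
    Matrix.map_injective (algebraMap ℝ ℂ).injective
  apply this
  simp only [Matrix.map_mul, realRep_map, map_mul, Units.val_mul]

theorem realRep_one : P.realRep 1 = 1 := by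
  ext i j
  simp [realRep, Matrix.one_apply]
  split_ifs <;> simp

/-- The action of `G` on `V_ℝ`. -/
noncomputable def act (g : P.G) (m : VR n) : VR n :=
  WithLp.toLp 2 ((P.realRep (g : P.GR)).mulVec m.ofLp)

theorem continuous_act (g : P.G) : Continuous (P.act g) := by
  unfold act
  fun_prop

theorem act_act_inv (g : P.G) (m : VR n) : P.act g (P.act g⁻¹ m) = m := by
  simp [act, ← realRep_mul, realRep_one]

/-- The action of an element of `G`, as a homeomorphism of `V_ℝ`. -/
noncomputable def actHomeo (g : P.G) : VR n ≃ₜ VR n where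
  toFun := P.act g
  invFun := P.act g⁻¹
  left_inv m := by simpa using P.act_act_inv g⁻¹ m
  right_inv m := P.act_act_inv g m
  continuous_toFun := P.continuous_act g
  continuous_invFun := P.continuous_act g⁻¹

/-- The left regular representation on `C₀(V_ℝ)`: `(π(g) φ)(m) = φ(g⁻¹ m)`. -/
noncomputable def leftRegular (g : P.G) (φ : C₀(VR n, ℂ)) : C₀(VR n, ℂ) :=
  φ.comp (P.actHomeo g⁻¹).toCocompactMap

/-- `π(f) φ = ∫ f(g) π(g) φ dg`, as a Bochner integral in the Banach space `C₀(V_ℝ)`. -/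
noncomputable def piOp [MeasurableSpace P.G] (μ : Measure P.G) (f : P.G → ℂ)
    (φ : C₀(VR n, ℂ)) : C₀(VR n, ℂ) :=
  ∫ g, f g • P.leftRegular g φ ∂μ

/-- The Lie algebra `𝔤` of `G_ℝ` (and of `G`). -/
def lieAlg : Set (Matrix (Fin N) (Fin N) ℝ) := {X | ∀ t : ℝ, expGL (t • X) ∈ P.GR}

/-- The one-parameter subgroup `t ↦ exp(t X)` of `G`. -/
noncomputable def oneParam (X : P.lieAlg) (t : ℝ) : P.G :=
  ⟨⟨expGL (t • (X : Matrix (Fin N) (Fin N) ℝ)), X.2 t⟩, by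
    have hc : Continuous fun t : ℝ => (⟨expGL (t • (X : Matrix (Fin N) (Fin N) ℝ)), X.2 t⟩ : P.GR) :=
      (continuous_expGL_smul _).subtype_mk _
    have h0 : (⟨expGL ((0 : ℝ) • (X : Matrix (Fin N) (Fin N) ℝ)), X.2 0⟩ : P.GR) = 1 := by
      apply Subtype.ext
      apply Units.ext
      simp [expGL, NormedSpace.exp_zero]
    exact (isPreconnected_range hc).subset_connectedComponent ⟨0, h0⟩ ⟨t, rfl⟩⟩

/-- A function on `G` is smooth if it is locally the restriction of a smooth function of the
matrix entries (`G` is an embedded submanifold of the space of matrices). -/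
def IsSmooth (f : P.G → ℂ) : Prop :=
  ∀ g : P.G, ∃ F : (Fin N → Fin N → ℝ) → ℂ, ContDiff ℝ ∞ F ∧
    ∀ᶠ h in 𝓝 g, F (fun i j => P.mat h i j) = f h

/-- The left regular representation of the Lie algebra on functions on `G`:
`(dL(X) f)(g) = d/dt f(exp(-t X) g)` at `t = 0`. -/
noncomputable def dL (X : P.lieAlg) (f : P.G → ℂ) (g : P.G) : ℂ :=
  deriv (fun t : ℝ => f (P.oneParam X (-t) * g)) 0

/-- `P.LeftDerivative f h` says that `h = dL(u) f` for some `u` in the universal enveloping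
algebra `𝔘` of the complexification of `𝔤`: these `u` are the complex linear combinations of
products of elements of `𝔤`. -/
inductive LeftDerivative (f : P.G → ℂ) : (P.G → ℂ) → Prop
  | self : LeftDerivative f f
  | lie (X : P.lieAlg) (h : P.G → ℂ) : LeftDerivative f h → LeftDerivative f (P.dL X h)
  | add (h₁ h₂ : P.G → ℂ) : LeftDerivative f h₁ → LeftDerivative f h₂ →
      LeftDerivative f (fun g => h₁ g + h₂ g)
  | smul (c : ℂ) (h : P.G → ℂ) : LeftDerivative f h → LeftDerivative f (fun g => c * h g)

/-- The entrywise derivative of a curve of matrices. -/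
noncomputable def curveDeriv (γ : ℝ → Matrix (Fin N) (Fin N) ℝ) (t : ℝ) :
    Matrix (Fin N) (Fin N) ℝ :=
  Matrix.of fun i j => deriv (fun s => γ s i j) t

/-- The length, on `[0, 1]`, of a curve in `G`, for the left invariant Riemannian metric whose value
at the unit element is (the restriction to the Lie algebra of) the inner product `B`. -/
noncomputable def curveLength (B : LinearMap.BilinForm ℝ (Matrix (Fin N) (Fin N) ℝ))
    (γ : ℝ → Matrix (Fin N) (Fin N) ℝ) : ℝ :=
  ∫ t in (0 : ℝ)..1, √(B ((γ t)⁻¹ * curveDeriv γ t) ((γ t)⁻¹ * curveDeriv γ t))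

/-- `|g| = d(g, e)`, the Riemannian distance of `g` to the unit element: the infimum of the
lengths of the `C¹` curves in `G` from `e` to `g`. -/
noncomputable def absG (B : LinearMap.BilinForm ℝ (Matrix (Fin N) (Fin N) ℝ)) (g : P.G) : ℝ :=
  sInf {L | ∃ γ : ℝ → Matrix (Fin N) (Fin N) ℝ,
    (∀ i j, ContDiff ℝ 1 fun t => γ t i j) ∧ (∀ t ∈ Set.Icc (0 : ℝ) 1, ∃ h : P.G, P.mat h = γ t) ∧
    γ 0 = 1 ∧ γ 1 = P.mat g ∧ L = curveLength B γ}

/-- The space `𝓢(G)` of rapidly decreasing smooth functions on `G`. -/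
structure RapidlyDecreasing [MeasurableSpace P.G]
    (B : LinearMap.BilinForm ℝ (Matrix (Fin N) (Fin N) ℝ)) (μ : Measure P.G)
    (f : P.G → ℂ) : Prop where
  smooth : P.IsSmooth f
  bounded : ∀ κ : ℝ, 0 ≤ κ → ∀ h, P.LeftDerivative f h →
    ∃ C : ℝ, ∀ g, ‖h g‖ ≤ C * Real.exp (-κ * P.absG B g)
  /-- `dL(u) f` is in `L¹(G, e^{κ|g|} dg)`. -/
  integrable : ∀ κ : ℝ, 0 ≤ κ → ∀ h, P.LeftDerivative f h →
    Integrable (fun g => (Real.exp (κ * P.absG B g) : ℂ) * h g) μ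

/-- `f̂(m, ξ) = ∫ f(g) e^{i (g⁻¹ m) · ξ} dg`. -/
noncomputable def fHat [MeasurableSpace P.G] (μ : Measure P.G) (f : P.G → ℂ) (m ξ : VR n) : ℂ :=
  ∫ g, f g * Complex.exp (Complex.I * (inner ℝ (P.act g⁻¹ m) ξ : ℝ)) ∂μ

/-- `a_f(m, ξ) = e^{-i m · ξ} f̂(m, ξ)`. -/
noncomputable def symbol [MeasurableSpace P.G] (μ : Measure P.G) (f : P.G → ℂ) (m ξ : VR n) : ℂ :=
  Complex.exp (-(Complex.I * (inner ℝ m ξ : ℝ))) * P.fHat μ f m ξ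

end PrehomogeneousSpace

/-- `∂/∂x_j` of a function `a(x, ξ)`. -/
noncomputable def dX {n : ℕ} (j : Fin n) (a : VR n → VR n → ℂ) : VR n → VR n → ℂ :=
  fun x ξ => lineDeriv ℝ (fun y => a y ξ) x (EuclideanSpace.single j 1)

/-- `∂/∂ξ_j` of a function `a(x, ξ)`. -/
noncomputable def dXi {n : ℕ} (j : Fin n) (a : VR n → VR n → ℂ) : VR n → VR n → ℂ :=
  fun x ξ => lineDeriv ℝ (fun η => a x η) ξ (EuclideanSpace.single j 1)

/-- `∂_ξ^α ∂_x^β a`, for multi-indices `α` and `β`. -/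
noncomputable def mixedDeriv {n : ℕ} (α β : Fin n → ℕ) (a : VR n → VR n → ℂ) :
    VR n → VR n → ℂ :=
  (List.finRange n).foldr (fun j b => (dXi j)^[α j] b)
    ((List.finRange n).foldr (fun j b => (dX j)^[β j] b) a)

/-- The symbol class `S^l(U × ℝ^n)`, for an open set `U` of `ℝ^n`. -/
def IsSymbol {n : ℕ} (l : ℝ) (U : Set (VR n)) (a : VR n → VR n → ℂ) : Prop :=
  ContDiffOn ℝ ∞ (fun p : VR n × VR n => a p.1 p.2) (U ×ˢ Set.univ) ∧
  ∀ (α β : Fin n → ℕ) (K : Set (VR n)), IsCompact K → K ⊆ U → ∃ C : ℝ, ∀ x ∈ K, ∀ ξ : VR n,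
    ‖mixedDeriv α β a x ξ‖ ≤ C * (√(1 + ‖ξ‖ ^ 2)) ^ (l - ((∑ j, α j : ℕ) : ℝ))

/-- The space `C_c^∞(U)`: smooth functions on `ℝ^n` with compact support contained in `U`. -/
structure TestFun {n : ℕ} (U : Set (VR n)) where
  /-- The function. -/
  toFun : VR n → ℂ
  smooth : ContDiff ℝ ∞ toFun
  compact : HasCompactSupport toFun
  support : tsupport toFun ⊆ U

/-- A test function as an element of `C₀(V_ℝ)`. -/
noncomputable def TestFun.toC0 {n : ℕ} {U : Set (VR n)} (u : TestFun U) : C₀(VR n, ℂ) where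
  toFun := u.toFun
  continuous_toFun := u.smooth.continuous
  zero_at_infty' := u.compact.is_zero_at_infty

/-- The Fourier transform `û(ξ) = ∫ e^{-i y · ξ} u(y) dy`. -/
noncomputable def fourierT {n : ℕ} (u : VR n → ℂ) (ξ : VR n) : ℂ :=
  ∫ y, Complex.exp (-(Complex.I * (inner ℝ y ξ : ℝ))) * u y

/-- The pseudodifferential operator with symbol `a`:
`(A u)(x) = (2π)^{-n} ∫ e^{i x · ξ} a(x, ξ) û(ξ) dξ`. -/
noncomputable def psiOp {n : ℕ} (a : VR n → VR n → ℂ) (u : VR n → ℂ) (x : VR n) : ℂ :=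
  ((2 * Real.pi : ℂ) ^ n)⁻¹ *
    ∫ ξ, Complex.exp (Complex.I * (inner ℝ x ξ : ℝ)) * a x ξ * fourierT u ξ

/-- The class `L^l(U)` of pseudodifferential operators of order `l` on an open set `U` of `ℝ^n`
(`A u` is considered as a function on `U`). -/
def IsPseudodiff {n : ℕ} (l : ℝ) (U : Set (VR n)) (A : TestFun U → VR n → ℂ) : Prop :=
  ∃ a : VR n → VR n → ℂ, IsSymbol l U a ∧ ∀ u : TestFun U, ∀ x ∈ U, A u x = psiOp a u.toFun x

/-- The class `L^{-∞}(U) = ⋂ L^l(U)`. -/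
def IsSmoothingPseudodiff {n : ℕ} (U : Set (VR n)) (A : TestFun U → VR n → ℂ) : Prop :=
  ∀ l : ℝ, IsPseudodiff l U A

/-- `A` is an integral operator on `U` with a smooth kernel. -/
def HasSmoothKernel {n : ℕ} (U : Set (VR n)) (A : TestFun U → VR n → ℂ) : Prop :=
  ∃ K : VR n → VR n → ℂ, ContDiffOn ℝ ∞ (fun p : VR n × VR n => K p.1 p.2) (U ×ˢ U) ∧
    ∀ u : TestFun U, ∀ x ∈ U, A u x = ∫ y, K x y * u.toFun y

/-- The integrand `e^{i (m - m') · ξ} a(m, ξ) φ(m')` of an oscillatory integral. -/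
noncomputable def oscIntegrand {n : ℕ} (a : VR n → VR n → ℂ) (φ : VR n → ℂ) (m m' ξ : VR n) : ℂ :=
  Complex.exp (Complex.I * (inner ℝ (m - m') ξ : ℝ)) * a m ξ * φ m'

/-!
The operator `π(f)` is averaging over the group, and Fourier inversion for the test function turns
it into the operator with the symbol `e^{-i m · ξ} f̂(m, ξ)`. So all is about the smoothness and the
decay in `ξ` of the oscillatory integral `f̂(m, ξ) = ∫ f(g) e^{i (g⁻¹ m) · ξ} dg`.

*Decay.* On the regular set the phase is nowhere stationary in `g`, for `ξ ≠ 0`. A left derivative `dL(X)` of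
`e^{i (g⁻¹ m) · ξ}` is the multiplication by `i (g⁻¹ dρ(X) m) · ξ`. When the vectors `dρ(X) m`, for
`X` in the Lie algebra, span `V_ℝ`, a combination of these, with coefficients the entries of `ρ(g)`,
is the multiplication by `i ξ_l`. As the integral of a left derivative vanishes
(`PrehomogeneousSpace.integral_hasLieDeriv_eq_zero`), the factor `ξ_l` can be traded for left
derivatives of `f` times matrix coefficients (`PrehomogeneousSpace.exists_mul_fHat_eq`), and this
can be repeated. The class of functions on `G` that appear is `PrehomogeneousSpace.Amplitude`; they
are integrable because the matrix coefficients grow at most exponentially in `|g|`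
(`PrehomogeneousSpace.exists_abs_realRep_le`), which is Grönwall's inequality along the curves
that define `|g|`. That every element of `G` is the end point of such a curve rests on Cartan's
argument that `exp` covers a neighbourhood of the unit element
(`PrehomogeneousSpace.eventually_mem_exp_lieAlg`).

*The regular set.* By `PrehomogeneousSpace.mem_regularSet_iff`, a real point lies in the dense orbit
if and only if the vectors `dρ(X) m`, for real `X`, span `V_ℝ`; in particular this set is open. The
algebra behind it is generic smoothness of the orbit map in characteristic zero
(`MvPolynomial.exists_tangent_vectors`), and that the Lie algebra of `GC` is the complexification of
that of `G_ℝ`.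

*Smoothness.* Derivatives of `f̂` in `m` and `ξ` only produce matrix coefficients of `ρ(g⁻¹)` and
polynomials in `(m, ξ)`, so that they stay in the class `PrehomogeneousSpace.Transform`, whose
members decrease rapidly in `ξ`. This gives the symbol estimates, and the smooth kernel
`(2π)^{-n} ∫ e^{-i m' · ξ} f̂(m, ξ) dξ`.
-/

/-! ### Tangent vectors at a zero of an ideal -/

/-- Algebraically independent elements of a finitely generated field extension in characteristic
zero have independent differentials: there is a derivation with prescribed values `c` on them,
written here as a homomorphism to the dual numbers. The extension is formally smooth over the
polynomial ring in the `y i`, because it is so over the fraction field of this ring, which is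
perfect. -/
theorem AlgebraicIndependent.exists_dualNumber_lift {k L ι : Type} [Field k] [CharZero k] [Field L]
    [Algebra k L] [Algebra.EssFiniteType k L] {y : ι → L} (hy : AlgebraicIndependent k y)
    (c : ι → L) : ∃ Φ : L →ₐ[k] DualNumber L, (∀ x, (Φ x).fst = x) ∧
      ∀ i, (Φ (y i)).snd = c i := by
  let R := MvPolynomial ι k
  let F := FractionRing R
  let _ : Algebra R L := (MvPolynomial.aeval y).toAlgebra
  have hinj : Function.Injective (algebraMap R L) := hy
  have _ : FaithfulSMul R L := (faithfulSMul_iff_algebraMap_injective R L).2 hinj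
  have _ : IsScalarTower k R L := IsScalarTower.of_algebraMap_eq fun x => by
    change _ = MvPolynomial.aeval y (MvPolynomial.C x)
    simp
  let _ : Algebra F L := FractionRing.liftAlgebra R L
  have _ : IsScalarTower R F L := FractionRing.isScalarTower_liftAlgebra R L
  have _ : IsScalarTower k F L := IsScalarTower.of_algebraMap_eq fun x => by
    rw [IsScalarTower.algebraMap_apply k R F, ← IsScalarTower.algebraMap_apply R F L,
      IsScalarTower.algebraMap_apply k R L]
  have _ : Algebra.EssFiniteType F L := Algebra.EssFiniteType.of_comp k F L
  have _ : CharZero F := charZero_of_injective_algebraMap (FaithfulSMul.algebraMap_injective k F)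
  have _ : Algebra.FormallySmooth F L := inferInstance
  have _ : Algebra.FormallySmooth R F := .of_isLocalization (nonZeroDivisors R)
  have _ : Algebra.FormallySmooth R L := .comp R F L
  let ψ : R →ₐ[k] DualNumber L :=
    MvPolynomial.aeval fun i => TrivSqZeroExt.inl (y i) + TrivSqZeroExt.inr (c i)
  let _ : Algebra R (DualNumber L) := ψ.toAlgebra
  have hfst : ∀ r : R, (ψ r).fst = MvPolynomial.aeval y r := by
    intro r
    have : (TrivSqZeroExt.fstHom k L L).comp ψ = MvPolynomial.aeval y := by
      apply MvPolynomial.algHom_ext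
      intro i
      simp [ψ]
    exact DFunLike.congr_fun this r
  let g : DualNumber L →ₐ[R] L :=
    { (TrivSqZeroExt.fstHom k L L).toRingHom with commutes' := fun r => hfst r }
  have hg : Function.Surjective g := fun x => ⟨TrivSqZeroExt.inl x, rfl⟩
  have hker : IsNilpotent (RingHom.ker (g : DualNumber L →+* L)) := by
    refine ⟨2, ?_⟩
    rw [Ideal.zero_eq_bot, eq_bot_iff, sq (RingHom.ker (g : DualNumber L →+* L)), Ideal.mul_le]
    intro r hr s hs
    have hr' : r.fst = 0 := hr
    have hs' : s.fst = 0 := hs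
    rw [Ideal.mem_bot]
    ext
    · simp [hr', hs']
    · simp [hr', hs']
  let Φ := Algebra.FormallySmooth.liftOfSurjective (AlgHom.id R L) g hg hker
  have hΦ : ∀ r : R, Φ (algebraMap R L r) = ψ r := fun r => Φ.commutes r
  refine ⟨{ Φ.toRingHom with commutes' := ?_ }, ?_, ?_⟩
  · intro x
    change Φ (algebraMap k L x) = _
    rw [IsScalarTower.algebraMap_apply k R L, hΦ]
    exact MvPolynomial.aeval_C _ x
  · exact fun x => Algebra.FormallySmooth.liftOfSurjective_apply (AlgHom.id R L) g hg hker x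
  · intro i
    change (Φ (y i)).snd = c i
    have : y i = algebraMap R L (MvPolynomial.X i) := by
      change _ = MvPolynomial.aeval y _
      simp
    have hX : ψ (MvPolynomial.X i) = TrivSqZeroExt.inl (y i) + TrivSqZeroExt.inr (c i) :=
      MvPolynomial.aeval_X _ i
    rw [this, hΦ, hX]
    simp

/-- A homomorphism to the dual numbers obeys the chain rule. -/
theorem MvPolynomial.snd_dualNumber_algHom {k L τ : Type} [Fintype τ] [Field k] [Field L]
    [Algebra k L] (Ψ : MvPolynomial τ k →ₐ[k] DualNumber L) (p : MvPolynomial τ k) :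
    (Ψ p).snd = ∑ a, (Ψ (X a)).snd * (Ψ (pderiv a p)).fst := by
  classical
  induction p using MvPolynomial.induction_on with
  | C c =>
    rw [show Ψ (C c) = algebraMap k _ c from Ψ.commutes c]
    simp [TrivSqZeroExt.algebraMap_eq_inl']
  | add p q hp hq => simp [hp, hq, mul_add, Finset.sum_add_distrib]
  | mul_X p b hp =>
    simp only [map_mul, TrivSqZeroExt.snd_mul, hp, Derivation.leibniz, map_add,
      TrivSqZeroExt.fst_add, smul_eq_mul, pderiv_X, TrivSqZeroExt.fst_mul, mul_add,
      Finset.sum_add_distrib]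
    simp [Pi.single_apply, Finset.smul_sum, apply_ite, Finset.sum_ite_eq, mul_comm, mul_assoc]

/-- If no nonzero polynomial in the `Y i` lies in the ideal `I`, then there is a zero of `I` at
which the differentials of the `Y i` are linearly independent on the Zariski tangent space of `I`.
This is generic smoothness of the dominant map with the components `Y i`. -/
theorem MvPolynomial.exists_tangent_vectors {τ : Type} [Fintype τ] {n : ℕ}
    (I : Ideal (MvPolynomial τ ℂ)) (Y : Fin n → MvPolynomial τ ℂ)
    (hY : ∀ q : MvPolynomial (Fin n) ℂ, q ≠ 0 → aeval Y q ∉ I) :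
    ∃ z ∈ zeroLocus ℂ I, ∃ v : Fin n → τ → ℂ,
      (∀ j, ∀ p ∈ I, ∑ a, v j a * eval z (pderiv a p) = 0) ∧
      ∀ i j, ∑ a, v j a * eval z (pderiv a (Y i)) = if i = j then 1 else 0 := by
  classical
  let S : Submonoid (MvPolynomial τ ℂ) :=
    (nonZeroDivisors (MvPolynomial (Fin n) ℂ)).map (aeval Y : _ →ₐ[ℂ] MvPolynomial τ ℂ)
  have hS : Disjoint (I : Set (MvPolynomial τ ℂ)) S := by
    rw [Set.disjoint_left]
    rintro _ hI ⟨q, hq, rfl⟩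
    exact hY q (nonZeroDivisors.ne_zero hq) hI
  -- a component of the zero set of `I` on which the `Y i` stay algebraically independent
  obtain ⟨𝔭, h𝔭, hI𝔭, hdisj⟩ := Ideal.exists_le_prime_disjoint I S hS
  let A := MvPolynomial τ ℂ ⧸ 𝔭
  let L := FractionRing A
  let π : MvPolynomial τ ℂ →ₐ[ℂ] L := (IsScalarTower.toAlgHom ℂ A L).comp (Ideal.Quotient.mkₐ ℂ 𝔭)
  have hπ : ∀ p, π p = 0 ↔ p ∈ 𝔭 := fun p => by
    change algebraMap A L (Ideal.Quotient.mk 𝔭 p) = 0 ↔ _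
    rw [FaithfulSMul.algebraMap_eq_zero_iff, Ideal.Quotient.eq_zero_iff_mem]
  have _ : Algebra.EssFiniteType ℂ L :=
    Algebra.EssFiniteType.comp ℂ A L
  have halg : AlgebraicIndependent ℂ fun i => π (Y i) := by
    rw [algebraicIndependent_iff]
    intro q hq
    by_contra hne
    rw [← comp_aeval_apply, hπ] at hq
    exact Set.disjoint_left.1 hdisj hq ⟨q, mem_nonZeroDivisors_of_ne_zero hne, rfl⟩
  choose Φ hΦ1 hΦ2 using fun j : Fin n => halg.exists_dualNumber_lift fun i => if i = j then 1 else 0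
  -- a common denominator of the components of the derivations; the point `z` has to avoid its zeros
  obtain ⟨b, hb⟩ := IsLocalization.exist_integer_multiples_of_finset (nonZeroDivisors A)
    (Finset.univ.image fun ja : Fin n × τ => (Φ ja.1 (π (X ja.2))).snd)
  obtain ⟨s, hs⟩ := Ideal.Quotient.mk_surjective (b : A)
  have hs𝔭 : s ∉ 𝔭 := fun h => by
    have := nonZeroDivisors.ne_zero b.2
    rw [← hs, Ne, Ideal.Quotient.eq_zero_iff_mem] at this
    exact this h
  have hw : ∀ j a, ∃ w : MvPolynomial τ ℂ, π w = π s * (Φ j (π (X a))).snd := by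
    intro j a
    obtain ⟨w', hw'⟩ := hb _ (Finset.mem_image_of_mem _ (Finset.mem_univ (j, a)))
    obtain ⟨w, rfl⟩ := Ideal.Quotient.mk_surjective w'
    refine ⟨w, hw'.trans ?_⟩
    rw [Algebra.smul_def, ← hs]
    rfl
  choose w hw using hw
  have key : ∀ j p, π (∑ a, w j a * pderiv a p) = π s * (Φ j (π p)).snd := by
    intro j p
    rw [show Φ j (π p) = ((Φ j).comp π) p from rfl, snd_dualNumber_algHom, Finset.mul_sum, map_sum]
    refine Finset.sum_congr rfl fun a _ => ?_
    change _ = π s * ((Φ j (π (X a))).snd * (Φ j (π (pderiv a p))).fst)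
    rw [map_mul, hw, hΦ1, mul_assoc]
  obtain ⟨z, hz, hsz⟩ : ∃ z ∈ zeroLocus ℂ 𝔭, eval z s ≠ 0 := by
    by_contra! hcon
    apply hs𝔭
    rw [← h𝔭.isRadical.radical, ← vanishingIdeal_zeroLocus_eq_radical (K := ℂ),
      mem_vanishingIdeal_iff]
    intro x hx
    simpa [aeval_eq_eval] using hcon x hx
  have hz' : ∀ p ∈ 𝔭, eval z p = 0 := fun p hp => by
    simpa [aeval_eq_eval] using (mem_zeroLocus_iff.1 hz) p hp
  refine ⟨z, zeroLocus_anti_mono hI𝔭 hz, fun j a => eval z (w j a) / eval z s, ?_, ?_⟩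
  · intro j p hp
    have h0 : π (∑ a, w j a * pderiv a p) = 0 := by
      rw [key, (hπ p).2 (hI𝔭 hp), map_zero, TrivSqZeroExt.snd_zero, mul_zero]
    have h1 := hz' _ ((hπ _).1 h0)
    simp only [map_sum, map_mul] at h1
    simp only [div_mul_eq_mul_div, ← Finset.sum_div, h1, zero_div]
  · intro i j
    have h0 : π (∑ a, w j a * pderiv a (Y i) - s * (if i = j then 1 else 0)) = 0 := by
      rw [map_sub, key, hΦ2]
      split_ifs <;> simp
    have h1 := hz' _ ((hπ _).1 h0)
    simp only [map_sub, map_sum, map_mul, sub_eq_zero] at h1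
    simp only [div_mul_eq_mul_div, ← Finset.sum_div, h1]
    split_ifs <;> simp [hsz]

/-! ### Left invariant vector fields on pairs of matrices -/

/-- The point of affine space with the entries of `x` and of `y` as coordinates. A group element
`g` is encoded as `pairCoords g g⁻¹`, which turns regular functions on `GL(N)` into polynomials. -/
def pairCoords {N : ℕ} {K : Type} (x y : Matrix (Fin N) (Fin N) K) :
    (Fin N × Fin N) ⊕ (Fin N × Fin N) → K :=
  Sum.elim (fun ij => x ij.1 ij.2) (fun ij => y ij.1 ij.2)

/-- The vector field `x ↦ x X`, `y ↦ -X y` on pairs of matrices, as a derivation. At the pairs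
`(g, g⁻¹)` it is the left invariant vector field of `X` on `GL(N)`. -/
noncomputable def invField {N : ℕ} {K : Type} [Field K] (X : Matrix (Fin N) (Fin N) K) :
    Derivation K (MvPolynomial ((Fin N × Fin N) ⊕ (Fin N × Fin N)) K)
      (MvPolynomial ((Fin N × Fin N) ⊕ (Fin N × Fin N)) K) :=
  MvPolynomial.mkDerivation K (Sum.elim
    (fun ij => ∑ c, MvPolynomial.C (X c ij.2) * MvPolynomial.X (Sum.inl (ij.1, c)))
    (fun ij => -∑ c, MvPolynomial.C (X ij.1 c) * MvPolynomial.X (Sum.inr (c, ij.2))))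

theorem eval_invField_X_inl {N : ℕ} {K : Type} [Field K] (X x y : Matrix (Fin N) (Fin N) K)
    (i j : Fin N) : MvPolynomial.eval (pairCoords x y) (invField X (MvPolynomial.X (Sum.inl (i, j))))
      = (x * X) i j := by
  simp [invField, MvPolynomial.mkDerivation_X, pairCoords, Matrix.mul_apply, mul_comm]

theorem eval_invField_X_inr {N : ℕ} {K : Type} [Field K] (X x y : Matrix (Fin N) (Fin N) K)
    (i j : Fin N) : MvPolynomial.eval (pairCoords x y) (invField X (MvPolynomial.X (Sum.inr (i, j))))
      = -(X * y) i j := by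
  simp [invField, MvPolynomial.mkDerivation_X, pairCoords, Matrix.mul_apply]

theorem invField_add {N : ℕ} {K : Type} [Field K] (X Y : Matrix (Fin N) (Fin N) K) :
    invField (X + Y) = invField X + invField Y := by
  apply MvPolynomial.derivation_ext
  rintro (⟨i, j⟩ | ⟨i, j⟩)
  · simp [invField, MvPolynomial.mkDerivation_X, add_mul, Finset.sum_add_distrib]
  · simp [invField, MvPolynomial.mkDerivation_X, add_mul, Finset.sum_add_distrib]
    abel

theorem invField_smul {N : ℕ} {K : Type} [Field K] (c : K) (X : Matrix (Fin N) (Fin N) K) :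
    invField (c • X) = c • invField X := by
  apply MvPolynomial.derivation_ext
  rintro (⟨i, j⟩ | ⟨i, j⟩)
  · simp [invField, MvPolynomial.mkDerivation_X, mul_assoc, Finset.smul_sum, MvPolynomial.smul_eq_C_mul]
  · simp [invField, MvPolynomial.mkDerivation_X, mul_assoc, Finset.smul_sum, MvPolynomial.smul_eq_C_mul]

theorem MvPolynomial.eval_derivation {τ K : Type} [Fintype τ] [Field K]
    (D : Derivation K (MvPolynomial τ K) (MvPolynomial τ K)) (z : τ → K) (p : MvPolynomial τ K) :
    eval z (D p) = ∑ a, eval z (D (X a)) * eval z (pderiv a p) := by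
  classical
  induction p using MvPolynomial.induction_on with
  | C c => simp [derivation_C]
  | add p q hp hq => simp [hp, hq, mul_add, Finset.sum_add_distrib]
  | mul_X p b hp =>
    simp only [Derivation.leibniz, map_add, smul_eq_mul, map_mul, hp, pderiv_X, mul_add,
      Finset.sum_add_distrib]
    simp [Pi.single_apply, apply_ite, Finset.mul_sum, mul_comm, mul_left_comm]

/-- The chain rule for a polynomial along a curve. -/
theorem MvPolynomial.hasDerivWithinAt_eval {τ K : Type} [Fintype τ] [RCLike K] {c : ℝ → τ → K}
    {c' : τ → K} {s : Set ℝ} {t : ℝ} (hc : ∀ a, HasDerivWithinAt (fun u => c u a) (c' a) s t)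
    (p : MvPolynomial τ K) : HasDerivWithinAt (fun u => eval (c u) p)
      (∑ a, c' a * eval (c t) (pderiv a p)) s t := by
  classical
  induction p using MvPolynomial.induction_on with
  | C c => simpa using hasDerivWithinAt_const t s c
  | add p q hp hq => simpa only [map_add, mul_add, Finset.sum_add_distrib] using! hp.add hq
  | mul_X p b hp =>
    have h := hp.mul (hc b)
    simp only [Derivation.leibniz, map_add, smul_eq_mul, map_mul, pderiv_X, mul_add,
      Finset.sum_add_distrib, eval_X]
    convert! h using 1
    simp only [Pi.single_apply, apply_ite (eval (c t)), map_one, map_zero, mul_ite, mul_one,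
      mul_zero, Finset.sum_ite_eq, Finset.mem_univ, if_true, Finset.sum_mul]
    rw [add_comm]
    congr 1
    · exact Finset.sum_congr rfl fun a _ => by ring
    · ring

/-- The derivative of a polynomial along a curve whose velocity at the time `t` is the value of the
vector field `invField X`. -/
theorem hasDerivWithinAt_eval_pairCoords {N : ℕ} {K : Type} [RCLike K]
    {x y : ℝ → Matrix (Fin N) (Fin N) K} {X : Matrix (Fin N) (Fin N) K} {s : Set ℝ} {t : ℝ}
    (hx : ∀ i j, HasDerivWithinAt (fun u => x u i j) ((x t * X) i j) s t)
    (hy : ∀ i j, HasDerivWithinAt (fun u => y u i j) (-(X * y t) i j) s t)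
    (p : MvPolynomial ((Fin N × Fin N) ⊕ (Fin N × Fin N)) K) :
    HasDerivWithinAt (fun u => MvPolynomial.eval (pairCoords (x u) (y u)) p)
      (MvPolynomial.eval (pairCoords (x t) (y t)) (invField X p)) s t := by
  rw [MvPolynomial.eval_derivation]
  refine MvPolynomial.hasDerivWithinAt_eval ?_ p
  rintro (⟨i, j⟩ | ⟨i, j⟩)
  · rw [eval_invField_X_inl]
    exact hx i j
  · rw [eval_invField_X_inr]
    exact hy i j

section MatrixExp

attribute [local instance] Matrix.linftyOpNormedRing Matrix.linftyOpNormedAlgebra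

theorem hasDerivAt_matrix_exp_smul {N : ℕ} {K : Type} [RCLike K] (X : Matrix (Fin N) (Fin N) K)
    (t : ℝ) (i j : Fin N) : HasDerivAt (fun u : ℝ => (NormedSpace.exp (u • X)) i j)
      ((NormedSpace.exp (t • X) * X) i j) t := by
  have _ : CompleteSpace (Matrix (Fin N) (Fin N) K) := FiniteDimensional.complete ℝ _
  have h := hasDerivAt_exp_smul_const (𝕂 := ℝ) X t
  exact (LinearMap.toContinuousLinearMap (Matrix.entryLinearMap ℝ K i j)).hasFDerivAt.comp_hasDerivAt
    t h

theorem analyticAt_matrix_exp_smul {N : ℕ} {K : Type} [RCLike K] (X : Matrix (Fin N) (Fin N) K)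
    (t : ℝ) (i j : Fin N) : AnalyticAt ℝ (fun u : ℝ => (NormedSpace.exp (u • X)) i j) t := by
  have _ : CompleteSpace (Matrix (Fin N) (Fin N) K) := FiniteDimensional.complete ℝ _
  have h1 : AnalyticAt ℝ (fun u : ℝ => u • X) t := analyticAt_id.smul analyticAt_const
  have h2 : AnalyticAt ℝ (NormedSpace.exp : Matrix (Fin N) (Fin N) K → _) (t • X) :=
    NormedSpace.exp_analytic (𝕂 := ℝ) _
  exact ((LinearMap.toContinuousLinearMap (Matrix.entryLinearMap ℝ K i j)).analyticAt _).comp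
    (AnalyticAt.comp (f := fun u : ℝ => u • X) h2 h1)

theorem matrix_exp_mul_comm {N : ℕ} {K : Type} [RCLike K] (X : Matrix (Fin N) (Fin N) K) :
    NormedSpace.exp X * X = X * NormedSpace.exp X := by
  have _ : CompleteSpace (Matrix (Fin N) (Fin N) K) := FiniteDimensional.complete ℝ _
  exact ((Commute.refl X).exp_left).eq

end MatrixExp

theorem hasDerivAt_matrix_exp_neg_smul {N : ℕ} {K : Type} [RCLike K] (X : Matrix (Fin N) (Fin N) K)
    (t : ℝ) (i j : Fin N) : HasDerivAt (fun u : ℝ => (NormedSpace.exp (-(u • X))) i j)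
      (-(X * NormedSpace.exp (-(t • X))) i j) t := by
  have h := hasDerivAt_matrix_exp_smul (-X) t i j
  simp only [smul_neg] at h
  convert! h using 1
  rcases eq_or_ne t 0 with rfl | ht
  · simp [NormedSpace.exp_zero]
  · have := matrix_exp_mul_comm (-(t • X))
    simp only [mul_neg, neg_mul, neg_inj, Matrix.mul_smul, Matrix.smul_mul] at this
    have := smul_right_injective _ ht this
    simp [this]

theorem hasDerivAt_eval_exp {N : ℕ} {K : Type} [RCLike K] (g h X : Matrix (Fin N) (Fin N) K)
    (p : MvPolynomial ((Fin N × Fin N) ⊕ (Fin N × Fin N)) K) (t : ℝ) :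
    HasDerivAt (fun u : ℝ => MvPolynomial.eval
        (pairCoords (g * NormedSpace.exp (u • X)) (NormedSpace.exp (-(u • X)) * h)) p)
      (MvPolynomial.eval (pairCoords (g * NormedSpace.exp (t • X)) (NormedSpace.exp (-(t • X)) * h))
        (invField X p)) t := by
  rw [← hasDerivWithinAt_univ]
  refine hasDerivWithinAt_eval_pairCoords (fun i j => ?_) (fun i j => ?_) p
  · rw [hasDerivWithinAt_univ, mul_assoc]
    simp only [Matrix.mul_apply (M := g)]
    exact HasDerivAt.fun_sum fun c _ => (hasDerivAt_matrix_exp_smul X t c j).const_mul _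
  · rw [hasDerivWithinAt_univ, ← mul_assoc]
    simp only [Matrix.mul_apply (N := h), ← Finset.sum_neg_distrib, ← neg_mul]
    exact HasDerivAt.fun_sum fun c _ => (hasDerivAt_matrix_exp_neg_smul X t i c).mul_const _

/-- A polynomial all of whose iterated derivatives along a left invariant vector field vanish at a
point vanishes along the integral curve, by analyticity. -/
theorem eval_exp_eq_zero {N : ℕ} {K : Type} [RCLike K] (g h X : Matrix (Fin N) (Fin N) K)
    (p : MvPolynomial ((Fin N × Fin N) ⊕ (Fin N × Fin N)) K)
    (hp : ∀ k : ℕ, MvPolynomial.eval (pairCoords g h) ((invField X)^[k] p) = 0) (t : ℝ) :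
    MvPolynomial.eval (pairCoords (g * NormedSpace.exp (t • X)) (NormedSpace.exp (-(t • X)) * h)) p
      = 0 := by
  set u : MvPolynomial ((Fin N × Fin N) ⊕ (Fin N × Fin N)) K → ℝ → K := fun p t => MvPolynomial.eval
    (pairCoords (g * NormedSpace.exp (t • X)) (NormedSpace.exp (-(t • X)) * h)) p with hu
  have hana : ∀ p t, AnalyticAt ℝ (u p) t := by
    intro p t
    induction p using MvPolynomial.induction_on with
    | C c => simpa [hu] using analyticAt_const
    | add p q hp hq => simpa only [hu, map_add] using! hp.add hq
    | mul_X p b hp =>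
      have hb : AnalyticAt ℝ (u (MvPolynomial.X b)) t := by
        rcases b with ⟨i, j⟩ | ⟨i, j⟩
        · simp only [hu, MvPolynomial.eval_X, pairCoords, Sum.elim_inl, Matrix.mul_apply]
          exact Finset.analyticAt_fun_sum _ fun c _ =>
            analyticAt_const.mul (analyticAt_matrix_exp_smul X t c j)
        · simp only [hu, MvPolynomial.eval_X, pairCoords, Sum.elim_inr, Matrix.mul_apply, ← smul_neg]
          exact Finset.analyticAt_fun_sum _ fun c _ =>
            (analyticAt_matrix_exp_smul (-X) t i c).mul analyticAt_const
      simpa only [hu, map_mul] using! hp.mul hb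
  have hder : ∀ (k : ℕ), iteratedDeriv k (u p) = u ((invField X)^[k] p) := by
    intro k
    induction k with
    | zero => simp
    | succ k ih =>
      rw [iteratedDeriv_succ, ih, Function.iterate_succ_apply']
      ext t
      exact (hasDerivAt_eval_exp g h X _ t).deriv
  have hzero : u p =ᶠ[𝓝 0] 0 := by
    change ∀ᶠ t in 𝓝 0, u p t = 0
    rw [← analyticOrderAt_eq_top, ENat.eq_top_iff_forall_ge]
    intro k
    rw [natCast_le_analyticOrderAt_iff_iteratedDeriv_eq_zero (hana p 0)]
    intro i _
    rw [hder]
    simpa [hu, NormedSpace.exp_zero] using hp i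
  have := AnalyticOnNhd.eqOn_zero_of_preconnected_of_eventuallyEq_zero (U := Set.univ)
    (fun t _ => hana p t) isPreconnected_univ (Set.mem_univ 0) hzero
  exact this (Set.mem_univ t)

/-! ### One-parameter subgroups of the general linear group -/

/-- The coordinates of `g` and of `g⁻¹`, as a point of affine space. -/
def glCoords {N : ℕ} {K : Type} [Field K] (g : GL (Fin N) K) :
    (Fin N × Fin N) ⊕ (Fin N × Fin N) → K :=
  pairCoords (g : Matrix (Fin N) (Fin N) K) ((g⁻¹ : GL (Fin N) K) : Matrix (Fin N) (Fin N) K)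

section MatrixExp

attribute [local instance] Matrix.linftyOpNormedRing Matrix.linftyOpNormedAlgebra

theorem map_matrix_exp {N : ℕ} {K L : Type} [RCLike K] [RCLike L] (f : K →+* L)
    (hf : Continuous f) (X : Matrix (Fin N) (Fin N) K) :
    (NormedSpace.exp X).map f = NormedSpace.exp (X.map f) := by
  have _ : CompleteSpace (Matrix (Fin N) (Fin N) K) := FiniteDimensional.complete ℝ _
  exact NormedSpace.map_exp (f.mapMatrix : Matrix (Fin N) (Fin N) K →+* Matrix (Fin N) (Fin N) L)
    (Continuous.matrix_map continuous_id hf) X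

end MatrixExp

/-- The exponential of a matrix over `ℝ` or `ℂ`, as an invertible matrix. -/
noncomputable def gexp {N : ℕ} {K : Type} [RCLike K] (X : Matrix (Fin N) (Fin N) K) :
    GL (Fin N) K where
  val := NormedSpace.exp X
  inv := NormedSpace.exp (-X)
  val_inv := by
    rw [← Matrix.exp_add_of_commute _ _ (Commute.refl X).neg_right, add_neg_cancel,
      NormedSpace.exp_zero]
  inv_val := by
    rw [← Matrix.exp_add_of_commute _ _ (Commute.refl X).neg_left, neg_add_cancel,
      NormedSpace.exp_zero]

theorem expGL_eq_gexp {N : ℕ} (X : Matrix (Fin N) (Fin N) ℝ) : expGL X = gexp X := rfl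

theorem map_gexp {N : ℕ} {K L : Type} [RCLike K] [RCLike L] (f : K →+* L)
    (hf : Continuous f) (X : Matrix (Fin N) (Fin N) K) :
    Matrix.GeneralLinearGroup.map f (gexp X) = gexp (X.map f) :=
  Units.ext (map_matrix_exp f hf X)

theorem glCoords_mul_gexp {N : ℕ} {K : Type} [RCLike K] (g : GL (Fin N) K)
    (X : Matrix (Fin N) (Fin N) K) : glCoords (g * gexp X) =
      pairCoords ((g : Matrix (Fin N) (Fin N) K) * NormedSpace.exp X)
        (NormedSpace.exp (-X) * ((g⁻¹ : GL (Fin N) K) : Matrix (Fin N) (Fin N) K)) := by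
  rw [glCoords, mul_inv_rev]
  rfl

theorem gexp_zero {N : ℕ} {K : Type} [RCLike K] : gexp (0 : Matrix (Fin N) (Fin N) K) = 1 :=
  Units.ext NormedSpace.exp_zero

theorem hasDerivAt_eval_gexp {N : ℕ} {K : Type} [RCLike K] (g : GL (Fin N) K)
    (X : Matrix (Fin N) (Fin N) K)
    (p : MvPolynomial ((Fin N × Fin N) ⊕ (Fin N × Fin N)) K) (t : ℝ) :
    HasDerivAt (fun u : ℝ => MvPolynomial.eval (glCoords (g * gexp (u • X))) p)
      (MvPolynomial.eval (glCoords (g * gexp (t • X))) (invField X p)) t := by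
  simp only [glCoords_mul_gexp]
  exact hasDerivAt_eval_exp _ _ X p t

/-- The left translate by `h`: the substitution `x ↦ h x`, `y ↦ y h⁻¹`. -/
noncomputable def leftTranslate {N : ℕ} {K : Type} [Field K] (h : GL (Fin N) K) :
    MvPolynomial ((Fin N × Fin N) ⊕ (Fin N × Fin N)) K →ₐ[K]
      MvPolynomial ((Fin N × Fin N) ⊕ (Fin N × Fin N)) K :=
  MvPolynomial.aeval (Sum.elim
    (fun ij => ∑ c, MvPolynomial.C (h ij.1 c) * MvPolynomial.X (Sum.inl (c, ij.2)))
    (fun ij => ∑ c, MvPolynomial.C ((h⁻¹ : GL (Fin N) K) c ij.2)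
      * MvPolynomial.X (Sum.inr (ij.1, c))))

theorem eval_leftTranslate {N : ℕ} {K : Type} [Field K] (h g : GL (Fin N) K)
    (p : MvPolynomial ((Fin N × Fin N) ⊕ (Fin N × Fin N)) K) :
    MvPolynomial.eval (glCoords g) (leftTranslate h p) = MvPolynomial.eval (glCoords (h * g)) p := by
  have : ((MvPolynomial.aeval (glCoords g)).comp (leftTranslate h) :
      MvPolynomial ((Fin N × Fin N) ⊕ (Fin N × Fin N)) K →ₐ[K] K)
      = MvPolynomial.aeval (glCoords (h * g)) := by
    apply MvPolynomial.algHom_ext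
    rintro (⟨i, j⟩ | ⟨i, j⟩)
    · simp [leftTranslate, glCoords, pairCoords, Matrix.mul_apply]
    · simp only [leftTranslate, glCoords, pairCoords, AlgHom.comp_apply, MvPolynomial.aeval_X,
        Sum.elim_inr, mul_inv_rev, Units.val_mul, Matrix.mul_apply, map_sum, map_mul,
        MvPolynomial.aeval_C]
      exact Finset.sum_congr rfl fun c _ => mul_comm _ _
  simpa [MvPolynomial.aeval_eq_eval] using DFunLike.congr_fun this p

/-- `invField X` is left invariant. -/
theorem invField_leftTranslate {N : ℕ} {K : Type} [Field K] (h : GL (Fin N) K)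
    (X : Matrix (Fin N) (Fin N) K)
    (p : MvPolynomial ((Fin N × Fin N) ⊕ (Fin N × Fin N)) K) :
    invField X (leftTranslate h p) = leftTranslate h (invField X p) := by
  induction p using MvPolynomial.induction_on with
  | C c =>
    rw [show leftTranslate h (MvPolynomial.C c) = MvPolynomial.C c from (leftTranslate h).commutes c]
    simp [MvPolynomial.derivation_C]
  | add p q hp hq => simp [hp, hq]
  | mul_X p b hp =>
    have hb : invField X (leftTranslate h (MvPolynomial.X b))
        = leftTranslate h (invField X (MvPolynomial.X b)) := by
      have hC : ∀ c, leftTranslate h (MvPolynomial.C c) = MvPolynomial.C c :=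
        fun c => (leftTranslate h).commutes c
      rcases b with ⟨i, j⟩ | ⟨i, j⟩
      · simp only [leftTranslate, MvPolynomial.aeval_X, Sum.elim_inl, map_sum,
          Derivation.leibniz, MvPolynomial.derivation_C, mul_zero, add_zero, invField,
          MvPolynomial.mkDerivation_X, Sum.elim_inl, map_mul,
          MvPolynomial.aeval_C, MvPolynomial.algebraMap_eq, Finset.mul_sum, smul_eq_mul]
        rw [Finset.sum_comm]
        exact Finset.sum_congr rfl fun c _ => Finset.sum_congr rfl fun d _ => by ring
      · simp only [leftTranslate, MvPolynomial.aeval_X, Sum.elim_inr, map_sum, map_neg,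
          Derivation.leibniz, MvPolynomial.derivation_C, mul_zero, add_zero, invField,
          MvPolynomial.mkDerivation_X, Sum.elim_inr, map_mul,
          MvPolynomial.aeval_C, MvPolynomial.algebraMap_eq, Finset.mul_sum, smul_eq_mul,
          mul_neg, Finset.sum_neg_distrib]
        rw [Finset.sum_comm]
        exact congrArg (fun x => -x)
          (Finset.sum_congr rfl fun c _ => Finset.sum_congr rfl fun d _ => by ring)
    simp [Derivation.leibniz, hp, hb]

/-! ### The Lie algebras of `GC` and of `G_ℝ` -/

namespace PrehomogeneousSpace

variable {N n : ℕ} (P : PrehomogeneousSpace N n)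

/-- The vanishing ideal of `GC`, in the coordinates of `g` and `g⁻¹`. -/
noncomputable def groupIdeal : Ideal (MvPolynomial ((Fin N × Fin N) ⊕ (Fin N × Fin N)) ℂ) :=
  MvPolynomial.vanishingIdeal ℂ (glCoords '' (P.GC : Set (GL (Fin N) ℂ)))

theorem mem_groupIdeal {p : MvPolynomial ((Fin N × Fin N) ⊕ (Fin N × Fin N)) ℂ} :
    p ∈ P.groupIdeal ↔ ∀ g ∈ P.GC, MvPolynomial.eval (glCoords g) p = 0 := by
  simp [groupIdeal, MvPolynomial.mem_vanishingIdeal_iff, MvPolynomial.aeval_eq_eval]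

/-- The polynomial `(x y - 1)_{ij}` in the coordinates of `x` and `y`. -/
noncomputable def mulInvRelation {N : ℕ} (i j : Fin N) :
    MvPolynomial ((Fin N × Fin N) ⊕ (Fin N × Fin N)) ℂ :=
  ∑ c, MvPolynomial.X (Sum.inl (i, c)) * MvPolynomial.X (Sum.inr (c, j))
    - MvPolynomial.C ((1 : Matrix (Fin N) (Fin N) ℂ) i j)

theorem eval_mulInvRelation {N : ℕ} (x y : Matrix (Fin N) (Fin N) ℂ) (i j : Fin N) :
    MvPolynomial.eval (pairCoords x y) (mulInvRelation i j) = (x * y - 1) i j := by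
  simp [mulInvRelation, pairCoords, Matrix.mul_apply]

theorem mulInvRelation_mem (i j : Fin N) : mulInvRelation i j ∈ P.groupIdeal := by
  rw [mem_groupIdeal]
  intro g _
  rw [glCoords, eval_mulInvRelation]
  simp

/-- `GC` is Zariski closed: the zeros of its vanishing ideal are points of `GC`. The relations
`x y = 1` in the ideal make a zero invertible. -/
theorem exists_of_mem_zeroLocus {z : (Fin N × Fin N) ⊕ (Fin N × Fin N) → ℂ}
    (hz : z ∈ MvPolynomial.zeroLocus ℂ P.groupIdeal) : ∃ g ∈ P.GC, glCoords g = z := by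
  have hz' : ∀ p ∈ P.groupIdeal, MvPolynomial.eval z p = 0 := fun p hp => by
    simpa [MvPolynomial.aeval_eq_eval] using (MvPolynomial.mem_zeroLocus_iff.1 hz) p hp
  let x : Matrix (Fin N) (Fin N) ℂ := Matrix.of fun i j => z (Sum.inl (i, j))
  let y : Matrix (Fin N) (Fin N) ℂ := Matrix.of fun i j => z (Sum.inr (i, j))
  have hzxy : z = pairCoords x y := by
    ext (⟨i, j⟩ | ⟨i, j⟩) <;> rfl
  have hxy : x * y = 1 := by
    ext i j
    have := hz' _ (P.mulInvRelation_mem i j)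
    rw [hzxy, eval_mulInvRelation] at this
    simpa [sub_eq_zero] using this
  refine ⟨⟨x, y, hxy, mul_eq_one_comm.1 hxy⟩, ?_, hzxy.symm⟩
  obtain ⟨I, hI⟩ := P.defined_over_real
  rw [hI]
  intro p hp
  have hmem : MvPolynomial.rename Sum.inl (MvPolynomial.map (algebraMap ℝ ℂ) p) ∈ P.groupIdeal := by
    rw [mem_groupIdeal]
    intro g hg
    rw [MvPolynomial.eval_rename, MvPolynomial.eval_map]
    exact (hI g).1 hg p hp
  have := hz' _ hmem
  rwa [MvPolynomial.eval_rename, MvPolynomial.eval_map] at this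

/-- The Lie algebra of `GC`, as the Zariski tangent space at the unit element. The definition by
the linear conditions on `invField X` makes it a subspace at once; `mem_complexLie_iff` identifies
it with the set of generators of one-parameter subgroups. -/
noncomputable def complexLie : Submodule ℂ (Matrix (Fin N) (Fin N) ℂ) where
  carrier := {X | ∀ p ∈ P.groupIdeal, MvPolynomial.eval (glCoords 1) (invField X p) = 0}
  add_mem' {X Y} hX hY p hp := by simp [invField_add, hX p hp, hY p hp]
  zero_mem' p _ := by
    have : invField (0 : Matrix (Fin N) (Fin N) ℂ) = 0 := by simpa using invField_smul (0 : ℂ) 0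
    simp [this]
  smul_mem' c X hX p hp := by simp [invField_smul, hX p hp]

/-- A left invariant vector field that is tangent to `GC` at one point of `GC` preserves the
vanishing ideal. -/
theorem invField_mem_groupIdeal {X : Matrix (Fin N) (Fin N) ℂ} {g : GL (Fin N) ℂ} (hg : g ∈ P.GC)
    (hX : ∀ p ∈ P.groupIdeal, MvPolynomial.eval (glCoords g) (invField X p) = 0)
    {p : MvPolynomial ((Fin N × Fin N) ⊕ (Fin N × Fin N)) ℂ} (hp : p ∈ P.groupIdeal) :
    invField X p ∈ P.groupIdeal := by
  rw [mem_groupIdeal]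
  intro h hh
  have hmem : leftTranslate (h * g⁻¹) p ∈ P.groupIdeal := by
    rw [mem_groupIdeal]
    intro k hk
    rw [eval_leftTranslate]
    exact P.mem_groupIdeal.1 hp _ (mul_mem (mul_mem hh (inv_mem hg)) hk)
  have := hX _ hmem
  rwa [invField_leftTranslate, eval_leftTranslate, inv_mul_cancel_right] at this

theorem mem_complexLie_of_tangent {X : Matrix (Fin N) (Fin N) ℂ} {g : GL (Fin N) ℂ} (hg : g ∈ P.GC)
    (hX : ∀ p ∈ P.groupIdeal, MvPolynomial.eval (glCoords g) (invField X p) = 0) :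
    X ∈ P.complexLie := fun _ hp =>
  P.mem_groupIdeal.1 (P.invField_mem_groupIdeal hg hX hp) _ (one_mem _)

theorem mem_complexLie_iff {X : Matrix (Fin N) (Fin N) ℂ} :
    X ∈ P.complexLie ↔ ∀ t : ℝ, gexp (t • X) ∈ P.GC := by
  constructor
  · intro hX t
    have hiter : ∀ p ∈ P.groupIdeal, ∀ k : ℕ, (invField X)^[k] p ∈ P.groupIdeal := by
      intro p hp k
      induction k with
      | zero => exact hp
      | succ k ih =>
        rw [Function.iterate_succ_apply']
        exact P.invField_mem_groupIdeal (one_mem _) hX ih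
    have hz : glCoords (gexp (t • X)) ∈ MvPolynomial.zeroLocus ℂ P.groupIdeal := by
      rw [MvPolynomial.mem_zeroLocus_iff]
      intro p hp
      have := eval_exp_eq_zero 1 1 X p (fun k => by
        simpa [glCoords] using P.mem_groupIdeal.1 (hiter p hp k) 1 (one_mem _)) t
      simpa [MvPolynomial.aeval_eq_eval, glCoords, gexp] using! this
    obtain ⟨g, hg, hgz⟩ := P.exists_of_mem_zeroLocus hz
    suffices g = gexp (t • X) from this ▸ hg
    ext i j
    exact congrFun hgz (Sum.inl (i, j))
  · intro hX p hp
    have h := hasDerivAt_eval_gexp 1 X p 0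
    have h0 : (fun u : ℝ => MvPolynomial.eval (glCoords (1 * gexp (u • X))) p) = fun _ => 0 := by
      ext u
      rw [one_mul]
      exact P.mem_groupIdeal.1 hp _ (hX u)
    rw [h0] at h
    simpa [gexp_zero] using (hasDerivAt_const (0 : ℝ) (0 : ℂ)).unique h |>.symm

theorem mem_lieAlg_iff {X : Matrix (Fin N) (Fin N) ℝ} :
    X ∈ P.lieAlg ↔ X.map (algebraMap ℝ ℂ) ∈ P.complexLie := by
  rw [mem_complexLie_iff]
  refine forall_congr' fun t => ?_
  change Matrix.GeneralLinearGroup.map (algebraMap ℝ ℂ) (gexp (t • X)) ∈ P.GC ↔ _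
  rw [map_gexp (algebraMap ℝ ℂ) Complex.continuous_ofReal]
  have : (t • X).map (algebraMap ℝ ℂ) = t • X.map (algebraMap ℝ ℂ) := by
    ext i j; simp
  rw [this]

/-- The Lie algebra of `G_ℝ` as a linear subspace. -/
noncomputable def lieSubmodule : Submodule ℝ (Matrix (Fin N) (Fin N) ℝ) where
  carrier := P.lieAlg
  add_mem' {X Y} hX hY := by
    rw [mem_lieAlg_iff] at *
    rw [Matrix.map_add _ (map_add _)]
    exact add_mem hX hY
  zero_mem' := by
    rw [mem_lieAlg_iff, Matrix.map_zero _ (map_zero _)]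
    exact zero_mem _
  smul_mem' c X hX := by
    rw [mem_lieAlg_iff] at *
    have : (c • X).map (algebraMap ℝ ℂ) = (c : ℂ) • X.map (algebraMap ℝ ℂ) := by
      ext i j; simp
    rw [this]
    exact P.complexLie.smul_mem _ hX

/-- `GC` is stable under complex conjugation, being defined over `ℝ`. -/
theorem conj_mem_GC {g : GL (Fin N) ℂ} (hg : g ∈ P.GC) :
    Matrix.GeneralLinearGroup.map (starRingEnd ℂ) g ∈ P.GC := by
  obtain ⟨I, hI⟩ := P.defined_over_real
  rw [hI] at *
  intro p hp
  have h : ∀ q : MvPolynomial (Fin N × Fin N) ℝ,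
      MvPolynomial.aeval (entries (Matrix.GeneralLinearGroup.map (starRingEnd ℂ) g)) q
        = starRingEnd ℂ (MvPolynomial.aeval (entries g) q) := by
    intro q
    have : MvPolynomial.aeval (entries (Matrix.GeneralLinearGroup.map (starRingEnd ℂ) g))
        = (Complex.conjAe : ℂ →ₐ[ℝ] ℂ).comp (MvPolynomial.aeval (entries g)) := by
      apply MvPolynomial.algHom_ext
      intro a
      simp [entries]
    rw [this]
    rfl
  rw [h, hg p hp, map_zero]

/-- The Lie algebra of `GC` is the complexification of that of `G_ℝ`. -/
theorem exists_lieAlg_add_I {X : Matrix (Fin N) (Fin N) ℂ} (hX : X ∈ P.complexLie) :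
    ∃ A ∈ P.lieAlg, ∃ B ∈ P.lieAlg,
      X = A.map (algebraMap ℝ ℂ) + Complex.I • B.map (algebraMap ℝ ℂ) := by
  have hconj : X.map (starRingEnd ℂ) ∈ P.complexLie := by
    rw [mem_complexLie_iff] at *
    intro t
    have : t • X.map (starRingEnd ℂ) = (t • X).map (starRingEnd ℂ) := by
      ext i j; simp
    rw [this, ← map_gexp _ Complex.continuous_conj]
    exact P.conj_mem_GC (hX t)
  refine ⟨X.map Complex.re, ?_, X.map Complex.im, ?_, ?_⟩
  · rw [mem_lieAlg_iff]
    have : (X.map Complex.re).map (algebraMap ℝ ℂ)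
        = (1 / 2 : ℂ) • (X + X.map (starRingEnd ℂ)) := by
      ext i j
      simp only [Matrix.map_apply, Matrix.smul_apply, Matrix.add_apply, smul_eq_mul,
        Complex.add_conj]
      simp
    rw [this]
    exact P.complexLie.smul_mem _ (add_mem hX hconj)
  · rw [mem_lieAlg_iff]
    have : (X.map Complex.im).map (algebraMap ℝ ℂ)
        = (1 / (2 * Complex.I) : ℂ) • (X - X.map (starRingEnd ℂ)) := by
      ext i j
      simp only [Matrix.map_apply, Matrix.smul_apply, Matrix.sub_apply, smul_eq_mul,
        Complex.sub_conj]
      simp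
      field_simp
      simp
    rw [this]
    exact P.complexLie.smul_mem _ (sub_mem hX hconj)
  · ext i j
    simp [mul_comm Complex.I, Complex.re_add_im]

/-! ### The differential of the representation -/

/-- The matrix coefficients of `ρ` are real polynomials in the entries of `g` and `g⁻¹`. -/
theorem exists_repPoly (i j : Fin n) :
    ∃ q : MvPolynomial ((Fin N × Fin N) ⊕ (Fin N × Fin N)) ℝ, ∀ g : P.GC,
      (P.ρ g : Matrix (Fin n) (Fin n) ℂ) i j
        = MvPolynomial.aeval (glCoords (g : GL (Fin N) ℂ)) q := by
  obtain ⟨p, r, h⟩ := P.rational i j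
  refine ⟨MvPolynomial.rename Sum.inl p * (Matrix.det (Matrix.of fun a b : Fin N =>
    (MvPolynomial.X (Sum.inr (a, b)) : MvPolynomial _ ℝ))) ^ r, fun g => ?_⟩
  have hdet : MvPolynomial.aeval (glCoords (g : GL (Fin N) ℂ)) (Matrix.det (Matrix.of fun a b : Fin N =>
      (MvPolynomial.X (Sum.inr (a, b)) : MvPolynomial ((Fin N × Fin N) ⊕ (Fin N × Fin N)) ℝ)))
      = (((g : GL (Fin N) ℂ)⁻¹ : GL (Fin N) ℂ) : Matrix (Fin N) (Fin N) ℂ).det := by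
    rw [AlgHom.map_det]
    congr 1
    ext a b
    simp [glCoords, pairCoords]
  have hone : (((g : GL (Fin N) ℂ)) : Matrix (Fin N) (Fin N) ℂ).det *
      (((g : GL (Fin N) ℂ)⁻¹ : GL (Fin N) ℂ) : Matrix (Fin N) (Fin N) ℂ).det = 1 := by
    rw [← Matrix.det_mul, ← Units.val_mul, mul_inv_cancel, Units.val_one, Matrix.det_one]
  rw [map_mul, map_pow, hdet, MvPolynomial.aeval_rename]
  have : glCoords (g : GL (Fin N) ℂ) ∘ Sum.inl = entries (g : GL (Fin N) ℂ) := rfl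
  rw [this, ← h g, mul_assoc, ← mul_pow, hone, one_pow, mul_one]

/-- A real polynomial in the entries of `g` and `g⁻¹` that gives the matrix coefficient `ρ(g)_{ij}`. -/
noncomputable def repPoly (i j : Fin n) : MvPolynomial ((Fin N × Fin N) ⊕ (Fin N × Fin N)) ℝ :=
  (P.exists_repPoly i j).choose

theorem rho_apply (g : P.GC) (i j : Fin n) : (P.ρ g : Matrix (Fin n) (Fin n) ℂ) i j
    = MvPolynomial.eval (glCoords (g : GL (Fin N) ℂ))
      (MvPolynomial.map (algebraMap ℝ ℂ) (P.repPoly i j)) := by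
  rw [(P.exists_repPoly i j).choose_spec g, MvPolynomial.eval_map]
  rfl

theorem realRep_apply (g : P.GR) (i j : Fin n) : P.realRep g i j
    = MvPolynomial.eval (glCoords (g : GL (Fin N) ℝ)) (P.repPoly i j) := by
  have h := P.rho_apply (P.toGC g) i j
  rw [← P.realRep_map, Matrix.map_apply] at h
  have hz : glCoords ((P.toGC g : P.GC) : GL (Fin N) ℂ)
      = algebraMap ℝ ℂ ∘ glCoords (g : GL (Fin N) ℝ) := by
    ext (⟨a, b⟩ | ⟨a, b⟩)
    · rfl
    · change ((Matrix.GeneralLinearGroup.map (algebraMap ℝ ℂ) (g : GL (Fin N) ℝ))⁻¹ :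
        GL (Fin N) ℂ) a b = _
      rw [← Matrix.GeneralLinearGroup.map_inv]
      rfl
  rw [hz, MvPolynomial.eval_map, ← MvPolynomial.aeval_def, MvPolynomial.aeval_algebraMap_apply] at h
  exact (algebraMap ℝ ℂ).injective h

/-- The differential of the real representation. It is defined, through the polynomials `repPoly`,
on all matrices, but depends on their choice outside of the Lie algebra. -/
noncomputable def drho : Matrix (Fin N) (Fin N) ℝ →ₗ[ℝ] Matrix (Fin n) (Fin n) ℝ where
  toFun X := Matrix.of fun i j => MvPolynomial.eval (glCoords 1) (invField X (P.repPoly i j))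
  map_add' X Y := by
    ext i j
    simp [invField_add]
  map_smul' c X := by
    ext i j
    simp [invField_smul]

/-- The differential of the complex representation, on all matrices as in `drho`. -/
noncomputable def cdrho : Matrix (Fin N) (Fin N) ℂ →ₗ[ℂ] Matrix (Fin n) (Fin n) ℂ where
  toFun X := Matrix.of fun i j => MvPolynomial.eval (glCoords 1)
    (invField X (MvPolynomial.map (algebraMap ℝ ℂ) (P.repPoly i j)))
  map_add' X Y := by
    ext i j
    simp [invField_add]
  map_smul' c X := by
    ext i j
    simp [invField_smul]

theorem invField_map (X : Matrix (Fin N) (Fin N) ℝ)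
    (p : MvPolynomial ((Fin N × Fin N) ⊕ (Fin N × Fin N)) ℝ) :
    invField (X.map (algebraMap ℝ ℂ)) (MvPolynomial.map (algebraMap ℝ ℂ) p)
      = MvPolynomial.map (algebraMap ℝ ℂ) (invField X p) := by
  induction p using MvPolynomial.induction_on with
  | C c => simp [MvPolynomial.derivation_C]
  | add p q hp hq => rw [map_add, map_add, map_add, map_add, hp, hq]
  | mul_X p b hp =>
    rw [map_mul, Derivation.leibniz, Derivation.leibniz, hp]
    rcases b with ⟨i, j⟩ | ⟨i, j⟩ <;> simp [invField, MvPolynomial.mkDerivation_X]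

theorem cdrho_map (X : Matrix (Fin N) (Fin N) ℝ) :
    P.cdrho (X.map (algebraMap ℝ ℂ)) = (P.drho X).map (algebraMap ℝ ℂ) := by
  ext i j
  have hz : glCoords (1 : GL (Fin N) ℂ) = algebraMap ℝ ℂ ∘ glCoords (1 : GL (Fin N) ℝ) := by
    ext (⟨a, b⟩ | ⟨a, b⟩) <;> by_cases hab : a = b <;> simp [glCoords, pairCoords, hab]
  change MvPolynomial.eval (glCoords 1) (invField (X.map (algebraMap ℝ ℂ))
    (MvPolynomial.map (algebraMap ℝ ℂ) (P.repPoly i j))) = _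
  rw [invField_map, hz, MvPolynomial.eval_map, ← MvPolynomial.aeval_def,
    MvPolynomial.aeval_algebraMap_apply]
  rfl

/-- The derivative of `ρ(g exp(t X))` at `t = 0` is `ρ(g) dρ(X)`. -/
theorem eval_invField_repPoly_complex {X : Matrix (Fin N) (Fin N) ℂ} (hX : X ∈ P.complexLie)
    (g : P.GC) (i j : Fin n) : MvPolynomial.eval (glCoords (g : GL (Fin N) ℂ))
      (invField X (MvPolynomial.map (algebraMap ℝ ℂ) (P.repPoly i j)))
      = ((P.ρ g : Matrix (Fin n) (Fin n) ℂ) * P.cdrho X) i j := by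
  have hmem := P.mem_complexLie_iff.1 hX
  have h1 := hasDerivAt_eval_gexp (g : GL (Fin N) ℂ) X
    (MvPolynomial.map (algebraMap ℝ ℂ) (P.repPoly i j)) 0
  have h2 : HasDerivAt (fun u : ℝ => ∑ k, (P.ρ g : Matrix (Fin n) (Fin n) ℂ) i k *
      MvPolynomial.eval (glCoords (1 * gexp (u • X)))
        (MvPolynomial.map (algebraMap ℝ ℂ) (P.repPoly k j)))
      (∑ k, (P.ρ g : Matrix (Fin n) (Fin n) ℂ) i k *
        MvPolynomial.eval (glCoords (1 * gexp ((0 : ℝ) • X)))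
          (invField X (MvPolynomial.map (algebraMap ℝ ℂ) (P.repPoly k j)))) 0 :=
    HasDerivAt.fun_sum fun k _ => (hasDerivAt_eval_gexp 1 X _ 0).const_mul _
  have heq : (fun u : ℝ => MvPolynomial.eval (glCoords ((g : GL (Fin N) ℂ) * gexp (u • X)))
      (MvPolynomial.map (algebraMap ℝ ℂ) (P.repPoly i j))) = fun u : ℝ =>
      ∑ k, (P.ρ g : Matrix (Fin n) (Fin n) ℂ) i k *
      MvPolynomial.eval (glCoords (1 * gexp (u • X)))
        (MvPolynomial.map (algebraMap ℝ ℂ) (P.repPoly k j)) := by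
    ext u
    have h3 := P.rho_apply (g * ⟨gexp (u • X), hmem u⟩) i j
    rw [map_mul, Units.val_mul, Matrix.mul_apply] at h3
    refine h3.symm.trans (Finset.sum_congr rfl fun k _ => ?_)
    rw [P.rho_apply ⟨gexp (u • X), hmem u⟩, one_mul]
  rw [heq] at h1
  have := h1.unique h2
  rw [zero_smul, gexp_zero, mul_one, mul_one] at this
  rw [this, Matrix.mul_apply]
  rfl

/-- The derivative of `ρ(g exp(t X))` at `t = 0`, for real `g` and `X`. -/
theorem eval_invField_repPoly {X : Matrix (Fin N) (Fin N) ℝ} (hX : X ∈ P.lieAlg)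
    (g : P.GR) (i j : Fin n) : MvPolynomial.eval (glCoords (g : GL (Fin N) ℝ))
      (invField X (P.repPoly i j)) = (P.realRep g * P.drho X) i j := by
  have h1 := hasDerivAt_eval_gexp (g : GL (Fin N) ℝ) X (P.repPoly i j) 0
  have h2 : HasDerivAt (fun u : ℝ => ∑ k, P.realRep g i k *
      MvPolynomial.eval (glCoords (1 * gexp (u • X))) (P.repPoly k j))
      (∑ k, P.realRep g i k * MvPolynomial.eval (glCoords (1 * gexp ((0 : ℝ) • X)))
          (invField X (P.repPoly k j))) 0 :=
    HasDerivAt.fun_sum fun k _ => (hasDerivAt_eval_gexp 1 X _ 0).const_mul _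
  have heq : (fun u : ℝ => MvPolynomial.eval (glCoords ((g : GL (Fin N) ℝ) * gexp (u • X)))
      (P.repPoly i j)) = fun u : ℝ =>
      ∑ k, P.realRep g i k * MvPolynomial.eval (glCoords (1 * gexp (u • X))) (P.repPoly k j) := by
    ext u
    have h3 := P.realRep_apply (g * ⟨gexp (u • X), hX u⟩) i j
    rw [realRep_mul, Matrix.mul_apply] at h3
    refine h3.symm.trans (Finset.sum_congr rfl fun k _ => ?_)
    rw [P.realRep_apply ⟨gexp (u • X), hX u⟩, one_mul]
  rw [heq] at h1
  have := h1.unique h2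
  rw [zero_smul, gexp_zero, mul_one, mul_one] at this
  rw [this, Matrix.mul_apply]
  rfl

end PrehomogeneousSpace

/-! ### The regular set in terms of the Lie algebra -/

/-- Density for the Zariski topology: no nonzero polynomial vanishes on the set. -/
theorem dense_zariskiTopology_iff {σ : Type} {S : Set (σ → ℂ)} :
    @Dense _ (zariskiTopology σ) S ↔
      ∀ q : MvPolynomial σ ℂ, q ≠ 0 → ∃ x ∈ S, MvPolynomial.eval x q ≠ 0 := by
  have hbasis : @TopologicalSpace.IsTopologicalBasis _ (zariskiTopology σ)
      (Set.range fun p : MvPolynomial σ ℂ => {x : σ → ℂ | MvPolynomial.eval x p ≠ 0}) := by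
    refine @TopologicalSpace.IsTopologicalBasis.mk _ (zariskiTopology σ) _ ?_ ?_ rfl
    · rintro _ ⟨p, rfl⟩ _ ⟨q, rfl⟩ x ⟨hp, hq⟩
      refine ⟨_, ⟨p * q, rfl⟩, ?_, ?_⟩
      · simpa using ⟨hp, hq⟩
      · rintro y hy
        simpa using hy
    · rw [Set.sUnion_eq_univ_iff]
      exact fun x => ⟨_, ⟨1, rfl⟩, by simp⟩
  rw [@TopologicalSpace.IsTopologicalBasis.dense_iff _ (zariskiTopology σ) _ hbasis]
  constructor
  · intro h q hq
    have hne : ∃ x : σ → ℂ, MvPolynomial.eval x q ≠ 0 := by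
      by_contra! hcon
      exact hq (MvPolynomial.funext fun x => by simp [hcon x])
    obtain ⟨x, hx1, hx2⟩ := h _ ⟨q, rfl⟩ hne
    exact ⟨x, hx2, hx1⟩
  · rintro h _ ⟨q, rfl⟩ ⟨y, hy⟩
    obtain ⟨x, hx1, hx2⟩ := h q (fun h0 => hy (by simp [h0]))
    exact ⟨x, hx2, hx1⟩

/-- A polynomial over a field of characteristic zero is zero if it belongs to a set that is stable
under partial derivatives and contains no nonzero constant. -/
theorem MvPolynomial.eq_zero_of_pderiv_stable {σ K : Type} [Field K] [CharZero K]
    {J : Set (MvPolynomial σ K)} (hJ : ∀ q ∈ J, ∀ i, pderiv i q ∈ J)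
    (hC : ∀ c, C c ∈ J → c = 0) {q : MvPolynomial σ K} (hq : q ∈ J) : q = 0 := by
  classical
  suffices ∀ d : ℕ, ∀ q ∈ J, q.totalDegree ≤ d → q = 0 from this _ q hq le_rfl
  intro d
  induction d with
  | zero =>
    intro q hq hd
    obtain ⟨c, rfl⟩ : ∃ c, q = C c := ⟨_, totalDegree_eq_zero_iff_eq_C.1 (Nat.le_zero.1 hd)⟩
    rw [hC c hq, C_0]
  | succ d ih =>
    intro q hq hd
    have hder : ∀ i, pderiv i q = 0 := by
      intro i
      refine ih _ (hJ q hq i) ?_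
      refine Finset.sup_le fun m hm => ?_
      rw [mem_support_iff, coeff_pderiv] at hm
      have h1 := le_totalDegree (mem_support_iff.2 (left_ne_zero_of_mul hm))
      rw [Finsupp.sum_add_index' (fun _ => rfl) (fun _ _ _ => rfl),
        Finsupp.sum_single_index rfl] at h1
      omega
    have hq0 : q = C (coeff 0 q) := by
      ext m
      rw [coeff_C]
      split_ifs with h
      · rw [h]
      · obtain ⟨i, hi⟩ : ∃ i, m i ≠ 0 := by
          by_contra! hcon
          exact h (Finsupp.ext fun i => (hcon i).symm)
        have h1 := coeff_pderiv (i := i) q (m - Finsupp.single i 1)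
        have hle : Finsupp.single i 1 ≤ m := by
          rw [Finsupp.single_le_iff]; omega
        rw [hder, coeff_zero, tsub_add_cancel_of_le hle] at h1
        exact (mul_eq_zero.1 h1.symm).resolve_right (Nat.cast_add_one_ne_zero _)
    rw [hq0] at hq ⊢
    rw [hC _ hq, C_0]

namespace PrehomogeneousSpace

variable {N n : ℕ} (P : PrehomogeneousSpace N n)

theorem cdrho_map_mulVec (X : Matrix (Fin N) (Fin N) ℝ) (m : Fin n → ℝ) :
    (P.cdrho (X.map (algebraMap ℝ ℂ))).mulVec (fun j => (m j : ℂ))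
      = fun i => (((P.drho X).mulVec m i : ℝ) : ℂ) := by
  ext i
  rw [cdrho_map]
  simp [Matrix.mulVec, dotProduct]

/-- If the infinitesimal action of the real Lie algebra at `m` is onto, then the partial
derivatives of a polynomial that vanishes on the complex orbit of `m` vanish there, too. -/
theorem eval_pderiv_eq_zero {m : Fin n → ℝ}
    (hm : ∀ v : Fin n → ℝ, ∃ X ∈ P.lieAlg, (P.drho X).mulVec m = v)
    {q : MvPolynomial (Fin n) ℂ} (hq : ∀ g : P.GC, MvPolynomial.eval
      ((P.ρ g : Matrix (Fin n) (Fin n) ℂ).mulVec fun j => (m j : ℂ)) q = 0) (i : Fin n) (g : P.GC) :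
    MvPolynomial.eval ((P.ρ g : Matrix (Fin n) (Fin n) ℂ).mulVec fun j => (m j : ℂ))
      (MvPolynomial.pderiv i q) = 0 := by
  set mc : Fin n → ℂ := fun j => (m j : ℂ) with hmc
  set d : Fin n → ℂ := fun a => MvPolynomial.eval
    ((P.ρ g : Matrix (Fin n) (Fin n) ℂ).mulVec mc) (MvPolynomial.pderiv a q) with hd
  have key : ∀ X ∈ P.lieAlg, ∑ a, ((P.ρ g : Matrix (Fin n) (Fin n) ℂ).mulVec
      ((P.cdrho (X.map (algebraMap ℝ ℂ))).mulVec mc)) a * d a = 0 := by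
    intro X hX
    have hXc := P.mem_lieAlg_iff.1 hX
    set Y := X.map (algebraMap ℝ ℂ)
    have hmem := P.mem_complexLie_iff.1 hXc
    have hcurve : ∀ a, HasDerivWithinAt (fun u : ℝ =>
        ((P.ρ (g * ⟨gexp (u • Y), hmem u⟩) : Matrix (Fin n) (Fin n) ℂ).mulVec mc) a)
        (((P.ρ g : Matrix (Fin n) (Fin n) ℂ).mulVec ((P.cdrho Y).mulVec mc)) a) Set.univ 0 := by
      intro a
      rw [hasDerivWithinAt_univ, Matrix.mulVec_mulVec]
      change HasDerivAt (fun u : ℝ => ∑ k, (P.ρ (g * ⟨gexp (u • Y), hmem u⟩) :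
        Matrix (Fin n) (Fin n) ℂ) a k * mc k) (∑ k, ((P.ρ g : Matrix (Fin n) (Fin n) ℂ)
          * P.cdrho Y) a k * mc k) 0
      refine HasDerivAt.fun_sum fun k _ => HasDerivAt.mul_const ?_ _
      rw [← P.eval_invField_repPoly_complex hXc]
      have := hasDerivAt_eval_gexp (g : GL (Fin N) ℂ) Y
        (MvPolynomial.map (algebraMap ℝ ℂ) (P.repPoly a k)) 0
      rw [zero_smul, gexp_zero, mul_one] at this
      convert! this using 2 with u
      exact P.rho_apply _ a k
    have h1 := MvPolynomial.hasDerivWithinAt_eval hcurve q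
    simp only [hq] at h1
    have h2 := (hasDerivWithinAt_univ.1 h1).unique (hasDerivAt_const (0 : ℝ) (0 : ℂ))
    rw [← h2]
    refine Finset.sum_congr rfl fun a _ => ?_
    have : (⟨gexp ((0 : ℝ) • Y), hmem 0⟩ : P.GC) = 1 := Subtype.ext (by simp [gexp_zero])
    rw [this, mul_one]
  -- the vectors `ρ(g) dρ(X) m` span, so that the gradient `d` vanishes
  have hvec : (P.ρ g : Matrix (Fin n) (Fin n) ℂ).vecMul d = 0 := by
    ext l
    obtain ⟨X, hX, hXl⟩ := hm (Pi.single l 1)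
    have h1 := key X hX
    have h2 : (fun i => (((P.drho X).mulVec m i : ℝ) : ℂ)) = Pi.single l 1 := by
      ext i
      rw [hXl]
      by_cases hil : i = l <;> simp [hil]
    rw [hmc, P.cdrho_map_mulVec, h2, Matrix.mulVec_single_one] at h1
    rw [Pi.zero_apply, ← h1]
    change ∑ a, d a * (P.ρ g : Matrix (Fin n) (Fin n) ℂ) a l
      = ∑ a, (P.ρ g : Matrix (Fin n) (Fin n) ℂ) a l * d a
    exact Finset.sum_congr rfl fun a _ => mul_comm _ _
  have hinj : d = 0 := by
    have : (((P.ρ g)⁻¹ : GL (Fin n) ℂ) : Matrix (Fin n) (Fin n) ℂ).vecMul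
        ((P.ρ g : Matrix (Fin n) (Fin n) ℂ).vecMul d) = d := by
      rw [Matrix.vecMul_vecMul, ← Units.val_mul, mul_inv_cancel, Units.val_one, Matrix.vecMul_one]
    rw [← this, hvec, Matrix.zero_vecMul]
  exact congrFun hinj i

/-- A real point is regular if and only if the infinitesimal action of the real Lie algebra is onto
at this point. If the orbit is dense, the orbit map is dominant, hence submersive at some group
element, and thus at the unit element; the real form of the Lie algebra then does as well as the
complex one. Conversely, a polynomial that vanishes on the orbit vanishes with all its
derivatives. -/
theorem mem_regularSet_iff {m : VR n} : m ∈ P.regularSet ↔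
    ∀ v : Fin n → ℝ, ∃ X ∈ P.lieAlg, (P.drho X).mulVec m.ofLp = v := by
  set mc : Fin n → ℂ := fun j => (m j : ℂ) with hmc
  have hreg : m ∈ P.regularSet ↔ ∀ q : MvPolynomial (Fin n) ℂ, q ≠ 0 → ∃ g : P.GC,
      MvPolynomial.eval ((P.ρ g : Matrix (Fin n) (Fin n) ℂ).mulVec mc) q ≠ 0 := by
    rw [regularSet, singularSet, Set.mem_ofPred_eq, Set.mem_ofPred_eq, not_not,
      dense_zariskiTopology_iff]
    simp [hmc]
  rw [hreg]
  constructor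
  · intro hdense
    let Y : Fin n → MvPolynomial ((Fin N × Fin N) ⊕ (Fin N × Fin N)) ℂ := fun i =>
      ∑ k, MvPolynomial.C (mc k) * MvPolynomial.map (algebraMap ℝ ℂ) (P.repPoly i k)
    have hY : ∀ g : P.GC, (fun i => MvPolynomial.eval (glCoords (g : GL (Fin N) ℂ)) (Y i))
        = (P.ρ g : Matrix (Fin n) (Fin n) ℂ).mulVec mc := by
      intro g
      ext i
      simp only [Y, map_sum, map_mul, MvPolynomial.eval_C, ← P.rho_apply, Matrix.mulVec, dotProduct]
      exact Finset.sum_congr rfl fun k _ => mul_comm _ _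
    obtain ⟨z, hz, v, hv1, hv2⟩ := MvPolynomial.exists_tangent_vectors P.groupIdeal Y (by
      intro q hq hmem
      obtain ⟨g, hg⟩ := hdense q hq
      apply hg
      have := P.mem_groupIdeal.1 hmem g g.2
      have hcomp := MvPolynomial.comp_aeval_apply (f := Y)
        (MvPolynomial.aeval (R := ℂ) (glCoords (g : GL (Fin N) ℂ))) q
      simp only [MvPolynomial.aeval_eq_eval] at hcomp
      rw [← hY g, ← this]
      exact hcomp.symm)
    obtain ⟨g, hg, rfl⟩ := P.exists_of_mem_zeroLocus hz
    -- the tangent vector `v j` at `g`, translated to the unit element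
    let V : Fin n → Matrix (Fin N) (Fin N) ℂ := fun j => Matrix.of fun a b => v j (Sum.inl (a, b))
    let W : Fin n → Matrix (Fin N) (Fin N) ℂ := fun j => Matrix.of fun a b => v j (Sum.inr (a, b))
    let gi : Matrix (Fin N) (Fin N) ℂ := ((g⁻¹ : GL (Fin N) ℂ) : Matrix (Fin N) (Fin N) ℂ)
    have hgi : (g : Matrix (Fin N) (Fin N) ℂ) * gi = 1 := by
      simp only [gi, ← Units.val_mul, mul_inv_cancel, Units.val_one]
    have hgi' : gi * (g : Matrix (Fin N) (Fin N) ℂ) = 1 := mul_eq_one_comm.1 hgi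
    -- the relation `x y = 1`, differentiated
    have hW : ∀ j, W j = -(gi * V j * gi) := by
      intro j
      have : V j * gi + g * W j = 0 := by
        ext a b
        have h1 := hv1 j _ (P.mulInvRelation_mem a b)
        have h2 := MvPolynomial.eval_derivation (MvPolynomial.mkDerivation ℂ
          fun a => (MvPolynomial.C (v j a) : MvPolynomial _ ℂ)) (glCoords g) (mulInvRelation a b)
        simp only [MvPolynomial.mkDerivation_X, MvPolynomial.eval_C] at h2
        rw [h1] at h2
        simp only [mulInvRelation, map_sub, map_sum, Derivation.leibniz, MvPolynomial.mkDerivation_X,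
          MvPolynomial.derivation_C, smul_eq_mul, map_add, map_mul, MvPolynomial.eval_X,
          MvPolynomial.eval_C, sub_zero, Finset.sum_add_distrib] at h2
        rw [Matrix.add_apply, Matrix.mul_apply, Matrix.mul_apply, Matrix.zero_apply, ← h2, add_comm]
        congr 1
        exact Finset.sum_congr rfl fun c _ => mul_comm _ _
      have h2 : gi * (V j * gi + g * W j) = 0 := by rw [this, mul_zero]
      rw [mul_add, ← mul_assoc gi g.val, hgi', one_mul, ← mul_assoc] at h2
      exact eq_neg_of_add_eq_zero_right h2
    have hfield : ∀ j p, MvPolynomial.eval (glCoords g) (invField (gi * V j) p)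
        = ∑ a, v j a * MvPolynomial.eval (glCoords g) (MvPolynomial.pderiv a p) := by
      intro j p
      rw [MvPolynomial.eval_derivation]
      refine Finset.sum_congr rfl fun a _ => ?_
      congr 1
      rcases a with ⟨a, b⟩ | ⟨a, b⟩
      · rw [glCoords, eval_invField_X_inl, ← mul_assoc, hgi, one_mul]
        rfl
      · rw [glCoords, eval_invField_X_inr]
        exact (congrFun (congrFun (hW j) a) b).symm
    have hLie : ∀ j, gi * V j ∈ P.complexLie := fun j =>
      P.mem_complexLie_of_tangent hg fun p hp => by rw [hfield, hv1 j p hp]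
    have hspan : ∀ j, (P.ρ ⟨g, hg⟩ : Matrix (Fin n) (Fin n) ℂ).mulVec
        ((P.cdrho (gi * V j)).mulVec mc) = Pi.single j 1 := by
      intro j
      ext i
      have h1 := hv2 i j
      rw [← hfield] at h1
      simp only [Y, map_sum, Derivation.leibniz, MvPolynomial.derivation_C, smul_eq_mul, mul_zero,
        add_zero, map_mul, MvPolynomial.eval_C] at h1
      rw [Matrix.mulVec_mulVec, Pi.single_apply, ← h1]
      change ∑ k, ((P.ρ ⟨g, hg⟩ : Matrix (Fin n) (Fin n) ℂ) * P.cdrho (gi * V j)) i k * mc k = _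
      refine Finset.sum_congr rfl fun k _ => ?_
      rw [mul_comm, ← P.eval_invField_repPoly_complex (hLie j) ⟨g, hg⟩]
    let T : Matrix (Fin N) (Fin N) ℝ →ₗ[ℝ] (Fin n → ℝ) :=
      (Matrix.mulVecBilin ℝ ℝ).flip m.ofLp ∘ₗ P.drho
    suffices P.lieSubmodule.map T = ⊤ by
      intro w
      obtain ⟨X, hX, hXw⟩ : w ∈ P.lieSubmodule.map T := this ▸ Submodule.mem_top
      exact ⟨X, hX, hXw⟩
    -- a real linear form that kills `dρ(X) m` for all real `X` does so for all complex `X`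
    by_contra hne
    obtain ⟨f, hf0, hf⟩ := Submodule.exists_le_ker_of_lt_top _ (lt_top_iff_ne_top.2 hne)
    let c : Fin n → ℝ := fun l => f (Pi.single l 1)
    have hfc : ∀ w, f w = ∑ l, c l * w l := by
      intro w
      conv_lhs => rw [← Finset.univ_sum_single w, map_sum]
      refine Finset.sum_congr rfl fun l _ => ?_
      rw [show Pi.single l (w l) = w l • (Pi.single l 1 : Fin n → ℝ) by
        rw [← Pi.single_smul, smul_eq_mul, mul_one], map_smul, smul_eq_mul, mul_comm]
    let cc : Fin n → ℂ := fun l => (c l : ℂ)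
    have hreal : ∀ X ∈ P.lieAlg, cc ⬝ᵥ (P.cdrho (X.map (algebraMap ℝ ℂ))).mulVec mc = 0 := by
      intro X hX
      have h1 : f (T X) = 0 := hf (Submodule.mem_map_of_mem hX)
      rw [hmc, cdrho_map_mulVec]
      rw [hfc] at h1
      have h2 := congrArg (fun x : ℝ => (x : ℂ)) h1
      simpa [dotProduct, cc, T] using h2
    have hcomplex : ∀ Z ∈ P.complexLie, cc ⬝ᵥ (P.cdrho Z).mulVec mc = 0 := by
      intro Z hZ
      obtain ⟨A, hA, B, hB, rfl⟩ := P.exists_lieAlg_add_I hZ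
      rw [map_add, map_smul, Matrix.add_mulVec, Matrix.smul_mulVec, dotProduct_add,
        dotProduct_smul, hreal A hA, hreal B hB, smul_zero, add_zero]
    have hcc : cc = 0 := by
      have hinv : ∀ w, (((P.ρ ⟨g, hg⟩)⁻¹ : GL (Fin n) ℂ) : Matrix (Fin n) (Fin n) ℂ).mulVec
          ((P.ρ ⟨g, hg⟩ : Matrix (Fin n) (Fin n) ℂ).mulVec w) = w := by
        intro w
        rw [Matrix.mulVec_mulVec, ← Units.val_mul, inv_mul_cancel, Units.val_one, Matrix.one_mulVec]
      have h1 : Matrix.vecMul cc (((P.ρ ⟨g, hg⟩)⁻¹ : GL (Fin n) ℂ) : Matrix (Fin n) (Fin n) ℂ) = 0 := by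
        ext j
        have h2 := hcomplex _ (hLie j)
        rw [← hinv ((P.cdrho (gi * V j)).mulVec mc), hspan j, Matrix.dotProduct_mulVec,
          dotProduct_single_one] at h2
        exact h2
      have h2 : Matrix.vecMul (Matrix.vecMul cc (((P.ρ ⟨g, hg⟩)⁻¹ : GL (Fin n) ℂ) :
          Matrix (Fin n) (Fin n) ℂ)) (P.ρ ⟨g, hg⟩ : Matrix (Fin n) (Fin n) ℂ) = cc := by
        rw [Matrix.vecMul_vecMul, ← Units.val_mul, inv_mul_cancel, Units.val_one, Matrix.vecMul_one]
      rw [← h2, h1, Matrix.zero_vecMul]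
    refine hf0 (LinearMap.ext fun w => ?_)
    rw [hfc]
    refine Finset.sum_eq_zero fun l _ => ?_
    have : c l = 0 := by simpa [cc] using congrFun hcc l
    rw [this, zero_mul]
  · intro hm q hq
    by_contra! hcon
    refine hq (MvPolynomial.eq_zero_of_pderiv_stable (J := {q | ∀ g : P.GC, MvPolynomial.eval
      ((P.ρ g : Matrix (Fin n) (Fin n) ℂ).mulVec mc) q = 0})
      (fun q hq i g => P.eval_pderiv_eq_zero hm hq i g) (fun c hc => ?_) hcon)
    simpa using hc 1

end PrehomogeneousSpace

/-! ### Frames, and the exponential map near the unit element -/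

/-- Products of exponentials of elements of two subspaces that span the algebra cover a
neighbourhood of `1`. -/
theorem NormedSpace.eventually_exp_mul_exp {𝔸 : Type*} [NormedRing 𝔸] [NormedAlgebra ℝ 𝔸]
    [FiniteDimensional ℝ 𝔸] {V W : Submodule ℝ 𝔸} (hVW : V ⊔ W = ⊤) {ε : ℝ} (hε : 0 < ε) :
    ∀ᶠ M in 𝓝 (1 : 𝔸), ∃ X ∈ V, ∃ w ∈ W, ‖w‖ < ε ∧ M = exp X * exp w := by
  have _ : CompleteSpace 𝔸 := FiniteDimensional.complete ℝ _
  let a : V × W →L[ℝ] 𝔸 := V.subtypeL.comp (ContinuousLinearMap.fst ℝ _ _)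
  let b : V × W →L[ℝ] 𝔸 := W.subtypeL.comp (ContinuousLinearMap.snd ℝ _ _)
  have hexp : HasStrictFDerivAt (exp : 𝔸 → 𝔸) (1 : 𝔸 →L[ℝ] 𝔸) 0 := hasStrictFDerivAt_exp_zero
  have h1 : HasStrictFDerivAt (fun x : V × W => exp (a x)) a 0 :=
    HasStrictFDerivAt.comp (0 : V × W) (g := exp) (by simpa using hexp) a.hasStrictFDerivAt
  have h2 : HasStrictFDerivAt (fun x : V × W => exp (b x)) b 0 :=
    HasStrictFDerivAt.comp (0 : V × W) (g := exp) (by simpa using hexp) b.hasStrictFDerivAt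
  have h3 : HasStrictFDerivAt (fun x : V × W => exp (a x) * exp (b x)) (a + b) 0 := by
    refine (h1.mul' h2).congr_fderiv (ContinuousLinearMap.ext fun x => ?_)
    simp [exp_zero, add_comm]
  have hsurj : (a + b).range = ⊤ := by
    rw [LinearMap.range_eq_top]
    intro M
    obtain ⟨x, hx, y, hy, rfl⟩ := Submodule.mem_sup.1 (hVW ▸ Submodule.mem_top : M ∈ V ⊔ W)
    exact ⟨(⟨x, hx⟩, ⟨y, hy⟩), rfl⟩
  have hmap := h3.map_nhds_eq_of_surj hsurj
  have hnhds : {x : V × W | ‖b x‖ < ε} ∈ 𝓝 (0 : V × W) :=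
    (b.continuous.norm.isOpen_preimage _ isOpen_Iio).mem_nhds (by simpa using hε)
  have himg := Filter.image_mem_map (m := fun x : V × W => exp (a x) * exp (b x)) hnhds
  rw [hmap, map_zero, map_zero, exp_zero, one_mul] at himg
  filter_upwards [himg] with M hM
  obtain ⟨x, hx, rfl⟩ := hM
  exact ⟨_, x.1.2, _, x.2.2, hx, rfl⟩

namespace PrehomogeneousSpace

variable {N n : ℕ} (P : PrehomogeneousSpace N n)

/-- Near a point of the regular set, the vector fields of `n` elements of the Lie algebra form a
frame. -/
theorem exists_frame {m₀ : VR n} (hm : m₀ ∈ P.regularSet) :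
    ∃ X : Fin n → P.lieAlg, ∀ᶠ m in 𝓝 m₀,
      (Matrix.of fun i k => (P.drho (X k)).mulVec m.ofLp i).det ≠ 0 := by
  have h := P.mem_regularSet_iff.1 hm
  choose X hX hXm using fun k : Fin n => h (Pi.single k 1)
  refine ⟨fun k => ⟨X k, hX k⟩, ?_⟩
  have hcont : Continuous fun m : VR n =>
      (Matrix.of fun i k => (P.drho (X k)).mulVec m.ofLp i).det := by
    refine Continuous.matrix_det (continuous_matrix fun i k => ?_)
    exact (continuous_apply i).comp (Continuous.matrix_mulVec continuous_const (PiLp.continuous_ofLp 2 _))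
  have h1 : (Matrix.of fun i k => (P.drho (X k)).mulVec m₀.ofLp i) = 1 := by
    ext i k
    rw [Matrix.of_apply, hXm, Matrix.one_apply, Pi.single_apply]
  refine hcont.continuousAt.eventually_ne ?_
  rw [h1, Matrix.det_one]
  exact one_ne_zero

theorem isOpen_regularSet : IsOpen P.regularSet := by
  rw [isOpen_iff_mem_nhds]
  intro m₀ hm
  obtain ⟨X, hX⟩ := P.exists_frame hm
  filter_upwards [hX] with m hdet
  rw [mem_regularSet_iff]
  intro v
  set M : Matrix (Fin n) (Fin n) ℝ := Matrix.of fun i k => (P.drho (X k)).mulVec m.ofLp i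
  refine ⟨∑ k, (M⁻¹.mulVec v) k • (X k : Matrix (Fin N) (Fin N) ℝ),
    P.lieSubmodule.sum_mem fun k _ => P.lieSubmodule.smul_mem _ (X k).2, ?_⟩
  have hM : M.mulVec (M⁻¹.mulVec v) = v := by
    rw [Matrix.mulVec_mulVec, Matrix.mul_nonsing_inv _ (isUnit_iff_ne_zero.2 hdet),
      Matrix.one_mulVec]
  conv_rhs => rw [← hM]
  ext i
  rw [map_sum, Matrix.sum_mulVec, Finset.sum_apply]
  refine Finset.sum_congr rfl fun k _ => ?_
  rw [map_smul, Matrix.smul_mulVec, Pi.smul_apply, smul_eq_mul, mul_comm]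
  rfl

theorem mem_GR_iff : ∃ I : Set (MvPolynomial (Fin N × Fin N) ℝ), ∀ g : GL (Fin N) ℝ,
    g ∈ P.GR ↔ ∀ p ∈ I, MvPolynomial.eval (entries g) p = 0 := by
  obtain ⟨I, hI⟩ := P.defined_over_real
  refine ⟨I, fun g => (hI _).trans (forall₂_congr fun p _ => ?_)⟩
  have : entries (Matrix.GeneralLinearGroup.map (algebraMap ℝ ℂ) g)
      = algebraMap ℝ ℂ ∘ entries g := rfl
  rw [this, MvPolynomial.aeval_algebraMap_apply, map_eq_zero, MvPolynomial.aeval_eq_eval]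

theorem continuous_entries : Continuous (entries : GL (Fin N) ℝ → _) :=
  continuous_pi fun _ => Continuous.matrix_elem Units.continuous_val _ _

theorem isClosed_GR : IsClosed (P.GR : Set (GL (Fin N) ℝ)) := by
  obtain ⟨I, hI⟩ := P.mem_GR_iff
  have : (P.GR : Set (GL (Fin N) ℝ)) = ⋂ p ∈ I, {g | MvPolynomial.eval (entries g) p = 0} := by
    ext g
    simp [hI]
  rw [this]
  exact isClosed_biInter fun p _ =>
    isClosed_eq ((MvPolynomial.continuous_eval p).comp continuous_entries) continuous_const

section MatrixNorm

attribute [local instance] Matrix.linftyOpNormedRing Matrix.linftyOpNormedAlgebra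

theorem continuous_gexp : Continuous (gexp : Matrix (Fin N) (Fin N) ℝ → GL (Fin N) ℝ) := by
  let _ : NormedAlgebra ℚ (Matrix (Fin N) (Fin N) ℝ) := Matrix.linftyOpNormedAlgebra
  have _ : CompleteSpace (Matrix (Fin N) (Fin N) ℝ) := FiniteDimensional.complete ℝ _
  have h := NormedSpace.exp_continuous (𝔸 := Matrix (Fin N) (Fin N) ℝ)
  exact Units.continuous_iff.2 ⟨h, h.comp continuous_neg⟩

theorem gexp_zsmul (k : ℤ) (X : Matrix (Fin N) (Fin N) ℝ) : gexp (k • X) = gexp X ^ k := by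
  apply Units.ext
  rw [Matrix.coe_units_zpow]
  exact Matrix.exp_zsmul k X

/-- If the exponentials of nonzero matrices `w k → 0` belong to `G_ℝ`, then a limit of the
directions of the `w k` belongs to the Lie algebra. -/
theorem mem_lieAlg_of_tendsto {w : ℕ → Matrix (Fin N) (Fin N) ℝ} {u : Matrix (Fin N) (Fin N) ℝ}
    (hw : Filter.Tendsto (fun k => ‖w k‖) Filter.atTop (𝓝 0)) (hw0 : ∀ k, w k ≠ 0)
    (hmem : ∀ k, gexp (w k) ∈ P.GR)
    (hu : Filter.Tendsto (fun k => ‖w k‖⁻¹ • w k) Filter.atTop (𝓝 u)) : u ∈ P.lieAlg := by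
  intro t
  rw [expGL_eq_gexp]
  -- `exp(w k)` to the power `⌊t / ‖w k‖⌋` is in the closed subgroup `G_ℝ`, and tends to `exp(t u)`
  have hlim : Filter.Tendsto (fun k => (⌊t / ‖w k‖⌋ : ℝ) * ‖w k‖) Filter.atTop (𝓝 t) := by
    rw [tendsto_iff_dist_tendsto_zero]
    refine squeeze_zero (fun _ => dist_nonneg) (fun k => ?_) hw
    have hpos : 0 < ‖w k‖ := norm_pos_iff.2 (hw0 k)
    have h1 := Int.floor_le (t / ‖w k‖)
    have h2 := Int.lt_floor_add_one (t / ‖w k‖)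
    rw [le_div_iff₀ hpos] at h1
    rw [div_lt_iff₀ hpos] at h2
    rw [Real.dist_eq, abs_le]
    constructor <;> nlinarith
  have hlim2 := (continuous_gexp.tendsto _).comp (hlim.smul hu)
  refine P.isClosed_GR.mem_of_tendsto hlim2 (Filter.Eventually.of_forall fun k => ?_)
  have : ((⌊t / ‖w k‖⌋ : ℝ) * ‖w k‖) • ‖w k‖⁻¹ • w k = ⌊t / ‖w k‖⌋ • w k := by
    rw [smul_smul, mul_assoc, mul_inv_cancel₀ (norm_ne_zero_iff.2 (hw0 k)), mul_one,
      Int.cast_smul_eq_zsmul]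
  rw [Function.comp_apply, this, gexp_zsmul]
  exact zpow_mem (hmem k) _

/-- Transversally to the Lie algebra, `G_ℝ` is discrete. -/
theorem exists_exp_transversal {W : Submodule ℝ (Matrix (Fin N) (Fin N) ℝ)}
    (hW : Disjoint P.lieSubmodule W) :
    ∃ ε > 0, ∀ w ∈ W, ‖w‖ < ε → gexp w ∈ P.GR → w = 0 := by
  by_contra! hcon
  choose w hwW hwn hwG hw0 using fun k : ℕ => hcon (1 / ((k : ℝ) + 1)) (by positivity)
  have hlim : Filter.Tendsto (fun k => ‖w k‖) Filter.atTop (𝓝 0) :=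
    squeeze_zero (fun _ => norm_nonneg _) (fun k => (hwn k).le) tendsto_one_div_add_atTop_nhds_zero_nat
  have hsphere : ∀ k, ‖w k‖⁻¹ • w k ∈ Metric.sphere (0 : Matrix (Fin N) (Fin N) ℝ) 1 := by
    intro k
    rw [mem_sphere_zero_iff_norm, norm_smul, norm_inv, norm_norm,
      inv_mul_cancel₀ (norm_ne_zero_iff.2 (hw0 k))]
  have _ : ProperSpace (Matrix (Fin N) (Fin N) ℝ) := FiniteDimensional.proper ℝ _
  obtain ⟨u, hu, φ, hφ, hφu⟩ := (isCompact_sphere (0 : Matrix (Fin N) (Fin N) ℝ) 1).tendsto_subseq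
    hsphere
  have hlie : u ∈ P.lieAlg := P.mem_lieAlg_of_tendsto (w := w ∘ φ) (hlim.comp hφ.tendsto_atTop)
    (fun k => hw0 _) (fun k => hwG _) hφu
  have huW : u ∈ W := W.closed_of_finiteDimensional.mem_of_tendsto hφu
    (Filter.Eventually.of_forall fun k => W.smul_mem _ (hwW _))
  have hu0 : u = 0 := (Submodule.disjoint_def.1 hW) u hlie huW
  rw [hu0, mem_sphere_zero_iff_norm, norm_zero] at hu
  exact zero_ne_one hu

/-- The exponential map covers a neighbourhood of the unit element of `G_ℝ`. -/
theorem eventually_mem_exp_lieAlg :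
    ∀ᶠ g : P.GR in 𝓝 1, ∃ X ∈ P.lieAlg, (g : GL (Fin N) ℝ) = gexp X := by
  obtain ⟨W, hW⟩ := P.lieSubmodule.exists_isCompl
  obtain ⟨ε, hε, hWε⟩ := P.exists_exp_transversal hW.disjoint
  have hval : Continuous fun g : P.GR => ((g : GL (Fin N) ℝ) : Matrix (Fin N) (Fin N) ℝ) :=
    Units.continuous_val.comp continuous_subtype_val
  have hpre := (hval.tendsto 1).eventually
    (NormedSpace.eventually_exp_mul_exp hW.sup_eq_top hε)
  filter_upwards [hpre] with g hg
  obtain ⟨X, hX, w, hwW, hwε, hXw⟩ := hg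
  have hgX : (g : GL (Fin N) ℝ) = gexp X * gexp w := Units.ext hXw
  have hXG : gexp (X : Matrix (Fin N) (Fin N) ℝ) ∈ P.GR := by
    have := hX 1
    rwa [one_smul] at this
  have hw : gexp (w : Matrix (Fin N) (Fin N) ℝ) ∈ P.GR := by
    have := mul_mem (inv_mem hXG) g.2
    rwa [hgX, inv_mul_cancel_left] at this
  refine ⟨X, hX, ?_⟩
  rw [hgX, hWε w hwW hwε hw, gexp_zero, mul_one]

end MatrixNorm

/-! ### Smooth curves in `G` -/

theorem mat_mul (g h : P.G) : P.mat (g * h) = P.mat g * P.mat h := rfl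

theorem mat_one : P.mat 1 = 1 := rfl

/-- The subgroup of the elements of `G` that are joined to the unit element by a `C¹` curve. The
smoothness of the inverse is a part of the condition, so that products and inverses of curves are
immediate. -/
noncomputable def smoothlyJoined : Subgroup P.G where
  carrier := {g | ∃ γ : ℝ → P.G, γ 0 = 1 ∧ γ 1 = g ∧
    (∀ i j, ContDiff ℝ 1 fun t => P.mat (γ t) i j) ∧
    ∀ i j, ContDiff ℝ 1 fun t => P.mat (γ t)⁻¹ i j}
  mul_mem' := by
    rintro g h ⟨γ, h0, h1, hγ, hγ'⟩ ⟨δ, k0, k1, hδ, hδ'⟩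
    refine ⟨fun t => γ t * δ t, by simp [h0, k0], by simp [h1, k1], fun i j => ?_, fun i j => ?_⟩
    · simp only [mat_mul, Matrix.mul_apply]
      exact ContDiff.sum fun c _ => (hγ i c).mul (hδ c j)
    · simp only [mul_inv_rev, mat_mul, Matrix.mul_apply]
      exact ContDiff.sum fun c _ => (hδ' i c).mul (hγ' c j)
  one_mem' := ⟨fun _ => 1, rfl, rfl, fun _ _ => contDiff_const, fun _ _ => by
    simpa using contDiff_const⟩
  inv_mem' := by
    rintro g ⟨γ, h0, h1, hγ, hγ'⟩
    exact ⟨fun t => (γ t)⁻¹, by simp [h0], by simp [h1], hγ', by simpa using hγ⟩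

theorem oneParam_mem_smoothlyJoined (X : P.lieAlg) : P.oneParam X 1 ∈ P.smoothlyJoined := by
  refine ⟨P.oneParam X, ?_, rfl, fun i j => ?_, fun i j => ?_⟩
  · apply Subtype.ext
    apply Subtype.ext
    change gexp ((0 : ℝ) • (X : Matrix (Fin N) (Fin N) ℝ)) = 1
    rw [zero_smul, gexp_zero]
  · exact contDiff_iff_contDiffAt.2 fun t => (analyticAt_matrix_exp_smul _ t i j).contDiffAt
  · have : ∀ t, P.mat (P.oneParam X t)⁻¹ i j
        = NormedSpace.exp (t • -(X : Matrix (Fin N) (Fin N) ℝ)) i j := by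
      intro t
      rw [smul_neg]
      rfl
    simp only [this]
    exact contDiff_iff_contDiffAt.2 fun t => (analyticAt_matrix_exp_smul _ t i j).contDiffAt

theorem connectedSpace_G : ConnectedSpace P.G :=
  isConnected_iff_connectedSpace.1 (isConnected_connectedComponent (x := (1 : P.GR)))

/-- The infimum in `absG` is over a nonempty set: the elements joined to the unit element form an
open subgroup of a connected group. -/
theorem smoothlyJoined_eq_top : P.smoothlyJoined = ⊤ := by
  have hopen : IsOpen (P.smoothlyJoined : Set P.G) := by
    refine P.smoothlyJoined.isOpen_of_mem_nhds (g := 1) ?_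
    have h := ((continuous_subtype_val (p := fun g : P.GR => g ∈ P.G)).tendsto 1).eventually
      P.eventually_mem_exp_lieAlg
    filter_upwards [h] with g hg
    obtain ⟨X, hX, hgX⟩ := hg
    have : g = P.oneParam ⟨X, hX⟩ 1 := by
      apply Subtype.ext
      apply Subtype.ext
      change _ = gexp ((1 : ℝ) • X)
      rw [one_smul, hgX]
    rw [this]
    exact P.oneParam_mem_smoothlyJoined _
  have hclosed := P.smoothlyJoined.isClosed_of_isOpen hopen
  have _ := P.connectedSpace_G
  have := IsClopen.eq_univ ⟨hclosed, hopen⟩ ⟨1, one_mem _⟩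
  exact SetLike.coe_injective (by simpa using this)

end PrehomogeneousSpace

/-! ### Growth of the representation -/

/-- A linear map on a finite-dimensional space is bounded for the norm of a positive definite
form. -/
theorem LinearMap.exists_bound_of_posDef {V E : Type*} [AddCommGroup V] [Module ℝ V]
    [FiniteDimensional ℝ V] [NormedAddCommGroup E] [NormedSpace ℝ E]
    (B : LinearMap.BilinForm ℝ V) (hB_symm : ∀ X Y, B X Y = B Y X)
    (hB_pos : ∀ X, X ≠ 0 → 0 < B X X) (D : V →ₗ[ℝ] E) :
    ∃ κ : ℝ, 0 ≤ κ ∧ ∀ X, ‖D X‖ ≤ κ * √(B X X) := by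
  let core : InnerProductSpace.Core ℝ V :=
    { inner := fun X Y => B X Y
      conj_inner_symm := fun X Y => hB_symm Y X
      re_inner_nonneg := fun X => by
        rcases eq_or_ne X 0 with rfl | h
        · simp
        · exact (hB_pos X h).le
      add_left := fun X Y Z => by simp
      smul_left := fun X Y r => by simp
      definite := fun X h => by
        by_contra hne
        exact (hB_pos X hne).ne' h }
  let _ : NormedAddCommGroup V := core.toNormedAddCommGroup
  let _ : InnerProductSpace ℝ V := InnerProductSpace.ofCore core.toCore
  refine ⟨‖LinearMap.toContinuousLinearMap D‖, ContinuousLinearMap.opNorm_nonneg _, fun X => ?_⟩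
  have h := (LinearMap.toContinuousLinearMap D).le_opNorm X
  rwa [show ‖X‖ = √(B X X) from norm_eq_sqrt_real_inner X] at h

/-- Grönwall's inequality with a variable coefficient, on `[0, 1]`. -/
theorem norm_le_mul_exp_integral {E : Type*} [NormedAddCommGroup E] [NormedSpace ℝ E]
    {A A' : ℝ → E} {k : ℝ → ℝ} (hA : ContinuousOn A (Set.Icc 0 1))
    (hA' : ∀ t ∈ Set.Ico (0 : ℝ) 1, HasDerivWithinAt A (A' t) (Set.Ici t) t)
    (hk : ContinuousOn k (Set.Icc 0 1))
    (hbound : ∀ t ∈ Set.Ico (0 : ℝ) 1, ‖A' t‖ ≤ k t * ‖A t‖) :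
    ‖A 1‖ ≤ ‖A 0‖ * Real.exp (∫ t in (0 : ℝ)..1, k t) := by
  -- `k` is extended by constants, so that its primitive is differentiable on the whole line
  let kk : ℝ → ℝ := Set.IccExtend (zero_le_one' ℝ) (Set.domRestrict (Set.Icc 0 1) k)
  have hkk : Continuous kk := hk.domRestrict.Icc_extend'
  have hkeq : ∀ t ∈ Set.Icc (0 : ℝ) 1, kk t = k t := fun t ht =>
    Set.IccExtend_of_mem _ _ ht
  have hε : ∀ ε > 0, ‖A 1‖ ≤ (‖A 0‖ + ε) * Real.exp ((∫ t in (0 : ℝ)..1, k t) + ε) := by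
    intro ε hε
    let b : ℝ → ℝ := fun t => (‖A 0‖ + ε) * Real.exp ((∫ s in (0 : ℝ)..t, kk s) + ε * t)
    have hb : ∀ t, HasDerivAt b (b t * (kk t + ε)) t := by
      intro t
      have h1 : HasDerivAt (fun u => ∫ s in (0 : ℝ)..u, kk s) (kk t) t :=
        intervalIntegral.integral_hasDerivAt_right (hkk.intervalIntegrable _ _)
          (hkk.stronglyMeasurableAtFilter _ _) hkk.continuousAt
      have h2 : HasDerivAt (fun u => ε * u) ε t := by
        simpa using (hasDerivAt_id t).const_mul ε
      have h3 := ((h1.add h2).exp).const_mul (‖A 0‖ + ε)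
      rw [← mul_assoc] at h3
      exact h3
    have hbpos : ∀ t, 0 < b t := fun t => by positivity
    have h := image_norm_le_of_norm_deriv_right_lt_deriv_boundary hA hA' (B := b)
      (B' := fun t => b t * (kk t + ε)) (by simp [b, hε.le]) hb (fun t ht heq => by
        refine (hbound t ht).trans_lt ?_
        rw [heq, hkeq t (Set.Ico_subset_Icc_self ht), mul_comm]
        exact mul_lt_mul_of_pos_left (by linarith) (hbpos t))
    have h1 := h (Set.right_mem_Icc.2 zero_le_one)
    have h2 : ∫ s in (0 : ℝ)..1, kk s = ∫ s in (0 : ℝ)..1, k s := by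
      refine intervalIntegral.integral_congr fun t ht => ?_
      rw [Set.uIcc_of_le zero_le_one] at ht
      exact hkeq t ht
    simpa [b, h2] using h1
  have hlim : Filter.Tendsto (fun ε : ℝ => (‖A 0‖ + ε) * Real.exp ((∫ t in (0 : ℝ)..1, k t) + ε))
      (𝓝[>] 0) (𝓝 ((‖A 0‖ + 0) * Real.exp ((∫ t in (0 : ℝ)..1, k t) + 0))) := by
    refine Filter.Tendsto.mono_left ?_ nhdsWithin_le_nhds
    exact Continuous.tendsto (by fun_prop) 0
  rw [add_zero, add_zero] at hlim
  exact ge_of_tendsto hlim (Filter.eventually_of_mem self_mem_nhdsWithin hε)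

theorem HasDerivWithinAt.ringInverse {𝔸 : Type*} [NormedRing 𝔸] [NormedAlgebra ℝ 𝔸]
    [HasSummableGeomSeries 𝔸] {γ : ℝ → 𝔸} {γ' : 𝔸} {s : Set ℝ} {t : ℝ}
    (h : HasDerivWithinAt γ γ' s t) (hu : IsUnit (γ t)) :
    HasDerivWithinAt (fun u => Ring.inverse (γ u))
      (-(Ring.inverse (γ t) * γ' * Ring.inverse (γ t))) s t := by
  obtain ⟨x, hx⟩ := hu
  have h1 := hasFDerivAt_ringInverse (𝕜 := ℝ) x
  rw [hx] at h1
  have h2 := h1.comp_hasDerivWithinAt t h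
  rw [← hx, Ring.inverse_unit]
  simpa using! h2

section MatrixNorm

attribute [local instance] Matrix.linftyOpNormedRing Matrix.linftyOpNormedAlgebra

theorem Matrix.hasDerivWithinAt_of_entries {n : ℕ} {γ : ℝ → Matrix (Fin n) (Fin n) ℝ}
    {γ' : Matrix (Fin n) (Fin n) ℝ} {s : Set ℝ} {t : ℝ}
    (h : ∀ i j, HasDerivWithinAt (fun u => γ u i j) (γ' i j) s t) : HasDerivWithinAt γ γ' s t := by
  have h1 : HasDerivWithinAt (fun u => ∑ i, ∑ j, γ u i j • Matrix.single i j (1 : ℝ))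
      (∑ i, ∑ j, γ' i j • Matrix.single i j (1 : ℝ)) s t :=
    HasDerivWithinAt.fun_sum fun i _ => HasDerivWithinAt.fun_sum fun j _ => (h i j).smul_const _
  have h2 : ∀ M : Matrix (Fin n) (Fin n) ℝ, ∑ i, ∑ j, M i j • Matrix.single i j (1 : ℝ) = M := by
    intro M
    simp only [Matrix.smul_single, smul_eq_mul, mul_one]
    exact (Matrix.matrix_eq_sum_single M).symm
  simpa only [h2] using h1

theorem Matrix.hasDerivWithinAt_entry {n : ℕ} {γ : ℝ → Matrix (Fin n) (Fin n) ℝ}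
    {γ' : Matrix (Fin n) (Fin n) ℝ} {s : Set ℝ} {t : ℝ}
    (h : HasDerivWithinAt γ γ' s t) (i j : Fin n) :
    HasDerivWithinAt (fun u => γ u i j) (γ' i j) s t :=
  (LinearMap.toContinuousLinearMap (Matrix.entryLinearMap ℝ ℝ i j)).hasFDerivAt.comp_hasDerivWithinAt
    t h

theorem Matrix.hasDerivWithinAt_inv {n : ℕ} {γ : ℝ → Matrix (Fin n) (Fin n) ℝ}
    {γ' : Matrix (Fin n) (Fin n) ℝ} {s : Set ℝ} {t : ℝ}
    (h : ∀ i j, HasDerivWithinAt (fun u => γ u i j) (γ' i j) s t) (hu : IsUnit (γ t)) (i j : Fin n) :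
    HasDerivWithinAt (fun u => (γ u)⁻¹ i j) ((-((γ t)⁻¹ * γ' * (γ t)⁻¹)) i j) s t := by
  have _ : CompleteSpace (Matrix (Fin n) (Fin n) ℝ) := FiniteDimensional.complete ℝ _
  have h1 := (Matrix.hasDerivWithinAt_of_entries h).ringInverse hu
  simp only [← Matrix.nonsing_inv_eq_ringInverse] at h1
  exact Matrix.hasDerivWithinAt_entry h1 i j

theorem Matrix.abs_entry_le_linftyOpNorm {n : ℕ} (M : Matrix (Fin n) (Fin n) ℝ) (i j : Fin n) :
    |M i j| ≤ ‖M‖ := by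
  rw [Matrix.linfty_opNorm_def]
  have h1 : ∑ j, ‖M i j‖₊ ≤ Finset.univ.sup fun i => ∑ j, ‖M i j‖₊ :=
    Finset.le_sup (f := fun i => ∑ j, ‖M i j‖₊) (Finset.mem_univ i)
  have h2 : ‖M i j‖₊ ≤ ∑ j, ‖M i j‖₊ :=
    Finset.single_le_sum (f := fun j => ‖M i j‖₊) (fun _ _ => zero_le) (Finset.mem_univ j)
  exact_mod_cast h2.trans h1

namespace PrehomogeneousSpace

variable {N n : ℕ} (P : PrehomogeneousSpace N n)

theorem mat_eq (g : P.G) : P.mat g = ((g : P.GR) : GL (Fin N) ℝ) := rfl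

theorem isUnit_mat (g : P.G) : IsUnit (P.mat g) := Units.isUnit _

theorem mat_inv (g : P.G) : P.mat g⁻¹ = (P.mat g)⁻¹ := by
  rw [mat_eq, mat_eq, ← Matrix.coe_units_inv]
  rfl

theorem pairCoords_mat (g : P.G) : pairCoords (P.mat g) (P.mat g)⁻¹
    = glCoords ((g : P.GR) : GL (Fin N) ℝ) := by
  rw [← mat_inv]
  rfl

/-- The left logarithmic derivative of a curve in `G` has values in the Lie algebra. -/
theorem inv_mul_deriv_mem_lieAlg {γ : ℝ → Matrix (Fin N) (Fin N) ℝ} {γ' : Matrix (Fin N) (Fin N) ℝ}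
    (hG : ∀ t ∈ Set.Icc (0 : ℝ) 1, ∃ h : P.G, P.mat h = γ t) {t : ℝ} (ht : t ∈ Set.Icc (0 : ℝ) 1)
    (hγ : ∀ i j, HasDerivWithinAt (fun u => γ u i j) (γ' i j) (Set.Icc 0 1) t) :
    (γ t)⁻¹ * γ' ∈ P.lieAlg := by
  obtain ⟨h, hh⟩ := hG t ht
  have hu : IsUnit (γ t) := hh ▸ P.isUnit_mat h
  have hinv : γ t * (γ t)⁻¹ = 1 := Matrix.mul_nonsing_inv _ ((Matrix.isUnit_iff_isUnit_det _).1 hu)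
  have hmap : ∀ k : P.G, pairCoords ((P.mat k).map (algebraMap ℝ ℂ)) ((P.mat k)⁻¹.map (algebraMap ℝ ℂ))
      = glCoords ((P.toGC k : P.GC) : GL (Fin N) ℂ) := by
    intro k
    rw [← mat_inv]
    ext (⟨a, b⟩ | ⟨a, b⟩)
    · rfl
    · change _ = ((P.toGC k : P.GC) : GL (Fin N) ℂ)⁻¹ a b
      rw [← Subgroup.coe_inv, ← map_inv]
      rfl
  rw [mem_lieAlg_iff]
  refine P.mem_complexLie_of_tangent (P.toGC h).2 fun p hp => ?_
  have h1 := hasDerivWithinAt_eval_pairCoords (x := fun u => (γ u).map (algebraMap ℝ ℂ))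
    (y := fun u => (γ u)⁻¹.map (algebraMap ℝ ℂ)) (X := ((γ t)⁻¹ * γ').map (algebraMap ℝ ℂ))
    (s := Set.Icc 0 1) (t := t) (fun i j => by
      rw [← Matrix.map_mul, ← mul_assoc, hinv, one_mul]
      exact (hγ i j).ofReal_comp) (fun i j => by
      rw [← Matrix.map_mul]
      have := (Matrix.hasDerivWithinAt_inv hγ hu i j).ofReal_comp
      simpa using this) p
  have h2 : HasDerivWithinAt (fun u : ℝ => MvPolynomial.eval (pairCoords ((γ u).map (algebraMap ℝ ℂ))
      ((γ u)⁻¹.map (algebraMap ℝ ℂ))) p) 0 (Set.Icc 0 1) t := by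
    refine (hasDerivWithinAt_const t (Set.Icc (0 : ℝ) 1) (0 : ℂ)).congr_of_mem (fun u hu => ?_) ht
    obtain ⟨k, hk⟩ := hG u hu
    rw [← hk, hmap]
    exact P.mem_groupIdeal.1 hp _ (P.toGC k).2
  have h3 := (uniqueDiffOn_Icc_zero_one t ht).eq_deriv _ h1 h2
  rwa [← hh, hmap, hh] at h3

/-- Along a curve in `G`, the representation and its inverse grow at most exponentially in the
length: with `X = γ⁻¹ γ'` they satisfy `A' = A dρ(X)` and `(A⁻¹)' = -dρ(X) A⁻¹`, to which Grönwall's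
inequality applies. -/
theorem norm_realRep_le_exp_curveLength {B : LinearMap.BilinForm ℝ (Matrix (Fin N) (Fin N) ℝ)} {κ : ℝ}
    (hκ : ∀ X, ‖P.drho X‖ ≤ κ * √(B X X)) {γ : ℝ → Matrix (Fin N) (Fin N) ℝ}
    (hγ : ∀ i j, ContDiff ℝ 1 fun t => γ t i j)
    (hG : ∀ t ∈ Set.Icc (0 : ℝ) 1, ∃ h : P.G, P.mat h = γ t) (h0 : γ 0 = 1) {g : P.G}
    (h1 : γ 1 = P.mat g) :
    ‖P.realRep g‖ ≤ ‖(1 : Matrix (Fin n) (Fin n) ℝ)‖ * Real.exp (κ * curveLength B γ) ∧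
      ‖P.realRep (g⁻¹ : P.G)‖ ≤ ‖(1 : Matrix (Fin n) (Fin n) ℝ)‖ * Real.exp (κ * curveLength B γ) := by
  choose! c hc using hG
  have hder : ∀ t i j, HasDerivAt (fun u => γ u i j) (curveDeriv γ t i j) t := fun t i j =>
    ((hγ i j).differentiable one_ne_zero).differentiableAt.hasDerivAt
  have hu : ∀ t ∈ Set.Icc (0 : ℝ) 1, IsUnit (γ t) := fun t ht => hc t ht ▸ P.isUnit_mat _
  let X : ℝ → Matrix (Fin N) (Fin N) ℝ := fun t => (γ t)⁻¹ * curveDeriv γ t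
  have hX : ∀ t ∈ Set.Icc (0 : ℝ) 1, X t ∈ P.lieAlg := fun t ht =>
    P.inv_mul_deriv_mem_lieAlg (fun t ht => ⟨c t, hc t ht⟩) ht
      fun i j => (hder t i j).hasDerivWithinAt
  have hinv' : ∀ t ∈ Set.Icc (0 : ℝ) 1, ∀ i j, HasDerivAt (fun u => (γ u)⁻¹ i j)
      (-(X t * (γ t)⁻¹) i j) t := fun t ht i j => by
    have := Matrix.hasDerivWithinAt_inv (s := Set.univ)
      (fun i j => (hder t i j).hasDerivWithinAt) (hu t ht) i j
    simpa [X] using this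
  let A : ℝ → Matrix (Fin n) (Fin n) ℝ := fun t => Matrix.of fun i j =>
    MvPolynomial.eval (pairCoords (γ t) (γ t)⁻¹) (P.repPoly i j)
  have hAeq : ∀ t ∈ Set.Icc (0 : ℝ) 1, A t = P.realRep (c t) := by
    intro t ht
    ext i j
    rw [P.realRep_apply, ← P.pairCoords_mat, hc t ht]
    rfl
  have hAder : ∀ t ∈ Set.Icc (0 : ℝ) 1, ∀ i j,
      HasDerivWithinAt (fun u => A u i j) ((A t * P.drho (X t)) i j) Set.univ t := by
    intro t ht i j
    have hgX : γ t * X t = curveDeriv γ t := by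
      rw [← mul_assoc, Matrix.mul_nonsing_inv _ ((Matrix.isUnit_iff_isUnit_det _).1 (hu t ht)),
        one_mul]
    have := hasDerivWithinAt_eval_pairCoords (x := γ) (y := fun u => (γ u)⁻¹) (X := X t)
      (s := Set.univ) (t := t) (fun i j => by rw [hgX]; exact (hder t i j).hasDerivWithinAt)
      (fun i j => (hinv' t ht i j).hasDerivWithinAt) (P.repPoly i j)
    convert! this using 1
    rw [hAeq t ht, ← P.eval_invField_repPoly (hX t ht), ← P.pairCoords_mat, hc t ht]
  have hrep : ∀ k : P.G, P.realRep k * P.realRep (k⁻¹ : P.G) = 1 := by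
    intro k
    rw [← realRep_mul, ← Subgroup.coe_mul, mul_inv_cancel]
    exact P.realRep_one
  have hAu : ∀ t ∈ Set.Icc (0 : ℝ) 1, IsUnit (A t) := fun t ht => by
    rw [hAeq t ht]
    exact IsUnit.of_mul_eq_one _ (hrep (c t))
  have hAinv : ∀ t ∈ Set.Icc (0 : ℝ) 1, (A t)⁻¹ = P.realRep ((c t)⁻¹ : P.G) := fun t ht => by
    rw [hAeq t ht]
    exact Matrix.inv_eq_right_inv (hrep (c t))
  have hAd : ∀ t ∈ Set.Icc (0 : ℝ) 1, HasDerivWithinAt A (A t * P.drho (X t)) Set.univ t :=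
    fun t ht => Matrix.hasDerivWithinAt_of_entries (hAder t ht)
  have hAid : ∀ t ∈ Set.Icc (0 : ℝ) 1, HasDerivWithinAt (fun u => (A u)⁻¹)
      (-(P.drho (X t) * (A t)⁻¹)) Set.univ t := fun t ht => by
    refine Matrix.hasDerivWithinAt_of_entries fun i j => ?_
    have := Matrix.hasDerivWithinAt_inv (hAder t ht) (hAu t ht) i j
    rwa [← mul_assoc, Matrix.nonsing_inv_mul _ ((Matrix.isUnit_iff_isUnit_det _).1 (hAu t ht)),
      one_mul] at this
  have hXc : ∀ i j, ContinuousOn (fun t => X t i j) (Set.Icc 0 1) := by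
    intro i j
    simp only [X, Matrix.mul_apply]
    refine continuousOn_finsetSum _ fun l _ => ContinuousOn.mul (fun t ht =>
      (hinv' t ht i l).continuousAt.continuousWithinAt) ?_
    exact ((hγ l j).continuous_deriv le_rfl).continuousOn
  let k : ℝ → ℝ := fun t => κ * √(B (X t) (X t))
  have hk : ContinuousOn k (Set.Icc 0 1) := by
    refine continuousOn_const.mul (Real.continuous_sqrt.comp_continuousOn ?_)
    have hlin : ∀ φ : Matrix (Fin N) (Fin N) ℝ →ₗ[ℝ] ℝ,
        ContinuousOn (fun t => φ (X t)) (Set.Icc 0 1) := fun φ =>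
      φ.continuous_of_finiteDimensional.comp_continuousOn
        (continuousOn_pi.2 fun i => continuousOn_pi.2 fun j => hXc i j)
    have hB : ∀ t, B (X t) (X t) = ∑ i, ∑ j, X t i j * B (Matrix.single i j 1) (X t) := by
      intro t
      have h := congrArg (LinearMap.flip B (X t)) (Matrix.matrix_eq_sum_single (X t))
      simp only [map_sum, LinearMap.flip_apply] at h
      refine h.trans (Finset.sum_congr rfl fun i _ => Finset.sum_congr rfl fun j _ => ?_)
      rw [show Matrix.single i j (X t i j) = X t i j • Matrix.single i j (1 : ℝ) by
        rw [Matrix.smul_single, smul_eq_mul, mul_one], map_smul, LinearMap.smul_apply, smul_eq_mul]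
    simp only [hB]
    exact continuousOn_finsetSum _ fun i _ => continuousOn_finsetSum _ fun j _ =>
      (hXc i j).mul (hlin _)
  have hint : ∫ t in (0 : ℝ)..1, k t = κ * curveLength B γ :=
    intervalIntegral.integral_const_mul _ _
  have hc0 : P.realRep (c 0) = 1 := by
    have : c 0 = 1 := by
      apply Subtype.ext
      apply Subtype.ext
      apply Units.ext
      exact (hc 0 (by simp)).trans h0
    rw [this]
    exact P.realRep_one
  have hc1 : c 1 = g := by
    apply Subtype.ext
    apply Subtype.ext
    apply Units.ext
    exact (hc 1 (by simp)).trans h1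
  constructor
  · have h := norm_le_mul_exp_integral (A := A) (A' := fun t => A t * P.drho (X t)) (k := k)
      (fun t ht => (hAd t ht).continuousWithinAt.mono (Set.subset_univ _))
      (fun t ht => (hAd t (Set.Ico_subset_Icc_self ht)).mono (Set.subset_univ _)) hk
      (fun t _ => (norm_mul_le _ _).trans (by
        rw [mul_comm]; exact mul_le_mul_of_nonneg_right (hκ _) (norm_nonneg _)))
    rwa [hint, hAeq 0 (by simp), hAeq 1 (by simp), hc0, hc1] at h
  · have h := norm_le_mul_exp_integral (A := fun t => (A t)⁻¹)
      (A' := fun t => -(P.drho (X t) * (A t)⁻¹)) (k := k)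
      (fun t ht => (hAid t ht).continuousWithinAt.mono (Set.subset_univ _))
      (fun t ht => (hAid t (Set.Ico_subset_Icc_self ht)).mono (Set.subset_univ _)) hk
      (fun t _ => by
        rw [norm_neg]
        exact (norm_mul_le _ _).trans (mul_le_mul_of_nonneg_right (hκ _) (norm_nonneg _)))
    rwa [hint, hAinv 1 (by simp), hAeq 0 (by simp), hc0, inv_one, hc1] at h

/-- The matrix coefficients of the representation grow at most exponentially in `|g|`. -/
theorem exists_abs_realRep_le (B : LinearMap.BilinForm ℝ (Matrix (Fin N) (Fin N) ℝ))
    (hB_symm : ∀ X Y, B X Y = B Y X) (hB_pos : ∀ X, X ≠ 0 → 0 < B X X) :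
    ∃ C κ : ℝ, 0 ≤ C ∧ 0 ≤ κ ∧ ∀ (g : P.G) (i j : Fin n),
      |P.realRep g i j| ≤ C * Real.exp (κ * P.absG B g) ∧
      |P.realRep (g⁻¹ : P.G) i j| ≤ C * Real.exp (κ * P.absG B g) := by
  obtain ⟨κ, hκ0, hκ⟩ := LinearMap.exists_bound_of_posDef B hB_symm hB_pos P.drho
  refine ⟨‖(1 : Matrix (Fin n) (Fin n) ℝ)‖, κ, norm_nonneg _, hκ0, fun g i j => ?_⟩
  set S : Set ℝ := {L | ∃ γ : ℝ → Matrix (Fin N) (Fin N) ℝ,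
    (∀ i j, ContDiff ℝ 1 fun t => γ t i j) ∧ (∀ t ∈ Set.Icc (0 : ℝ) 1, ∃ h : P.G, P.mat h = γ t) ∧
    γ 0 = 1 ∧ γ 1 = P.mat g ∧ L = curveLength B γ} with hS
  have hne : S.Nonempty := by
    have hg : g ∈ P.smoothlyJoined := P.smoothlyJoined_eq_top ▸ Subgroup.mem_top g
    obtain ⟨γ, h0, h1, hγ, _⟩ := hg
    exact ⟨_, fun t => P.mat (γ t), hγ, fun t _ => ⟨_, rfl⟩, by simp [h0, mat_one], by simp [h1], rfl⟩
  have hbdd : BddBelow S := by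
    refine ⟨0, ?_⟩
    rintro _ ⟨γ, -, -, -, -, rfl⟩
    exact intervalIntegral.integral_nonneg zero_le_one fun _ _ => Real.sqrt_nonneg _
  have hmem : P.absG B g ∈ closure S := csInf_mem_closure hne hbdd
  have hcont : Continuous fun L : ℝ => ‖(1 : Matrix (Fin n) (Fin n) ℝ)‖ * Real.exp (κ * L) := by
    fun_prop
  have hclosed : IsClosed {L : ℝ |
      |P.realRep g i j| ≤ ‖(1 : Matrix (Fin n) (Fin n) ℝ)‖ * Real.exp (κ * L) ∧
      |P.realRep (g⁻¹ : P.G) i j| ≤ ‖(1 : Matrix (Fin n) (Fin n) ℝ)‖ * Real.exp (κ * L)} :=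
    (isClosed_le continuous_const hcont).inter (isClosed_le continuous_const hcont)
  refine closure_minimal ?_ hclosed hmem
  rintro _ ⟨γ, hγ, hG, h0, h1, rfl⟩
  have h := P.norm_realRep_le_exp_curveLength hκ hγ hG h0 h1
  exact ⟨(Matrix.abs_entry_le_linftyOpNorm _ i j).trans h.1,
    (Matrix.abs_entry_le_linftyOpNorm _ i j).trans h.2⟩

end PrehomogeneousSpace

end MatrixNorm

/-! ### Left Lie derivatives -/

/-- If `F'` is the derivative of `F` along the left translations by a curve `c`, then its integral
with respect to a left invariant measure vanishes. -/
theorem integral_deriv_mul_left_eq_zero {H : Type*} [Group H] [TopologicalSpace H]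
    [IsTopologicalGroup H] [SecondCountableTopology H] [MeasurableSpace H] [BorelSpace H]
    (μ : Measure H) [SFinite μ] [μ.IsMulLeftInvariant] {c : ℝ → H} (hc : Continuous c)
    (hc0 : c 0 = 1) {F F' : H → ℂ}
    (h : ∀ g s, HasDerivAt (fun t => F (c t * g)) (F' (c s * g)) s)
    (hF' : Continuous F') (hFi : Integrable F μ) (hFi' : Integrable F' μ) : ∫ g, F' g ∂μ = 0 := by
  have hcont : Continuous fun p : ℝ × H => F' (c p.1 * p.2) :=
    hF'.comp ((hc.comp continuous_fst).mul continuous_snd)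
  have hint : Integrable (Function.uncurry fun (s : ℝ) (g : H) => F' (c s * g))
      ((volume.restrict (Set.uIoc (0 : ℝ) 1)).prod μ) := by
    have hm : AEStronglyMeasurable
        (Function.uncurry fun (s : ℝ) (g : H) => F' (c s * g))
        ((volume.restrict (Set.uIoc (0 : ℝ) 1)).prod μ) := hcont.aestronglyMeasurable
    rw [integrable_prod_iff hm]
    refine ⟨Filter.Eventually.of_forall fun s => hFi'.comp_mul_left (c s), ?_⟩
    have : ∀ s : ℝ, ∫ g, ‖F' (c s * g)‖ ∂μ = ∫ g, ‖F' g‖ ∂μ := fun s =>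
      integral_mul_left_eq_self (fun g => ‖F' g‖) _
    simp only [Function.uncurry_apply_pair, this]
    have _ : IsFiniteMeasure ((volume : Measure ℝ).restrict (Set.uIoc (0 : ℝ) 1)) := by
      unfold Set.uIoc
      infer_instance
    exact integrable_const _
  have hswap := intervalIntegral_integral_swap hint
  have h1 : ∀ s : ℝ, ∫ g, F' (c s * g) ∂μ = ∫ g, F' g ∂μ := fun s =>
    integral_mul_left_eq_self F' _
  have h2 : ∀ g, ∫ s in (0 : ℝ)..1, F' (c s * g) = F (c 1 * g) - F g := by
    intro g
    rw [intervalIntegral.integral_eq_sub_of_hasDerivAt (fun s _ => h g s)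
      ((hcont.comp (continuous_id.prodMk continuous_const)).intervalIntegrable _ _)]
    simp [hc0]
  simp only [h1, h2] at hswap
  rw [integral_sub (hFi.comp_mul_left _) hFi, integral_mul_left_eq_self, sub_self] at hswap
  simpa using hswap

namespace PrehomogeneousSpace

variable {N n : ℕ} (P : PrehomogeneousSpace N n)

/-- `g ↦ (g, g⁻¹)` is a closed embedding of `G` in a finite-dimensional space. -/
theorem isClosedEmbedding_pair : IsClosedEmbedding fun g : P.G =>
    ((P.mat g, P.mat g⁻¹) : (Fin N → Fin N → ℝ) × (Fin N → Fin N → ℝ)) := by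
  have h1 : IsClosedEmbedding (Units.embedProduct (Matrix (Fin N) (Fin N) ℝ)) :=
    Units.isClosedEmbedding_embedProduct
  have h2 : IsClosedEmbedding fun g : P.G => ((g : P.GR) : GL (Fin N) ℝ) :=
    (P.isClosed_GR.isClosedEmbedding_subtypeVal).comp
      ((isClosed_connectedComponent (x := (1 : P.GR))).isClosedEmbedding_subtypeVal)
  exact (((Homeomorph.refl (Matrix (Fin N) (Fin N) ℝ)).prodCongr
    MulOpposite.opHomeomorph.symm).isClosedEmbedding.comp h1).comp h2

theorem sigmaCompactSpace_G : SigmaCompactSpace P.G := P.isClosedEmbedding_pair.sigmaCompactSpace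

theorem secondCountableTopology_G : SecondCountableTopology P.G :=
  P.isClosedEmbedding_pair.isEmbedding.secondCountableTopology

theorem continuous_mat : Continuous fun g : P.G => (P.mat g : Fin N → Fin N → ℝ) :=
  P.isClosedEmbedding_pair.continuous.fst

theorem continuous_mat_inv : Continuous fun g : P.G => (P.mat g⁻¹ : Fin N → Fin N → ℝ) :=
  P.isClosedEmbedding_pair.continuous.snd

theorem continuous_realRep (i j : Fin n) : Continuous fun g : P.G => P.realRep g i j := by
  have : (fun g : P.G => P.realRep g i j) = fun g : P.G =>
      MvPolynomial.eval (pairCoords (P.mat g) (P.mat g⁻¹)) (P.repPoly i j) := by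
    ext g
    rw [realRep_apply, mat_inv, pairCoords_mat]
  rw [this]
  refine (MvPolynomial.continuous_eval _).comp (continuous_pi ?_)
  rintro (⟨a, b⟩ | ⟨a, b⟩)
  · exact (continuous_apply b).comp ((continuous_apply a).comp P.continuous_mat)
  · exact (continuous_apply b).comp ((continuous_apply a).comp P.continuous_mat_inv)

theorem continuous_oneParam (X : P.lieAlg) : Continuous (P.oneParam X) :=
  ((continuous_expGL_smul _).subtype_mk _).subtype_mk _

theorem oneParam_zero (X : P.lieAlg) : P.oneParam X 0 = 1 := by
  apply Subtype.ext
  apply Subtype.ext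
  change gexp ((0 : ℝ) • (X : Matrix (Fin N) (Fin N) ℝ)) = 1
  rw [zero_smul, gexp_zero]

theorem oneParam_add (X : P.lieAlg) (s t : ℝ) :
    P.oneParam X (s + t) = P.oneParam X s * P.oneParam X t := by
  apply Subtype.ext
  apply Subtype.ext
  apply Units.ext
  change NormedSpace.exp ((s + t) • (X : Matrix (Fin N) (Fin N) ℝ))
    = NormedSpace.exp (s • (X : Matrix (Fin N) (Fin N) ℝ))
      * NormedSpace.exp (t • (X : Matrix (Fin N) (Fin N) ℝ))
  rw [add_smul, Matrix.exp_add_of_commute]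
  exact ((Commute.refl _).smul_left s).smul_right t

theorem oneParam_neg (X : P.lieAlg) (t : ℝ) : P.oneParam X (-t) = (P.oneParam X t)⁻¹ := by
  rw [eq_inv_iff_mul_eq_one, ← oneParam_add, neg_add_cancel, oneParam_zero]

/-- `F'` is `dL(X) F`, where `F` is required to be differentiable along the flow, so that no value
of `dL` is a default value of `deriv`. -/
def HasLieDeriv (X : P.lieAlg) (F F' : P.G → ℂ) : Prop :=
  ∀ g, HasDerivAt (fun t : ℝ => F (P.oneParam X (-t) * g)) (F' g) 0

variable {P}

/-- The derivative at an arbitrary time, by the group law. -/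
theorem HasLieDeriv.hasDerivAt {X : P.lieAlg} {F F' : P.G → ℂ} (h : P.HasLieDeriv X F F')
    (g : P.G) (s : ℝ) : HasDerivAt (fun t : ℝ => F (P.oneParam X (-t) * g))
      (F' (P.oneParam X (-s) * g)) s := by
  have h1 := h (P.oneParam X (-s) * g)
  have h2 := HasDerivAt.scomp s (g₁ := fun t : ℝ => F (P.oneParam X (-t) * (P.oneParam X (-s) * g)))
    (h := fun t => t - s) (by simpa using h1) ((hasDerivAt_id s).sub_const s)
  rw [one_smul] at h2
  convert! h2 using 1
  ext t
  simp only [Function.comp_apply]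
  rw [← mul_assoc, ← oneParam_add]
  congr 3
  ring

theorem HasLieDeriv.add {X : P.lieAlg} {F F' H H' : P.G → ℂ} (h : P.HasLieDeriv X F F')
    (k : P.HasLieDeriv X H H') : P.HasLieDeriv X (fun g => F g + H g) (fun g => F' g + H' g) :=
  fun g => (h g).add (k g)

theorem HasLieDeriv.mul {X : P.lieAlg} {F F' H H' : P.G → ℂ} (h : P.HasLieDeriv X F F')
    (k : P.HasLieDeriv X H H') :
    P.HasLieDeriv X (fun g => F g * H g) (fun g => F' g * H g + F g * H' g) := fun g => by
  have := (h g).mul (k g)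
  simpa [oneParam_zero] using! this

theorem HasLieDeriv.const_mul {X : P.lieAlg} {F F' : P.G → ℂ} (c : ℂ) (h : P.HasLieDeriv X F F') :
    P.HasLieDeriv X (fun g => c * F g) (fun g => c * F' g) := fun g => (h g).const_mul c

theorem HasLieDeriv.sum {X : P.lieAlg} {ι : Type*} {s : Finset ι} {F F' : ι → P.G → ℂ}
    (h : ∀ i ∈ s, P.HasLieDeriv X (F i) (F' i)) :
    P.HasLieDeriv X (fun g => ∑ i ∈ s, F i g) (fun g => ∑ i ∈ s, F' i g) :=
  fun g => HasDerivAt.fun_sum fun i hi => h i hi g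

variable (P)

theorem integral_hasLieDeriv_eq_zero [MeasurableSpace P.G] [BorelSpace P.G] (μ : Measure P.G)
    [μ.IsHaarMeasure] {X : P.lieAlg} {F F' : P.G → ℂ} (h : P.HasLieDeriv X F F')
    (hF' : Continuous F') (hFi : Integrable F μ) (hFi' : Integrable F' μ) : ∫ g, F' g ∂μ = 0 := by
  have _ := P.sigmaCompactSpace_G
  have _ := P.secondCountableTopology_G
  exact integral_deriv_mul_left_eq_zero μ ((P.continuous_oneParam X).comp continuous_neg)
    (by simp [oneParam_zero]) h.hasDerivAt hF' hFi hFi'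

theorem hasDerivAt_mat_oneParam (X : P.lieAlg) (g : P.G) (i j : Fin N) :
    HasDerivAt (fun t : ℝ => P.mat (P.oneParam X (-t) * g) i j)
      (-((X : Matrix (Fin N) (Fin N) ℝ) * P.mat g) i j) 0 := by
  have h : ∀ c, HasDerivAt (fun t : ℝ => P.mat (P.oneParam X (-t)) i c)
      (-(X : Matrix (Fin N) (Fin N) ℝ) i c) 0 := by
    intro c
    have := hasDerivAt_matrix_exp_smul (-(X : Matrix (Fin N) (Fin N) ℝ)) 0 i c
    rw [zero_smul, NormedSpace.exp_zero, one_mul] at this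
    simpa only [smul_neg, ← neg_smul] using! this
  simp only [mat_mul, Matrix.mul_apply, ← Finset.sum_neg_distrib, ← neg_mul]
  exact HasDerivAt.fun_sum fun c _ => (h c).mul_const _

theorem IsSmooth.continuous {P : PrehomogeneousSpace N n} {f : P.G → ℂ} (hf : P.IsSmooth f) :
    Continuous f := by
  rw [continuous_iff_continuousAt]
  intro g
  obtain ⟨F, hF, hFf⟩ := hf g
  exact (hF.continuous.comp P.continuous_mat).continuousAt.congr hFf

/-- A smooth function is differentiable along `dL(X)`, and its derivative is smooth. -/
theorem IsSmooth.hasLieDeriv {P : PrehomogeneousSpace N n} {f : P.G → ℂ} (hf : P.IsSmooth f)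
    (X : P.lieAlg) : P.HasLieDeriv X f (P.dL X f) ∧ P.IsSmooth (P.dL X f) := by
  have key : ∀ g : P.G, ∃ F : (Fin N → Fin N → ℝ) → ℂ, ContDiff ℝ ∞ F ∧
      ∀ᶠ h in 𝓝 g, HasDerivAt (fun t : ℝ => f (P.oneParam X (-t) * h)) (F (P.mat h)) 0 := by
    intro g
    obtain ⟨F, hF, hFf⟩ := hf g
    -- the vector field `x ↦ -X x` of the flow `exp(-t X) x`
    let v : (Fin N → Fin N → ℝ) → Fin N → Fin N → ℝ := fun x i j =>
      -∑ c, (X : Matrix (Fin N) (Fin N) ℝ) i c * x c j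
    have hv : ContDiff ℝ ∞ v := by
      refine contDiff_pi.2 fun i => contDiff_pi.2 fun j => ContDiff.neg (ContDiff.sum fun c _ => ?_)
      exact contDiff_const.mul (contDiff_apply_apply (𝕜 := ℝ) (E := ℝ) c j)
    refine ⟨fun x => fderiv ℝ F x (v x), (hF.fderiv_right (m := ∞) le_rfl).clm_apply hv, ?_⟩
    filter_upwards [eventually_eventually_nhds.2 hFf] with h hh
    let c : ℝ → Fin N → Fin N → ℝ := fun t i j => P.mat (P.oneParam X (-t) * h) i j
    have hcurve : HasDerivAt c (v (P.mat h)) 0 :=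
      hasDerivAt_pi.2 fun i => hasDerivAt_pi.2 fun j => P.hasDerivAt_mat_oneParam X h i j
    have h0 : P.mat (P.oneParam X (-0) * h) = P.mat h := by
      rw [neg_zero, oneParam_zero, one_mul]
    have hFd : HasFDerivAt F (fderiv ℝ F (P.mat h)) (c 0) := by
      rw [show c 0 = P.mat h from h0]
      exact (hF.differentiable (by simp)).differentiableAt.hasFDerivAt
    have hd := hFd.comp_hasDerivAt (0 : ℝ) hcurve
    refine hd.congr_of_eventuallyEq ?_
    have hlim : Filter.Tendsto (fun t : ℝ => P.oneParam X (-t) * h) (𝓝 0) (𝓝 h) := by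
      have : Continuous fun t : ℝ => P.oneParam X (-t) * h :=
        ((P.continuous_oneParam X).comp continuous_neg).mul continuous_const
      simpa [oneParam_zero] using this.tendsto 0
    filter_upwards [hlim.eventually hh] with t ht
    exact ht.symm
  constructor
  · intro g
    obtain ⟨F, _, hFf⟩ := key g
    have := hFf.self_of_nhds
    rwa [← this.deriv] at this
  · intro g
    obtain ⟨F, hF, hFf⟩ := key g
    exact ⟨F, hF, hFf.mono fun h hh => hh.deriv.symm⟩

theorem LeftDerivative.isSmooth {P : PrehomogeneousSpace N n} {f : P.G → ℂ} (hf : P.IsSmooth f)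
    {h : P.G → ℂ} (hh : P.LeftDerivative f h) : P.IsSmooth h := by
  induction hh with
  | self => exact hf
  | lie X h _ ih => exact (ih.hasLieDeriv X).2
  | add h₁ h₂ _ _ ih₁ ih₂ =>
    intro g
    obtain ⟨F₁, hF₁, h₁⟩ := ih₁ g
    obtain ⟨F₂, hF₂, h₂⟩ := ih₂ g
    refine ⟨fun x => F₁ x + F₂ x, hF₁.add hF₂, ?_⟩
    filter_upwards [h₁, h₂] with k hk₁ hk₂
    rw [hk₁, hk₂]
  | smul c h _ ih =>
    intro g
    obtain ⟨F, hF, hh⟩ := ih g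
    refine ⟨fun x => c * F x, contDiff_const.mul hF, ?_⟩
    filter_upwards [hh] with k hk
    rw [hk]

theorem hasDerivAt_realRep_oneParam (X : P.lieAlg) (i j : Fin n) :
    HasDerivAt (fun t : ℝ => P.realRep (P.oneParam X t) i j)
      (P.drho (X : Matrix (Fin N) (Fin N) ℝ) i j) 0 := by
  have h := hasDerivAt_eval_gexp 1 (X : Matrix (Fin N) (Fin N) ℝ) (P.repPoly i j) 0
  rw [zero_smul, gexp_zero, one_mul] at h
  convert! h using 1
  ext t
  rw [realRep_apply, one_mul]
  rfl

theorem hasLieDeriv_realRep (X : P.lieAlg) (i j : Fin n) :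
    P.HasLieDeriv X (fun g => (P.realRep g i j : ℂ))
      (fun g => ∑ k, ((-P.drho (X : Matrix (Fin N) (Fin N) ℝ) i k : ℝ) : ℂ) * P.realRep g k j) := by
  intro g
  have h1 : ∀ k, HasDerivAt (fun t : ℝ => P.realRep (P.oneParam X (-t)) i k)
      (-P.drho (X : Matrix (Fin N) (Fin N) ℝ) i k) 0 := by
    intro k
    have h := P.hasDerivAt_realRep_oneParam X i k
    have h2 := HasDerivAt.scomp (0 : ℝ) (g₁ := fun t : ℝ => P.realRep (P.oneParam X t) i k)
      (h := fun t => -t) (by simpa using h) (hasDerivAt_neg 0)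
    simpa using! h2
  have h2 : HasDerivAt (fun t : ℝ => ∑ k, P.realRep (P.oneParam X (-t)) i k * P.realRep g k j)
      (∑ k, -P.drho (X : Matrix (Fin N) (Fin N) ℝ) i k * P.realRep g k j) 0 :=
    HasDerivAt.fun_sum fun k _ => (h1 k).mul_const _
  have h3 := h2.ofReal_comp
  simp only [Complex.ofReal_sum, Complex.ofReal_mul] at h3
  convert! h3 using 1
  ext t
  change (P.realRep (P.oneParam X (-t) * g : P.G) i j : ℂ) = _
  rw [Subgroup.coe_mul, realRep_mul, Matrix.mul_apply, Complex.ofReal_sum]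
  simp only [Complex.ofReal_mul]

theorem hasLieDeriv_realRep_inv (X : P.lieAlg) (i j : Fin n) :
    P.HasLieDeriv X (fun g => (P.realRep (g⁻¹ : P.G) i j : ℂ))
      (fun g => ∑ k, (P.drho (X : Matrix (Fin N) (Fin N) ℝ) k j : ℂ)
        * P.realRep (g⁻¹ : P.G) i k) := by
  intro g
  have h2 : HasDerivAt (fun t : ℝ => ∑ k, P.realRep (P.oneParam X t) k j * P.realRep (g⁻¹ : P.G) i k)
      (∑ k, P.drho (X : Matrix (Fin N) (Fin N) ℝ) k j * P.realRep (g⁻¹ : P.G) i k) 0 :=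
    HasDerivAt.fun_sum fun k _ => (P.hasDerivAt_realRep_oneParam X k j).mul_const _
  have h3 := h2.ofReal_comp
  simp only [Complex.ofReal_sum, Complex.ofReal_mul] at h3
  convert! h3 using 1
  ext t
  change (P.realRep ((P.oneParam X (-t) * g)⁻¹ : P.G) i j : ℂ) = _
  rw [oneParam_neg, mul_inv_rev, inv_inv, Subgroup.coe_mul, realRep_mul, Matrix.mul_apply,
    Complex.ofReal_sum]
  simp only [Complex.ofReal_mul, mul_comm]

/-! ### Amplitudes -/

/-- The module generated by the left derivatives of `f` over the algebra of the matrix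
coefficients of the representation and of its inverse. It is stable under left derivatives, and
its elements are integrable when `f` is rapidly decreasing. -/
inductive Amplitude (f : P.G → ℂ) : (P.G → ℂ) → Prop
  | base (h : P.G → ℂ) : P.LeftDerivative f h → Amplitude f h
  | rep (i j : Fin n) (F : P.G → ℂ) : Amplitude f F → Amplitude f fun g => P.realRep g i j * F g
  | repInv (i j : Fin n) (F : P.G → ℂ) : Amplitude f F →
      Amplitude f fun g => P.realRep (g⁻¹ : P.G) i j * F g
  | add (F H : P.G → ℂ) : Amplitude f F → Amplitude f H → Amplitude f fun g => F g + H g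
  | smul (c : ℂ) (F : P.G → ℂ) : Amplitude f F → Amplitude f fun g => c * F g

variable {P} {f : P.G → ℂ}

theorem Amplitude.sum {ι : Type*} (s : Finset ι) {F : ι → P.G → ℂ}
    (h : ∀ i ∈ s, P.Amplitude f (F i)) : P.Amplitude f fun g => ∑ i ∈ s, F i g := by
  classical
  induction s using Finset.induction_on with
  | empty =>
    have := Amplitude.smul 0 f (Amplitude.base f LeftDerivative.self)
    simpa using this
  | insert a s ha ih =>
    simp only [Finset.sum_insert ha]
    exact Amplitude.add _ _ (h a (Finset.mem_insert_self _ _))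
      (ih fun i hi => h i (Finset.mem_insert_of_mem hi))

theorem Amplitude.continuous (hf : P.IsSmooth f) {F : P.G → ℂ} (hF : P.Amplitude f F) :
    Continuous F := by
  induction hF with
  | base h hh => exact (hh.isSmooth hf).continuous
  | rep i j F _ ih => exact (Complex.continuous_ofReal.comp (P.continuous_realRep i j)).mul ih
  | repInv i j F _ ih =>
    exact (Complex.continuous_ofReal.comp ((P.continuous_realRep i j).comp continuous_inv)).mul ih
  | add F H _ _ ih₁ ih₂ => exact ih₁.add ih₂
  | smul c F _ ih => exact continuous_const.mul ih

theorem Amplitude.exists_hasLieDeriv (hf : P.IsSmooth f) {F : P.G → ℂ} (hF : P.Amplitude f F)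
    (X : P.lieAlg) : ∃ F', P.Amplitude f F' ∧ P.HasLieDeriv X F F' := by
  induction hF with
  | base h hh => exact ⟨_, .base _ (.lie X h hh), ((hh.isSmooth hf).hasLieDeriv X).1⟩
  | rep i j F hF ih =>
    obtain ⟨F', hF', hd⟩ := ih
    refine ⟨_, ?_, (P.hasLieDeriv_realRep X i j).mul hd⟩
    refine .add _ _ ?_ (.rep i j _ hF')
    simp only [Finset.sum_mul, mul_assoc]
    exact Amplitude.sum _ fun k _ => .smul _ _ (.rep k j _ hF)
  | repInv i j F hF ih =>
    obtain ⟨F', hF', hd⟩ := ih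
    refine ⟨_, ?_, (P.hasLieDeriv_realRep_inv X i j).mul hd⟩
    refine .add _ _ ?_ (.repInv i j _ hF')
    simp only [Finset.sum_mul, mul_assoc]
    exact Amplitude.sum _ fun k _ => .smul _ _ (.repInv i k _ hF)
  | add F H _ _ ih₁ ih₂ =>
    obtain ⟨F', hF', hd⟩ := ih₁
    obtain ⟨H', hH', hd'⟩ := ih₂
    exact ⟨_, .add _ _ hF' hH', hd.add hd'⟩
  | smul c F _ ih =>
    obtain ⟨F', hF', hd⟩ := ih
    exact ⟨_, .smul c _ hF', hd.const_mul c⟩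

/-- The exponential decay of the derivatives of `f` absorbs the growth of the matrix
coefficients. -/
theorem Amplitude.integrable_exp_mul [MeasurableSpace P.G] [BorelSpace P.G] {μ : Measure P.G}
    {B : LinearMap.BilinForm ℝ (Matrix (Fin N) (Fin N) ℝ)} (hB_symm : ∀ X Y, B X Y = B Y X)
    (hB_pos : ∀ X, X ≠ 0 → 0 < B X X) (hf : P.RapidlyDecreasing B μ f) {F : P.G → ℂ}
    (hF : P.Amplitude f F) (κ : ℝ) (hκ : 0 ≤ κ) :
    Integrable (fun g => (Real.exp (κ * P.absG B g) : ℂ) * F g) μ := by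
  have _ := P.secondCountableTopology_G
  obtain ⟨C, κ₀, hC, hκ₀, hgrow⟩ := P.exists_abs_realRep_le B hB_symm hB_pos
  have hmul : ∀ (r : P.G → ℝ) (F : P.G → ℂ), Continuous r →
      (∀ g, |r g| ≤ C * Real.exp (κ₀ * P.absG B g)) →
      (∀ κ, 0 ≤ κ → Integrable (fun g => (Real.exp (κ * P.absG B g) : ℂ) * F g) μ) →
      ∀ κ, 0 ≤ κ → Integrable (fun g => (Real.exp (κ * P.absG B g) : ℂ) * (r g * F g)) μ := by
    intro r F hr hrC hF κ hκ
    have h1 : AEStronglyMeasurable (fun g => (r g : ℂ)) μ :=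
      (Complex.continuous_ofReal.comp hr).aestronglyMeasurable
    have h2 := h1.mul (hF κ hκ).aestronglyMeasurable
    refine ((hF (κ + κ₀) (by positivity)).const_mul (C : ℂ)).mono
      (h2.congr (Filter.Eventually.of_forall fun g => by simp only [Pi.mul_apply]; ring))
      (Filter.Eventually.of_forall fun g => ?_)
    simp only [norm_mul, Complex.norm_real, Real.norm_eq_abs, abs_of_nonneg hC, Real.abs_exp]
    rw [add_mul, Real.exp_add]
    have := mul_le_mul_of_nonneg_right (hrC g) (norm_nonneg (F g))
    calc Real.exp (κ * P.absG B g) * (|r g| * ‖F g‖)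
        ≤ Real.exp (κ * P.absG B g) * (C * Real.exp (κ₀ * P.absG B g) * ‖F g‖) := by gcongr
      _ = _ := by ring
  induction hF generalizing κ with
  | base h hh => exact hf.integrable κ hκ h hh
  | rep i j F _ ih =>
    exact hmul (fun g => P.realRep g i j) F (P.continuous_realRep i j) (fun g => (hgrow g i j).1) ih κ hκ
  | repInv i j F _ ih =>
    exact hmul (fun g => P.realRep (g⁻¹ : P.G) i j) F ((P.continuous_realRep i j).comp continuous_inv)
      (fun g => (hgrow g i j).2) ih κ hκ
  | add F H _ _ ih₁ ih₂ =>
    simp only [mul_add]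
    exact (ih₁ κ hκ).add (ih₂ κ hκ)
  | smul c F _ ih =>
    have := (ih κ hκ).const_mul c
    simpa only [mul_left_comm] using this

theorem Amplitude.integrable [MeasurableSpace P.G] [BorelSpace P.G] {μ : Measure P.G}
    {B : LinearMap.BilinForm ℝ (Matrix (Fin N) (Fin N) ℝ)} (hB_symm : ∀ X Y, B X Y = B Y X)
    (hB_pos : ∀ X, X ≠ 0 → 0 < B X X) (hf : P.RapidlyDecreasing B μ f) {F : P.G → ℂ}
    (hF : P.Amplitude f F) : Integrable F μ := by
  simpa using hF.integrable_exp_mul hB_symm hB_pos hf 0 le_rfl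

end PrehomogeneousSpace

/-! ### Fourier transforms with finitely many frequencies -/

/-- The integral `∫ F(x) exp(i ∑ r_ι(x) y_ι) dμ(x)`, as a function of `y`. -/
noncomputable def expTransform {X ι : Type*} [Fintype ι] [MeasurableSpace X] (μ : Measure X)
    (r : ι → X → ℝ) (F : X → ℂ) (y : ι → ℝ) : ℂ :=
  ∫ x, F x * Complex.exp (Complex.I * (∑ i, r i x * y i : ℝ)) ∂μ

section expTransform

variable {X ι : Type*} [Fintype ι] [MeasurableSpace X] {μ : Measure X} {r : ι → X → ℝ} {F : X → ℂ}

theorem norm_exp_I_mul_ofReal (s : ℝ) : ‖Complex.exp (Complex.I * (s : ℂ))‖ = 1 := by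
  rw [mul_comm, Complex.norm_exp_ofReal_mul_I]

theorem aestronglyMeasurable_expTransform_integrand (hr : ∀ i, AEStronglyMeasurable (r i) μ)
    (hF : Integrable F μ) (y : ι → ℝ) : AEStronglyMeasurable
      (fun x => F x * Complex.exp (Complex.I * (∑ i, r i x * y i : ℝ))) μ := by
  refine hF.aestronglyMeasurable.mul ?_
  have h : AEStronglyMeasurable (fun x => ∑ i, r i x * y i) μ :=
    Finset.aestronglyMeasurable_fun_sum _ fun i _ => (hr i).mul_const _
  exact (by fun_prop : Continuous fun s : ℝ =>
    Complex.exp (Complex.I * (s : ℂ))).comp_aestronglyMeasurable h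

theorem integrable_expTransform_integrand (hr : ∀ i, AEStronglyMeasurable (r i) μ)
    (hF : Integrable F μ) (y : ι → ℝ) :
    Integrable (fun x => F x * Complex.exp (Complex.I * (∑ i, r i x * y i : ℝ))) μ :=
  hF.mono (aestronglyMeasurable_expTransform_integrand hr hF y)
    (Filter.Eventually.of_forall fun x => by rw [norm_mul, norm_exp_I_mul_ofReal, mul_one])

theorem hasFDerivAt_expTransform (hr : ∀ i, AEStronglyMeasurable (r i) μ)
    (hF : Integrable F μ) (hrF : ∀ i, Integrable (fun x => r i x * F x) μ) (y : ι → ℝ) :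
    HasFDerivAt (expTransform μ r F)
      (∑ i, (Complex.I * expTransform μ r (fun x => r i x * F x) y) •
        Complex.ofRealCLM.comp (ContinuousLinearMap.proj (R := ℝ) (φ := fun _ : ι => ℝ) i)) y := by
  let D : ι → (ι → ℝ) →L[ℝ] ℂ := fun i =>
    Complex.ofRealCLM.comp (ContinuousLinearMap.proj (R := ℝ) (φ := fun _ : ι => ℝ) i)
  let e : (ι → ℝ) → X → ℂ := fun y x => Complex.exp (Complex.I * (∑ i, r i x * y i : ℝ))
  have hint : ∀ i, Integrable (fun x => (r i x * F x) * e y x) μ := fun i =>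
    integrable_expTransform_integrand hr (hrF i) y
  have hD : ∀ i, ‖D i‖ ≤ 1 := fun i => ContinuousLinearMap.opNorm_le_bound _ zero_le_one fun v => by
    simpa [D] using norm_le_pi_norm v i
  have key := hasFDerivAt_integral_of_dominated_of_fderiv_le (μ := μ) (x₀ := y) (s := Set.univ)
    (F := fun y x => F x * e y x)
    (F' := fun y x => ∑ i, (Complex.I * ((r i x * F x) * e y x)) • D i)
    (bound := fun x => ∑ i, ‖(r i x : ℂ) * F x‖) Filter.univ_mem
    (Filter.Eventually.of_forall fun z => aestronglyMeasurable_expTransform_integrand hr hF z)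
    (integrable_expTransform_integrand hr hF y)
    (Finset.aestronglyMeasurable_fun_sum _ fun i _ =>
      ((hint i).aestronglyMeasurable.const_mul _).smul_const _)
    (Filter.Eventually.of_forall fun x z _ => (norm_sum_le _ _).trans
      (Finset.sum_le_sum fun i _ => by
        rw [norm_smul, norm_mul, norm_mul, norm_exp_I_mul_ofReal, Complex.norm_I, one_mul, mul_one]
        exact mul_le_of_le_one_right (norm_nonneg _) (hD i)))
    (integrable_finsetSum _ fun i _ => (hrF i).norm)
    (Filter.Eventually.of_forall fun x z _ => by
      have h1 : HasFDerivAt (fun z : ι → ℝ => Complex.I * ((∑ i, r i x * z i : ℝ) : ℂ))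
          (∑ i, (Complex.I * r i x) • D i) z := by
        have h0 : (fun z : ι → ℝ => Complex.I * ((∑ i, r i x * z i : ℝ) : ℂ))
            = ⇑(∑ i, (Complex.I * r i x) • D i) := by
          ext z
          simp [D, Finset.mul_sum, mul_assoc]
        rw [h0]
        exact ContinuousLinearMap.hasFDerivAt _
      have h2 := h1.cexp.const_mul (F x)
      convert! h2 using 1
      simp only [Finset.smul_sum, smul_smul]
      refine Finset.sum_congr rfl fun i _ => ?_
      congr 1
      simp only [e]
      ring)
  refine key.congr_fderiv ?_
  rw [integral_finsetSum _ fun i _ => ((hint i).const_mul _).smul_const _]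
  refine Finset.sum_congr rfl fun i _ => ?_
  rw [integral_smul_const, integral_const_mul]
  rfl

/-- If a class of integrable functions is stable under the multiplication by the frequencies, then
its transforms are smooth. -/
theorem contDiff_expTransform (hr : ∀ i, AEStronglyMeasurable (r i) μ) {p : (X → ℂ) → Prop}
    (hp : ∀ F, p F → Integrable F μ) (hpr : ∀ i F, p F → p fun x => r i x * F x)
    (hF : p F) : ContDiff ℝ ∞ (expTransform μ r F) := by
  rw [contDiff_infty]
  intro k
  induction k generalizing F with
  | zero =>
    refine contDiff_zero.2 (continuous_iff_continuousAt.2 fun y => ?_)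
    exact (hasFDerivAt_expTransform hr (hp _ hF) (fun i => hp _ (hpr i _ hF)) y).continuousAt
  | succ k ih =>
    refine (contDiff_succ_iff_hasFDerivAt (n := k)).2 ⟨_, ?_, fun y =>
      hasFDerivAt_expTransform hr (hp _ hF) (fun i => hp _ (hpr i _ hF)) y⟩
    refine ContDiff.sum fun i _ => ?_
    exact (contDiff_const.mul (ih (hpr i _ hF))).smul contDiff_const

end expTransform

/-! ### The Fourier transform of an amplitude -/

namespace PrehomogeneousSpace

variable {N n : ℕ} {P : PrehomogeneousSpace N n} {f : P.G → ℂ}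

/-- The monomials `m_k ξ_l`, indexed by `(l, k)`. The phase `(g⁻¹ m) · ξ` is a linear function of
them, with the coefficients `ρ(g⁻¹)_{lk}`. -/
def phaseCoords (m ξ : VR n) : Fin n × Fin n → ℝ := fun lk => m lk.2 * ξ lk.1

variable (P) in
theorem inner_act_inv (g : P.G) (m ξ : VR n) : inner ℝ (P.act g⁻¹ m) ξ
    = ∑ lk : Fin n × Fin n, P.realRep (g⁻¹ : P.G) lk.1 lk.2 * phaseCoords m ξ lk := by
  simp only [PiLp.inner_apply, act, Matrix.mulVec, dotProduct, Fintype.sum_prod_type, phaseCoords,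
    RCLike.inner_apply, conj_trivial, Finset.mul_sum]
  refine Finset.sum_congr rfl fun l _ => Finset.sum_congr rfl fun k _ => ?_
  ring

variable (P) in
theorem hasLieDeriv_cexp (X : P.lieAlg) (m ξ : VR n) : P.HasLieDeriv X
    (fun g => Complex.exp (Complex.I * (inner ℝ (P.act g⁻¹ m) ξ : ℝ)))
    (fun g => (∑ a, ∑ b, Complex.I * ξ a * (P.drho (X : Matrix (Fin N) (Fin N) ℝ)).mulVec m.ofLp b
      * P.realRep (g⁻¹ : P.G) a b) * Complex.exp (Complex.I * (inner ℝ (P.act g⁻¹ m) ξ : ℝ))) := by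
  intro g
  have h1 : P.HasLieDeriv X (fun g => Complex.I * (inner ℝ (P.act g⁻¹ m) ξ : ℝ))
      (fun g => ∑ a, ∑ b, Complex.I * ξ a *
        (P.drho (X : Matrix (Fin N) (Fin N) ℝ)).mulVec m.ofLp b * P.realRep (g⁻¹ : P.G) a b) := by
    have h2 := HasLieDeriv.sum (s := Finset.univ) fun (a : Fin n) _ =>
      HasLieDeriv.sum (s := Finset.univ) fun (b : Fin n) _ =>
        (P.hasLieDeriv_realRep_inv X a b).const_mul (Complex.I * ξ a * m b)
    convert! h2 using 1
    · ext g
      simp only [inner_act_inv, Fintype.sum_prod_type, phaseCoords, Complex.ofReal_sum,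
        Finset.mul_sum, Complex.ofReal_mul]
      refine Finset.sum_congr rfl fun l _ => Finset.sum_congr rfl fun k _ => ?_
      ring
    · ext g
      refine Finset.sum_congr rfl fun a _ => ?_
      simp only [Matrix.mulVec, dotProduct, Complex.ofReal_sum, Complex.ofReal_mul, Finset.mul_sum,
        Finset.sum_mul]
      rw [Finset.sum_comm]
      refine Finset.sum_congr rfl fun l _ => Finset.sum_congr rfl fun k _ => ?_
      ring
  have h := (h1 g).cexp
  simpa only [neg_zero, oneParam_zero, one_mul, mul_comm] using! h

variable [MeasurableSpace P.G] {μ : Measure P.G}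

variable (P μ) in
theorem fHat_eq_expTransform (F : P.G → ℂ) (m ξ : VR n) : P.fHat μ F m ξ = expTransform μ
    (fun lk g => P.realRep (g⁻¹ : P.G) lk.1 lk.2) F (phaseCoords m ξ) := by
  simp only [fHat, expTransform, inner_act_inv]

theorem norm_fHat_le (F : P.G → ℂ) (m ξ : VR n) : ‖P.fHat μ F m ξ‖ ≤ ∫ g, ‖F g‖ ∂μ := by
  refine (norm_integral_le_integral_norm _).trans_eq ?_
  simp only [norm_mul, norm_exp_I_mul_ofReal, mul_one]

theorem fHat_const_mul (c : ℂ) (F : P.G → ℂ) (m ξ : VR n) :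
    P.fHat μ (fun g => c * F g) m ξ = c * P.fHat μ F m ξ := by
  simp only [fHat, mul_assoc, integral_const_mul]

variable [BorelSpace P.G]

theorem aestronglyMeasurable_realRep_inv (μ : Measure P.G) (lk : Fin n × Fin n) :
    AEStronglyMeasurable (fun g : P.G => P.realRep (g⁻¹ : P.G) lk.1 lk.2) μ := by
  have _ := P.secondCountableTopology_G
  exact ((P.continuous_realRep lk.1 lk.2).comp continuous_inv).aestronglyMeasurable

theorem integrable_mul_cexp {F : P.G → ℂ} (hF : Integrable F μ) (m ξ : VR n) :
    Integrable (fun g => F g * Complex.exp (Complex.I * (inner ℝ (P.act g⁻¹ m) ξ : ℝ))) μ := by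
  simp only [inner_act_inv]
  exact integrable_expTransform_integrand
    (r := fun (lk : Fin n × Fin n) (g : P.G) => P.realRep (g⁻¹ : P.G) lk.1 lk.2)
    (aestronglyMeasurable_realRep_inv μ) hF (phaseCoords m ξ)

theorem fHat_sum {ι : Type*} (s : Finset ι) {F : ι → P.G → ℂ} (hF : ∀ i ∈ s, Integrable (F i) μ)
    (m ξ : VR n) : P.fHat μ (fun g => ∑ i ∈ s, F i g) m ξ = ∑ i ∈ s, P.fHat μ (F i) m ξ := by
  simp only [fHat, Finset.sum_mul]
  exact integral_finsetSum _ fun i hi => integrable_mul_cexp (hF i hi) m ξ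

theorem contDiff_fHat (hint : ∀ F, P.Amplitude f F → Integrable F μ) {F : P.G → ℂ}
    (hF : P.Amplitude f F) : ContDiff ℝ ∞ fun p : VR n × VR n => P.fHat μ F p.1 p.2 := by
  have h := contDiff_expTransform (r := fun (lk : Fin n × Fin n) (g : P.G) =>
    P.realRep (g⁻¹ : P.G) lk.1 lk.2) (aestronglyMeasurable_realRep_inv μ) hint
    (fun lk F hF => .repInv lk.1 lk.2 F hF) hF
  have hq : ContDiff ℝ ∞ fun p : VR n × VR n => phaseCoords p.1 p.2 := by
    refine contDiff_pi.2 fun lk => ?_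
    unfold phaseCoords
    fun_prop
  simpa only [fHat_eq_expTransform] using! h.comp hq

/-- The derivative of `fHat` along a curve of the parameters. -/
theorem hasDerivAt_fHat (hint : ∀ F, P.Amplitude f F → Integrable F μ) {F : P.G → ℂ}
    (hF : P.Amplitude f F) {c d : ℝ → VR n} {t : ℝ} {w : Fin n × Fin n → ℝ}
    (hw : ∀ lk, HasDerivAt (fun s => phaseCoords (c s) (d s) lk) (w lk) t) :
    HasDerivAt (fun s => P.fHat μ F (c s) (d s)) (∑ lk : Fin n × Fin n, Complex.I *
      P.fHat μ (fun g => P.realRep (g⁻¹ : P.G) lk.1 lk.2 * F g) (c t) (d t) * w lk) t := by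
  have h := (hasFDerivAt_expTransform (r := fun (lk : Fin n × Fin n) (g : P.G) =>
    P.realRep (g⁻¹ : P.G) lk.1 lk.2) (aestronglyMeasurable_realRep_inv μ) (hint _ hF)
    (fun lk => hint _ (.repInv lk.1 lk.2 F hF)) (phaseCoords (c t) (d t))).comp_hasDerivAt t
    (hasDerivAt_pi.2 hw)
  simp only [fHat_eq_expTransform]
  convert! h using 1
  simp

/-! ### Integration by parts along the group -/

/-- Integration by parts along `X`: multiplying an amplitude by the derivative
`i (ρ(g⁻¹) dρ(X) m) · ξ` of the phase gives the transform of another amplitude. -/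
theorem sum_fHat_repInv_eq [μ.IsHaarMeasure] (hf : P.IsSmooth f)
    (hint : ∀ F, P.Amplitude f F → Integrable F μ)
    {F : P.G → ℂ} (hF : P.Amplitude f F) (X : P.lieAlg) : ∃ F', P.Amplitude f F' ∧ ∀ m ξ : VR n,
      ∑ a, ∑ b, Complex.I * ξ a * (P.drho (X : Matrix (Fin N) (Fin N) ℝ)).mulVec m.ofLp b
        * P.fHat μ (fun g => P.realRep (g⁻¹ : P.G) a b * F g) m ξ = P.fHat μ F' m ξ := by
  obtain ⟨F', hF', hd⟩ := hF.exists_hasLieDeriv hf X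
  refine ⟨_, .smul (-1) F' hF', fun m ξ => ?_⟩
  have hAmp : P.Amplitude f fun g => ∑ a, ∑ b, Complex.I * ξ a *
      (P.drho (X : Matrix (Fin N) (Fin N) ℝ)).mulVec m.ofLp b
        * (P.realRep (g⁻¹ : P.G) a b * F g) :=
    Amplitude.sum _ fun a _ => Amplitude.sum _ fun b _ => .smul _ _ (.repInv a b F hF)
  have hcexp : Continuous fun g : P.G =>
      Complex.exp (Complex.I * (inner ℝ (P.act g⁻¹ m) ξ : ℝ)) := by
    simp only [inner_act_inv]
    have h : Continuous fun g : P.G =>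
        ∑ lk : Fin n × Fin n, P.realRep (g⁻¹ : P.G) lk.1 lk.2 * phaseCoords m ξ lk :=
      continuous_finsetSum _ fun lk _ =>
        ((P.continuous_realRep lk.1 lk.2).comp continuous_inv).mul continuous_const
    fun_prop
  have hd' := hd.mul (P.hasLieDeriv_cexp X m ξ)
  have heq : (fun g => F' g * Complex.exp (Complex.I * (inner ℝ (P.act g⁻¹ m) ξ : ℝ)) +
      F g * ((∑ a, ∑ b, Complex.I * ξ a * (P.drho (X : Matrix (Fin N) (Fin N) ℝ)).mulVec m.ofLp b
      * P.realRep (g⁻¹ : P.G) a b) * Complex.exp (Complex.I * (inner ℝ (P.act g⁻¹ m) ξ : ℝ))))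
      = fun g => F' g * Complex.exp (Complex.I * (inner ℝ (P.act g⁻¹ m) ξ : ℝ)) +
      (∑ a, ∑ b, Complex.I * ξ a * (P.drho (X : Matrix (Fin N) (Fin N) ℝ)).mulVec m.ofLp b
        * (P.realRep (g⁻¹ : P.G) a b * F g)) *
        Complex.exp (Complex.I * (inner ℝ (P.act g⁻¹ m) ξ : ℝ)) := by
    ext g
    simp only [← mul_assoc _ _ (F g), ← Finset.sum_mul]
    ring
  rw [heq] at hd'
  have h1 := P.integral_hasLieDeriv_eq_zero μ hd'
    (((hF'.continuous hf).mul hcexp).add ((hAmp.continuous hf).mul hcexp))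
    (integrable_mul_cexp (hint _ hF) m ξ)
    ((integrable_mul_cexp (hint _ hF') m ξ).add (integrable_mul_cexp (hint _ hAmp) m ξ))
  rw [integral_add (integrable_mul_cexp (hint _ hF') m ξ)
    (integrable_mul_cexp (hint _ hAmp) m ξ)] at h1
  change P.fHat μ F' m ξ + P.fHat μ _ m ξ = 0 at h1
  rw [fHat_sum _ fun a _ => hint _ (Amplitude.sum _ fun b _ => .smul _ _ (.repInv a b F hF))] at h1
  rw [fHat_const_mul, neg_one_mul, ← sub_eq_zero, sub_neg_eq_add, add_comm, ← h1]
  congr 1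
  refine Finset.sum_congr rfl fun a _ => ?_
  rw [fHat_sum _ fun b _ => hint _ (.smul _ _ (.repInv a b F hF))]
  refine Finset.sum_congr rfl fun b _ => ?_
  rw [fHat_const_mul]

/-- Near a regular point, the product of a transform with `ξ_l` is a combination of transforms, with
coefficients that are continuous in `m`. With `M(m)` the matrix of the columns `dρ(X_k) m`, for a
frame `X_k`, integration by parts along `X_k` turns into `i ξ_l` after contraction with `M(m)⁻¹`
and with `ρ(g)`. -/
theorem exists_mul_fHat_eq [μ.IsHaarMeasure] (hf : P.IsSmooth f)
    (hint : ∀ F, P.Amplitude f F → Integrable F μ) {F : P.G → ℂ} (hF : P.Amplitude f F)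
    {m₀ : VR n} (hm₀ : m₀ ∈ P.regularSet) (l : Fin n) :
    ∃ (H : Fin n → Fin n → P.G → ℂ) (A : Fin n → Fin n → VR n → ℝ),
      (∀ k c, P.Amplitude f (H k c)) ∧ (∀ k c, ContinuousAt (A k c) m₀) ∧
      ∀ᶠ m in 𝓝 m₀, ∀ ξ : VR n, Complex.I * ξ l * P.fHat μ F m ξ
        = ∑ k, ∑ c, A k c m * P.fHat μ (H k c) m ξ := by
  obtain ⟨X, hX⟩ := P.exists_frame hm₀
  choose H hH hHeq using fun k c => sum_fHat_repInv_eq hf hint (Amplitude.rep c l F hF) (X k)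
  let M : VR n → Matrix (Fin n) (Fin n) ℝ := fun m =>
    Matrix.of fun i k => (P.drho (X k : Matrix (Fin N) (Fin N) ℝ)).mulVec m.ofLp i
  have hM : Continuous M := by
    refine continuous_matrix fun i k => ?_
    change Continuous fun m : VR n => (P.drho (X k : Matrix (Fin N) (Fin N) ℝ)).mulVec m.ofLp i
    simp only [Matrix.mulVec, dotProduct]
    fun_prop
  refine ⟨H, fun k c m => (M m)⁻¹ k c, hH, fun k c => ?_, ?_⟩
  · have hd : ContinuousAt (fun m => (M m).det) m₀ := hM.matrix_det.continuousAt
    have ha : ContinuousAt (fun m => (M m).adjugate k c) m₀ :=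
      (hM.matrix_adjugate.matrix_elem k c).continuousAt
    have := (hd.inv₀ hX.self_of_nhds).mul ha
    simpa only [Matrix.inv_def, Matrix.smul_apply, Ring.inverse_eq_inv', smul_eq_mul] using! this
  · filter_upwards [hX] with m hm ξ
    have hunit : IsUnit (M m).det := isUnit_iff_ne_zero.2 hm
    have hmi : ∀ b c, ∑ k, ((M m) b k : ℂ) * ((M m)⁻¹ k c : ℝ) = if b = c then 1 else 0 := by
      intro b c
      have := congrFun (congrFun (Matrix.mul_nonsing_inv (M m) hunit) b) c
      rw [Matrix.mul_apply, Matrix.one_apply] at this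
      rw [← Complex.ofReal_one, ← Complex.ofReal_zero, ← apply_ite Complex.ofReal, ← this]
      simp
    have hrep : ∀ (g : P.G) a, ∑ c, (P.realRep (g⁻¹ : P.G) a c : ℂ) * P.realRep g c l
        = if a = l then 1 else 0 := by
      intro g a
      have : P.realRep (g⁻¹ : P.G) * P.realRep g = 1 := by
        rw [← realRep_mul, ← Subgroup.coe_mul, inv_mul_cancel]
        exact P.realRep_one
      have := congrFun (congrFun this a) l
      rw [Matrix.mul_apply, Matrix.one_apply] at this
      rw [← Complex.ofReal_one, ← Complex.ofReal_zero, ← apply_ite Complex.ofReal, ← this]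
      simp
    let Z : Fin n → Fin n → Fin n → ℂ := fun a b c =>
      P.fHat μ (fun g => P.realRep (g⁻¹ : P.G) a b * (P.realRep g c l * F g)) m ξ
    have hZ : ∀ a, ∑ c, Z a c c = if a = l then P.fHat μ F m ξ else 0 := by
      intro a
      rw [← fHat_sum _ fun c _ => hint _ (.repInv a c _ (.rep c l F hF))]
      simp only [← mul_assoc, ← Finset.sum_mul, hrep]
      rw [fHat_const_mul]
      split_ifs <;> simp
    have hk : ∀ k c, P.fHat μ (H k c) m ξ = ∑ a, ∑ b, Complex.I * ξ a * M m b k * Z a b c :=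
      fun k c => (hHeq k c m ξ).symm
    have perm : ∀ T : Fin n → Fin n → Fin n → Fin n → ℂ,
        ∑ a, ∑ c, ∑ b, ∑ k, T a c b k = ∑ k, ∑ c, ∑ a, ∑ b, T a c b k := fun T => by
      calc ∑ a, ∑ c, ∑ b, ∑ k, T a c b k = ∑ a, ∑ c, ∑ k, ∑ b, T a c b k :=
            Finset.sum_congr rfl fun a _ => Finset.sum_congr rfl fun c _ => Finset.sum_comm
        _ = ∑ a, ∑ k, ∑ c, ∑ b, T a c b k := Finset.sum_congr rfl fun a _ => Finset.sum_comm
        _ = ∑ k, ∑ a, ∑ c, ∑ b, T a c b k := Finset.sum_comm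
        _ = ∑ k, ∑ c, ∑ a, ∑ b, T a c b k := Finset.sum_congr rfl fun k _ => Finset.sum_comm
    calc Complex.I * ξ l * P.fHat μ F m ξ
        = ∑ a, Complex.I * ξ a * ∑ c, Z a c c := by simp [hZ]
      _ = ∑ a, ∑ c, ∑ b, Complex.I * ξ a * (∑ k, (M m b k : ℂ) * ((M m)⁻¹ k c : ℝ)) * Z a b c := by
        simp [hmi, Finset.mul_sum]
      _ = ∑ k, ∑ c, ∑ a, ∑ b,
          ((M m)⁻¹ k c : ℝ) * (Complex.I * ξ a * M m b k * Z a b c) := by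
        simp only [Finset.mul_sum, Finset.sum_mul]
        rw [perm]
        refine Finset.sum_congr rfl fun k _ => Finset.sum_congr rfl fun c _ =>
          Finset.sum_congr rfl fun a _ => Finset.sum_congr rfl fun b _ => ?_
        ring
      _ = _ := by
        simp only [hk, Finset.mul_sum]

/-- Transforms decrease rapidly in `ξ`, locally uniformly on the regular set. -/
theorem eventually_pow_mul_norm_fHat_le [μ.IsHaarMeasure] (hf : P.IsSmooth f)
    (hint : ∀ F, P.Amplitude f F → Integrable F μ) {F : P.G → ℂ} (hF : P.Amplitude f F)
    {m₀ : VR n} (hm₀ : m₀ ∈ P.regularSet) (k : ℕ) :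
    ∃ C, ∀ᶠ m in 𝓝 m₀, ∀ ξ : VR n, ‖ξ‖ ^ k * ‖P.fHat μ F m ξ‖ ≤ C := by
  induction k generalizing F with
  | zero => exact ⟨∫ g, ‖F g‖ ∂μ, Filter.Eventually.of_forall fun m ξ => by
      simpa using norm_fHat_le F m ξ⟩
  | succ k ih =>
    choose H A hH hA hHA using fun l => exists_mul_fHat_eq (μ := μ) hf hint hF hm₀ l
    choose C hC using fun l a b => ih (hH l a b)
    refine ⟨∑ l, ∑ a, ∑ b, (|A l a b m₀| + 1) * C l a b, ?_⟩
    have hA' : ∀ᶠ m in 𝓝 m₀, ∀ l a b, |A l a b m| ≤ |A l a b m₀| + 1 := by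
      simp only [Filter.eventually_all]
      intro l a b
      exact ((hA l a b).abs.eventually (gt_mem_nhds (lt_add_one _))).mono fun m hm => hm.le
    have hC' : ∀ᶠ m in 𝓝 m₀, ∀ l a b, ∀ ξ : VR n, ‖ξ‖ ^ k * ‖P.fHat μ (H l a b) m ξ‖ ≤ C l a b := by
      simp only [Filter.eventually_all (ι := Fin n)]
      exact hC
    filter_upwards [hA', hC', Filter.eventually_all.2 hHA] with m hAm hCm hm ξ
    have hξ : ‖ξ‖ ≤ ∑ l, |ξ l| := by
      have := EuclideanSpace.norm_eq ξ
      have h2 : ξ = ∑ l, ξ l • EuclideanSpace.single l (1 : ℝ) := by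
        ext i
        simp [Finset.sum_apply, Pi.single_apply]
      calc ‖ξ‖ = ‖∑ l, ξ l • EuclideanSpace.single l (1 : ℝ)‖ := by rw [← h2]
        _ ≤ ∑ l, ‖ξ l • EuclideanSpace.single l (1 : ℝ)‖ := norm_sum_le _ _
        _ = _ := by simp [norm_smul]
    calc ‖ξ‖ ^ (k + 1) * ‖P.fHat μ F m ξ‖
        = ‖ξ‖ * (‖ξ‖ ^ k * ‖P.fHat μ F m ξ‖) := by ring
      _ ≤ (∑ l, |ξ l|) * (‖ξ‖ ^ k * ‖P.fHat μ F m ξ‖) := by gcongr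
      _ = ∑ l, ‖ξ‖ ^ k * ‖Complex.I * ξ l * P.fHat μ F m ξ‖ := by
        rw [Finset.sum_mul]
        refine Finset.sum_congr rfl fun l _ => ?_
        rw [norm_mul, norm_mul, Complex.norm_I, Complex.norm_real, Real.norm_eq_abs]
        ring
      _ ≤ ∑ l, ∑ a, ∑ b, (|A l a b m₀| + 1) * C l a b := by
        refine Finset.sum_le_sum fun l _ => ?_
        rw [hm l ξ]
        calc ‖ξ‖ ^ k * ‖∑ a, ∑ b, (A l a b m : ℂ) * P.fHat μ (H l a b) m ξ‖
            ≤ ‖ξ‖ ^ k * ∑ a, ∑ b, ‖(A l a b m : ℂ) * P.fHat μ (H l a b) m ξ‖ := by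
              gcongr
              exact (norm_sum_le _ _).trans (Finset.sum_le_sum fun a _ => norm_sum_le _ _)
          _ = ∑ a, ∑ b, |A l a b m| * (‖ξ‖ ^ k * ‖P.fHat μ (H l a b) m ξ‖) := by
              simp only [Finset.mul_sum]
              refine Finset.sum_congr rfl fun a _ => Finset.sum_congr rfl fun b _ => ?_
              rw [norm_mul, Complex.norm_real, Real.norm_eq_abs]
              ring
          _ ≤ _ := by
              refine Finset.sum_le_sum fun a _ => Finset.sum_le_sum fun b _ => ?_
              exact mul_le_mul (hAm l a b) (hCm l a b ξ) (by positivity) (by positivity)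

end PrehomogeneousSpace

namespace PrehomogeneousSpace

variable {N n : ℕ} {P : PrehomogeneousSpace N n} {f : P.G → ℂ} [MeasurableSpace P.G]
  {μ : Measure P.G}

/-! ### The module of transforms -/

variable (P μ f) in
/-- The module generated by the transforms `fHat μ F`, for the amplitudes `F`, over the polynomials
in `(m, ξ)`. It is stable under all partial derivatives. -/
inductive Transform : (VR n → VR n → ℂ) → Prop
  | hat (F : P.G → ℂ) : P.Amplitude f F → Transform fun m ξ => P.fHat μ F m ξ
  | mulX (k : Fin n) (h : VR n → VR n → ℂ) : Transform h → Transform fun m ξ => m k * h m ξ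
  | mulXi (k : Fin n) (h : VR n → VR n → ℂ) : Transform h → Transform fun m ξ => ξ k * h m ξ
  | add (h₁ h₂ : VR n → VR n → ℂ) : Transform h₁ → Transform h₂ →
      Transform fun m ξ => h₁ m ξ + h₂ m ξ
  | smul (c : ℂ) (h : VR n → VR n → ℂ) : Transform h → Transform fun m ξ => c * h m ξ

theorem Transform.sum {ι : Type*} (s : Finset ι) {h : ι → VR n → VR n → ℂ}
    (hh : ∀ i ∈ s, P.Transform f μ (h i)) : P.Transform f μ fun m ξ => ∑ i ∈ s, h i m ξ := by
  classical
  induction s using Finset.induction_on with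
  | empty =>
    have := Transform.smul 0 _ (Transform.hat (μ := μ) f (Amplitude.base f LeftDerivative.self))
    simpa using this
  | insert a s ha ih =>
    simp only [Finset.sum_insert ha]
    exact Transform.add _ _ (hh a (Finset.mem_insert_self _ _))
      (ih fun i hi => hh i (Finset.mem_insert_of_mem hi))

theorem contDiff_coord {E : Type*} [NormedAddCommGroup E] [NormedSpace ℝ E] {c : E → VR n}
    (hc : ContDiff ℝ ∞ c) (k : Fin n) : ContDiff ℝ ∞ fun p => ((c p k : ℝ) : ℂ) :=
  Complex.ofRealCLM.contDiff.comp ((EuclideanSpace.proj (𝕜 := ℝ) k).contDiff.comp hc)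

variable [BorelSpace P.G]

theorem Transform.contDiff (hint : ∀ F, P.Amplitude f F → Integrable F μ) {h : VR n → VR n → ℂ}
    (hh : P.Transform f μ h) : ContDiff ℝ ∞ fun p : VR n × VR n => h p.1 p.2 := by
  induction hh with
  | hat F hF => exact contDiff_fHat hint hF
  | mulX k h _ ih => exact (contDiff_coord contDiff_fst k).mul ih
  | mulXi k h _ ih => exact (contDiff_coord contDiff_snd k).mul ih
  | add h₁ h₂ _ _ ih₁ ih₂ => exact ih₁.add ih₂
  | smul c h _ ih => exact contDiff_const.mul ih

theorem hasDerivAt_coord_add_smul (m : VR n) (j k : Fin n) :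
    HasDerivAt (fun t : ℝ => (m + t • EuclideanSpace.single j (1 : ℝ)) k)
      (if k = j then 1 else 0) 0 := by
  have := ((hasDerivAt_id (0 : ℝ)).mul_const ((EuclideanSpace.single j (1 : ℝ)) k)).const_add (m k)
  simpa [Pi.single_apply] using! this

theorem Transform.exists_hasLineDerivAt_fst (hint : ∀ F, P.Amplitude f F → Integrable F μ)
    {h : VR n → VR n → ℂ} (hh : P.Transform f μ h) (j : Fin n) : ∃ h', P.Transform f μ h' ∧
      ∀ m ξ, HasLineDerivAt ℝ (fun x => h x ξ) (h' m ξ) m (EuclideanSpace.single j 1) := by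
  simp only [HasLineDerivAt]
  induction hh with
  | hat F hF =>
    refine ⟨fun m ξ => ∑ lk : Fin n × Fin n, (Complex.I * (if lk.2 = j then 1 else 0)) *
      (ξ lk.1 * P.fHat μ (fun g => P.realRep (g⁻¹ : P.G) lk.1 lk.2 * F g) m ξ), ?_, fun m ξ => ?_⟩
    · exact Transform.sum _ fun lk _ => .smul _ _ (.mulXi _ _ (.hat _ (.repInv _ _ _ hF)))
    · have := hasDerivAt_fHat hint hF (c := fun t : ℝ => m + t • EuclideanSpace.single j (1 : ℝ))
        (d := fun _ => ξ) (t := 0) fun lk => (hasDerivAt_coord_add_smul m j lk.2).mul_const (ξ lk.1)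
      refine this.congr_deriv (Finset.sum_congr rfl fun lk _ => ?_)
      simp only [zero_smul, add_zero, Complex.ofReal_mul]
      split_ifs
      · simp
        ring
      · simp
  | mulX k h hh ih =>
    obtain ⟨h', hh', hd⟩ := ih
    refine ⟨_, .add _ _ (.smul (if k = j then 1 else 0) h hh) (.mulX k h' hh'), fun m ξ => ?_⟩
    have := (hasDerivAt_coord_add_smul m j k).ofReal_comp.mul (hd m ξ)
    convert! this using 1
    simp only [zero_smul, add_zero]
    split_ifs <;> simp
  | mulXi k h hh ih =>
    obtain ⟨h', hh', hd⟩ := ih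
    exact ⟨_, .mulXi k h' hh', fun m ξ => (hd m ξ).const_mul _⟩
  | add h₁ h₂ _ _ ih₁ ih₂ =>
    obtain ⟨h₁', hh₁', hd₁⟩ := ih₁
    obtain ⟨h₂', hh₂', hd₂⟩ := ih₂
    exact ⟨_, .add _ _ hh₁' hh₂', fun m ξ => (hd₁ m ξ).add (hd₂ m ξ)⟩
  | smul c h _ ih =>
    obtain ⟨h', hh', hd⟩ := ih
    exact ⟨_, .smul c h' hh', fun m ξ => (hd m ξ).const_mul _⟩

theorem Transform.exists_hasLineDerivAt_snd (hint : ∀ F, P.Amplitude f F → Integrable F μ)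
    {h : VR n → VR n → ℂ} (hh : P.Transform f μ h) (j : Fin n) : ∃ h', P.Transform f μ h' ∧
      ∀ m ξ, HasLineDerivAt ℝ (fun η => h m η) (h' m ξ) ξ (EuclideanSpace.single j 1) := by
  simp only [HasLineDerivAt]
  induction hh with
  | hat F hF =>
    refine ⟨fun m ξ => ∑ lk : Fin n × Fin n, (Complex.I * (if lk.1 = j then 1 else 0)) *
      (m lk.2 * P.fHat μ (fun g => P.realRep (g⁻¹ : P.G) lk.1 lk.2 * F g) m ξ), ?_, fun m ξ => ?_⟩
    · exact Transform.sum _ fun lk _ => .smul _ _ (.mulX _ _ (.hat _ (.repInv _ _ _ hF)))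
    · have := hasDerivAt_fHat hint hF (d := fun t : ℝ => ξ + t • EuclideanSpace.single j (1 : ℝ))
        (c := fun _ => m) (t := 0) fun lk => (hasDerivAt_coord_add_smul ξ j lk.1).const_mul (m lk.2)
      refine this.congr_deriv (Finset.sum_congr rfl fun lk _ => ?_)
      simp only [zero_smul, add_zero, Complex.ofReal_mul]
      split_ifs
      · simp
        ring
      · simp
  | mulX k h hh ih =>
    obtain ⟨h', hh', hd⟩ := ih
    exact ⟨_, .mulX k h' hh', fun m ξ => (hd m ξ).const_mul _⟩
  | mulXi k h hh ih =>
    obtain ⟨h', hh', hd⟩ := ih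
    refine ⟨_, .add _ _ (.smul (if k = j then 1 else 0) h hh) (.mulXi k h' hh'), fun m ξ => ?_⟩
    have := (hasDerivAt_coord_add_smul ξ j k).ofReal_comp.mul (hd m ξ)
    convert! this using 1
    simp only [zero_smul, add_zero]
    split_ifs <;> simp
  | add h₁ h₂ _ _ ih₁ ih₂ =>
    obtain ⟨h₁', hh₁', hd₁⟩ := ih₁
    obtain ⟨h₂', hh₂', hd₂⟩ := ih₂
    exact ⟨_, .add _ _ hh₁' hh₂', fun m ξ => (hd₁ m ξ).add (hd₂ m ξ)⟩
  | smul c h _ ih =>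
    obtain ⟨h', hh', hd⟩ := ih
    exact ⟨_, .smul c h' hh', fun m ξ => (hd m ξ).const_mul _⟩

theorem Transform.exists_pow_mul_norm_le [μ.IsHaarMeasure] (hf : P.IsSmooth f)
    (hint : ∀ F, P.Amplitude f F → Integrable F μ) {h : VR n → VR n → ℂ}
    (hh : P.Transform f μ h) {K : Set (VR n)} (hK : IsCompact K) (hKr : K ⊆ P.regularSet) (k : ℕ) :
    ∃ C, ∀ m ∈ K, ∀ ξ, ‖ξ‖ ^ k * ‖h m ξ‖ ≤ C := by
  induction hh generalizing k with
  | hat F hF =>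
    refine hK.induction_on (p := fun S => ∃ C, ∀ m ∈ S, ∀ ξ, ‖ξ‖ ^ k * ‖P.fHat μ F m ξ‖ ≤ C)
      ⟨0, by simp⟩ (fun s t hst ⟨C, hC⟩ => ⟨C, fun m hm => hC m (hst hm)⟩) ?_ fun m hm => ?_
    · rintro s t ⟨C, hC⟩ ⟨D, hD⟩
      refine ⟨max C D, fun m hm ξ => ?_⟩
      rcases hm with hm | hm
      · exact (hC m hm ξ).trans (le_max_left _ _)
      · exact (hD m hm ξ).trans (le_max_right _ _)
    · obtain ⟨C, hC⟩ := eventually_pow_mul_norm_fHat_le hf hint hF (hKr hm) k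
      exact ⟨_, mem_nhdsWithin_of_mem_nhds hC, C, fun m hm => hm⟩
  | mulX j h _ ih =>
    obtain ⟨C, hC⟩ := ih k
    obtain ⟨R, hR⟩ := hK.exists_bound_of_continuousOn
      (f := fun m : VR n => m j) (by fun_prop)
    refine ⟨R * C, fun m hm ξ => ?_⟩
    rw [norm_mul, Complex.norm_real, mul_left_comm]
    exact mul_le_mul (hR m hm) (hC m hm ξ) (by positivity) ((norm_nonneg _).trans (hR m hm))
  | mulXi j h _ ih =>
    obtain ⟨C, hC⟩ := ih (k + 1)
    refine ⟨C, fun m hm ξ => (le_trans ?_ (hC m hm ξ))⟩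
    rw [norm_mul, Complex.norm_real, ← mul_assoc, pow_succ]
    gcongr
    exact PiLp.norm_apply_le ξ j
  | add h₁ h₂ _ _ ih₁ ih₂ =>
    obtain ⟨C, hC⟩ := ih₁ k
    obtain ⟨D, hD⟩ := ih₂ k
    refine ⟨C + D, fun m hm ξ => ?_⟩
    calc ‖ξ‖ ^ k * ‖h₁ m ξ + h₂ m ξ‖ ≤ ‖ξ‖ ^ k * (‖h₁ m ξ‖ + ‖h₂ m ξ‖) := by
          gcongr
          exact norm_add_le _ _
      _ ≤ C + D := by
          rw [mul_add]
          exact add_le_add (hC m hm ξ) (hD m hm ξ)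
  | smul c h _ ih =>
    obtain ⟨C, hC⟩ := ih k
    refine ⟨‖c‖ * C, fun m hm ξ => ?_⟩
    rw [norm_mul, mul_left_comm]
    exact mul_le_mul_of_nonneg_left (hC m hm ξ) (norm_nonneg _)

/-- The functions of the module decrease rapidly in `ξ`, uniformly on the compact subsets of the
regular set. -/
theorem Transform.exists_norm_mul_one_add_pow_le [μ.IsHaarMeasure] (hf : P.IsSmooth f)
    (hint : ∀ F, P.Amplitude f F → Integrable F μ) {h : VR n → VR n → ℂ}
    (hh : P.Transform f μ h) {K : Set (VR n)} (hK : IsCompact K) (hKr : K ⊆ P.regularSet) (k : ℕ) :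
    ∃ C, 0 ≤ C ∧ ∀ m ∈ K, ∀ ξ, ‖h m ξ‖ * (1 + ‖ξ‖) ^ k ≤ C := by
  obtain ⟨C, hC⟩ := hh.exists_pow_mul_norm_le hf hint hK hKr 0
  obtain ⟨D, hD⟩ := hh.exists_pow_mul_norm_le hf hint hK hKr k
  refine ⟨max 0 (2 ^ (k - 1) * (C + D)), le_max_left _ _, fun m hm ξ =>
    le_trans ?_ (le_max_right _ _)⟩
  calc ‖h m ξ‖ * (1 + ‖ξ‖) ^ k
      ≤ ‖h m ξ‖ * (2 ^ (k - 1) * (1 ^ k + ‖ξ‖ ^ k)) := by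
        gcongr
        exact add_pow_le zero_le_one (norm_nonneg _) k
    _ = 2 ^ (k - 1) * (‖ξ‖ ^ 0 * ‖h m ξ‖ + ‖ξ‖ ^ k * ‖h m ξ‖) := by ring
    _ ≤ _ := by
        gcongr
        · exact hC m hm ξ
        · exact hD m hm ξ

/-! ### The symbol -/

theorem hasDerivAt_inner_add_smul (m ξ : VR n) (j : Fin n) : HasDerivAt
    (fun t : ℝ => inner ℝ (m + t • EuclideanSpace.single j (1 : ℝ)) ξ) (ξ j) 0 := by
  have := ((hasDerivAt_id (0 : ℝ)).mul_const (ξ j)).const_add (inner ℝ m ξ)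
  simpa [inner_add_left, inner_smul_left, EuclideanSpace.inner_single_left] using! this

theorem hasDerivAt_cexp_neg_inner (m ξ : VR n) (j : Fin n) : HasDerivAt
    (fun t : ℝ => Complex.exp
      (-(Complex.I * (inner ℝ (m + t • EuclideanSpace.single j (1 : ℝ)) ξ : ℝ))))
    (Complex.exp (-(Complex.I * (inner ℝ m ξ : ℝ))) * -(Complex.I * ξ j)) 0 := by
  have := ((hasDerivAt_inner_add_smul m ξ j).ofReal_comp.const_mul Complex.I).neg.cexp
  simpa using! this

variable (P μ f) in
/-- The functions `e^{-i m · ξ} h(m, ξ)`, for `h` in the module of transforms. -/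
def TwistedTransform (a : VR n → VR n → ℂ) : Prop :=
  ∃ h, P.Transform f μ h ∧
    a = fun m ξ => Complex.exp (-(Complex.I * (inner ℝ m ξ : ℝ))) * h m ξ

theorem TwistedTransform.dX (hint : ∀ F, P.Amplitude f F → Integrable F μ) {a : VR n → VR n → ℂ}
    (ha : P.TwistedTransform f μ a) (j : Fin n) : P.TwistedTransform f μ (dX j a) := by
  obtain ⟨h, hh, rfl⟩ := ha
  obtain ⟨h', hh', hd⟩ := hh.exists_hasLineDerivAt_fst hint j
  refine ⟨_, .add _ _ (.smul (-Complex.I) _ (.mulXi j h hh)) hh', ?_⟩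
  ext m ξ
  refine HasLineDerivAt.lineDeriv ?_
  refine ((hasDerivAt_cexp_neg_inner m ξ j).mul (hd m ξ)).congr_deriv ?_
  simp only [zero_smul, add_zero]
  ring

theorem TwistedTransform.dXi (hint : ∀ F, P.Amplitude f F → Integrable F μ) {a : VR n → VR n → ℂ}
    (ha : P.TwistedTransform f μ a) (j : Fin n) : P.TwistedTransform f μ (dXi j a) := by
  obtain ⟨h, hh, rfl⟩ := ha
  obtain ⟨h', hh', hd⟩ := hh.exists_hasLineDerivAt_snd hint j
  refine ⟨_, .add _ _ (.smul (-Complex.I) _ (.mulX j h hh)) hh', ?_⟩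
  ext m ξ
  refine HasLineDerivAt.lineDeriv ?_
  have h1 := (hasDerivAt_cexp_neg_inner ξ m j).mul (hd m ξ)
  simp only [real_inner_comm m] at h1
  refine h1.congr_deriv ?_
  simp only [zero_smul, add_zero]
  ring

/-- A class of functions that is stable under the first derivatives is stable under `mixedDeriv`. -/
theorem _root_.mixedDeriv_induction {p : (VR n → VR n → ℂ) → Prop} (hX : ∀ j a, p a → p (_root_.dX j a))
    (hXi : ∀ j a, p a → p (_root_.dXi j a)) (α β : Fin n → ℕ) {a : VR n → VR n → ℂ} (ha : p a) :
    p (mixedDeriv α β a) := by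
  have key : ∀ (D : Fin n → (VR n → VR n → ℂ) → (VR n → VR n → ℂ)), (∀ j a, p a → p (D j a)) →
      ∀ (γ : Fin n → ℕ) (l : List (Fin n)) a, p a → p (l.foldr (fun j b => (D j)^[γ j] b) a) := by
    intro D hD γ l a ha
    induction l with
    | nil => exact ha
    | cons j l ih =>
      rw [List.foldr_cons]
      generalize γ j = k
      induction k with
      | zero => exact ih
      | succ k ihk =>
        rw [Function.iterate_succ_apply']
        exact hD j _ ihk
  exact key _root_.dXi hXi α _ _ (key _root_.dX hX β _ _ ha)

theorem norm_cexp_neg_I_mul_ofReal (s : ℝ) : ‖Complex.exp (-(Complex.I * (s : ℂ)))‖ = 1 := by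
  rw [← mul_neg, ← Complex.ofReal_neg, norm_exp_I_mul_ofReal]

theorem TwistedTransform.isSymbol [μ.IsHaarMeasure] (hf : P.IsSmooth f)
    (hint : ∀ F, P.Amplitude f F → Integrable F μ) {a : VR n → VR n → ℂ}
    (ha : P.TwistedTransform f μ a) (l : ℝ) : IsSymbol l P.regularSet a := by
  constructor
  · obtain ⟨h, hh, rfl⟩ := ha
    refine ContDiff.contDiffOn (ContDiff.mul ?_ (hh.contDiff hint))
    exact (contDiff_const.mul (Complex.ofRealCLM.contDiff.comp
      (contDiff_fst.inner ℝ contDiff_snd))).neg.cexp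
  · intro α β K hK hKr
    obtain ⟨h, hh, hheq⟩ := mixedDeriv_induction (p := P.TwistedTransform f μ)
      (fun j a ha => ha.dX hint j) (fun j a ha => ha.dXi hint j) α β ha
    -- the decay of order `k` beats the required growth of order `l - |α|`
    obtain ⟨k, hk⟩ := exists_nat_ge (-(l - ((∑ j, α j : ℕ) : ℝ)))
    obtain ⟨C, hC0, hC⟩ := hh.exists_norm_mul_one_add_pow_le hf hint hK hKr k
    refine ⟨C, fun m hm ξ => ?_⟩
    rw [hheq, norm_mul, norm_cexp_neg_I_mul_ofReal, one_mul]
    have hs1 : 1 ≤ √(1 + ‖ξ‖ ^ 2) := by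
      rw [Real.one_le_sqrt]
      nlinarith [sq_nonneg ‖ξ‖]
    have hs2 : √(1 + ‖ξ‖ ^ 2) ≤ 1 + ‖ξ‖ := by
      rw [Real.sqrt_le_left (by positivity)]
      nlinarith [norm_nonneg ξ]
    have hs0 : 0 < √(1 + ‖ξ‖ ^ 2) := zero_lt_one.trans_le hs1
    calc ‖h m ξ‖ = ‖h m ξ‖ * √(1 + ‖ξ‖ ^ 2) ^ k * (√(1 + ‖ξ‖ ^ 2)) ^ (-(k : ℝ)) := by
          rw [Real.rpow_neg hs0.le, Real.rpow_natCast, mul_assoc, mul_inv_cancel₀ (by positivity),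
            mul_one]
      _ ≤ C * (√(1 + ‖ξ‖ ^ 2)) ^ (-(k : ℝ)) := by
          refine mul_le_mul_of_nonneg_right (le_trans ?_ (hC m hm ξ)) (by positivity)
          gcongr
      _ ≤ C * (√(1 + ‖ξ‖ ^ 2)) ^ (l - ((∑ j, α j : ℕ) : ℝ)) := by
          refine mul_le_mul_of_nonneg_left (Real.rpow_le_rpow_of_exponent_le hs1 ?_) hC0
          linarith

/-! ### The kernel -/

/-- The exponent `n + 1` makes the bound integrable on `ℝ^n`. -/
theorem Transform.norm_le_rpow [μ.IsHaarMeasure] (hf : P.IsSmooth f)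
    (hint : ∀ F, P.Amplitude f F → Integrable F μ) {h : VR n → VR n → ℂ}
    (hh : P.Transform f μ h) {K : Set (VR n)} (hK : IsCompact K) (hKr : K ⊆ P.regularSet) :
    ∃ C, 0 ≤ C ∧ ∀ m ∈ K, ∀ ξ, ‖h m ξ‖ ≤ C * (1 + ‖ξ‖) ^ (-((n + 1 : ℕ) : ℝ)) := by
  obtain ⟨C, hC0, hC⟩ := hh.exists_norm_mul_one_add_pow_le hf hint hK hKr (n + 1)
  refine ⟨C, hC0, fun m hm ξ => ?_⟩
  rw [Real.rpow_neg (by positivity), Real.rpow_natCast, ← div_eq_mul_inv,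
    le_div_iff₀ (by positivity)]
  exact hC m hm ξ

theorem integrable_one_add_norm_rpow_neg (n : ℕ) :
    Integrable fun ξ : VR n => (1 + ‖ξ‖) ^ (-((n + 1 : ℕ) : ℝ)) :=
  integrable_one_add_norm (by simp)

theorem Transform.continuous_snd (hint : ∀ F, P.Amplitude f F → Integrable F μ)
    {h : VR n → VR n → ℂ} (hh : P.Transform f μ h) (m : VR n) : Continuous (h m) :=
  (hh.contDiff hint).continuous.comp (continuous_const.prodMk continuous_id)

theorem Transform.integrable [μ.IsHaarMeasure] (hf : P.IsSmooth f)
    (hint : ∀ F, P.Amplitude f F → Integrable F μ) {h : VR n → VR n → ℂ}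
    (hh : P.Transform f μ h) {m : VR n} (hm : m ∈ P.regularSet) : Integrable (h m) := by
  obtain ⟨C, hC0, hC⟩ := hh.norm_le_rpow hf hint isCompact_singleton (Set.singleton_subset_iff.2 hm)
  refine ((integrable_one_add_norm_rpow_neg n).const_mul C).mono'
    (hh.continuous_snd hint m).aestronglyMeasurable
    (Filter.Eventually.of_forall fun ξ => hC m rfl ξ)

/-- The `j`-th coordinate, as a complex-valued linear form. -/
noncomputable def coordC (j : Fin n) : VR n →L[ℝ] ℂ :=
  Complex.ofRealCLM.comp (EuclideanSpace.proj (𝕜 := ℝ) j)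

theorem norm_coordC_le (j : Fin n) : ‖coordC j‖ ≤ 1 :=
  ContinuousLinearMap.opNorm_le_bound _ zero_le_one fun v => by
    simpa [coordC] using PiLp.norm_apply_le v j

theorem Transform.exists_hasFDerivAt_fst (hint : ∀ F, P.Amplitude f F → Integrable F μ)
    {h : VR n → VR n → ℂ} (hh : P.Transform f μ h) : ∃ H : Fin n → VR n → VR n → ℂ,
      (∀ j, P.Transform f μ (H j)) ∧
      ∀ m ξ, HasFDerivAt (fun x => h x ξ) (∑ j, H j m ξ • coordC j) m := by
  choose H hH hd using hh.exists_hasLineDerivAt_fst hint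
  refine ⟨H, hH, fun m ξ => ?_⟩
  have h1 : Differentiable ℝ fun x => h x ξ :=
    ((hh.contDiff hint).comp (contDiff_id.prodMk contDiff_const)).differentiable (by simp)
  have h2 := (h1 m).hasFDerivAt
  refine h2.congr_fderiv ?_
  refine ContinuousLinearMap.coe_injective
    ((EuclideanSpace.basisFun (Fin n) ℝ).toBasis.ext fun j => ?_)
  have h3 := (h2.hasLineDerivAt (EuclideanSpace.single j 1)).lineDeriv.symm.trans
    (hd j m ξ).lineDeriv
  simp only [OrthonormalBasis.coe_toBasis, EuclideanSpace.basisFun_apply,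
    ContinuousLinearMap.coe_coe, h3]
  simp [coordC, apply_ite Complex.ofReal]

/-- The function `∫ e^{-i m' · ξ} h(m, ξ) dξ` of `(m, m')`. For `h = fHat μ f` it is the Schwartz
kernel of `π(f)`, up to the factor `(2π)^n`. -/
noncomputable def kernelOf (h : VR n → VR n → ℂ) (p : VR n × VR n) : ℂ :=
  ∫ ξ, Complex.exp (-(Complex.I * (inner ℝ p.2 ξ : ℝ))) * h p.1 ξ

theorem Transform.hasFDerivAt_kernelOf [μ.IsHaarMeasure] (hf : P.IsSmooth f)
    (hint : ∀ F, P.Amplitude f F → Integrable F μ) {h : VR n → VR n → ℂ}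
    (hh : P.Transform f μ h) {H : Fin n → VR n → VR n → ℂ} (hH : ∀ j, P.Transform f μ (H j))
    (hd : ∀ m ξ, HasFDerivAt (fun x => h x ξ) (∑ j, H j m ξ • coordC j) m) {p : VR n × VR n}
    (hp : p.1 ∈ P.regularSet) : HasFDerivAt (kernelOf h)
      (∑ j, (kernelOf (H j) p • (coordC j).comp (ContinuousLinearMap.fst ℝ (VR n) (VR n)) +
        kernelOf (fun m ξ => -Complex.I * (ξ j * h m ξ)) p •
          (coordC j).comp (ContinuousLinearMap.snd ℝ (VR n) (VR n)))) p := by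
  obtain ⟨K, hK, hKr, hKc⟩ := local_compact_nhds (P.isOpen_regularSet.mem_nhds hp)
  have hG : ∀ j, P.Transform f μ fun m ξ => -Complex.I * (ξ j * h m ξ) :=
    fun j => .smul _ _ (.mulXi j h hh)
  choose C hC0 hC using fun j => (hH j).norm_le_rpow hf hint hKc hKr
  choose D hD0 hD using fun j => (hG j).norm_le_rpow hf hint hKc hKr
  let e : VR n × VR n → VR n → ℂ := fun p ξ => Complex.exp (-(Complex.I * (inner ℝ p.2 ξ : ℝ)))
  have hec : ∀ p, Continuous (e p) := fun p => by
    simp only [e]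
    fun_prop
  have hmeas : ∀ {b : VR n → VR n → ℂ}, P.Transform f μ b → ∀ q : VR n × VR n,
      AEStronglyMeasurable (fun ξ => e q ξ * b q.1 ξ) volume := fun hb q =>
    ((hec q).mul (hb.continuous_snd hint q.1)).aestronglyMeasurable
  have hinte : ∀ {b : VR n → VR n → ℂ}, P.Transform f μ b →
      Integrable (fun ξ => e p ξ * b p.1 ξ) := fun hb =>
    (hb.integrable hf hint hp).mono (hmeas hb p) (Filter.Eventually.of_forall fun ξ => by
      rw [norm_mul, norm_cexp_neg_I_mul_ofReal, one_mul])
  let A : Fin n → VR n × VR n →L[ℝ] ℂ := fun j =>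
    (coordC j).comp (ContinuousLinearMap.fst ℝ (VR n) (VR n))
  let A' : Fin n → VR n × VR n →L[ℝ] ℂ := fun j =>
    (coordC j).comp (ContinuousLinearMap.snd ℝ (VR n) (VR n))
  have hA : ∀ j, ‖A j‖ ≤ 1 := fun j => (ContinuousLinearMap.opNorm_comp_le _ _).trans
    (mul_le_one₀ (norm_coordC_le j) (norm_nonneg _) (ContinuousLinearMap.norm_fst_le ..))
  have hA' : ∀ j, ‖A' j‖ ≤ 1 := fun j => (ContinuousLinearMap.opNorm_comp_le _ _).trans
    (mul_le_one₀ (norm_coordC_le j) (norm_nonneg _) (ContinuousLinearMap.norm_snd_le ..))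
  have key := hasFDerivAt_integral_of_dominated_of_fderiv_le (μ := (volume : Measure (VR n)))
    (x₀ := p) (s := K ×ˢ Set.univ) (F := fun q ξ => e q ξ * h q.1 ξ)
    (F' := fun q ξ => ∑ j, ((e q ξ * H j q.1 ξ) • A j +
      (e q ξ * (-Complex.I * (ξ j * h q.1 ξ))) • A' j))
    (bound := fun ξ => ∑ j, (C j + D j) * (1 + ‖ξ‖) ^ (-((n + 1 : ℕ) : ℝ)))
    (prod_mem_nhds hK Filter.univ_mem)
    (Filter.Eventually.of_forall fun q => hmeas hh q) (hinte hh)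
    (Finset.aestronglyMeasurable_fun_sum _ fun j _ =>
      ((hmeas (hH j) p).smul_const _).add ((hmeas (hG j) p).smul_const _))
    (Filter.Eventually.of_forall fun ξ q hq => (norm_sum_le _ _).trans
      (Finset.sum_le_sum fun j _ => by
        refine (norm_add_le _ _).trans ?_
        rw [add_mul]
        refine add_le_add ?_ ?_
        · rw [norm_smul, norm_mul, norm_cexp_neg_I_mul_ofReal, one_mul]
          exact (mul_le_of_le_one_right (norm_nonneg _) (hA j)).trans (hC j q.1 hq.1 ξ)
        · rw [norm_smul, norm_mul, norm_cexp_neg_I_mul_ofReal, one_mul]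
          exact (mul_le_of_le_one_right (norm_nonneg _) (hA' j)).trans (hD j q.1 hq.1 ξ)))
    (integrable_finsetSum _ fun j _ => (integrable_one_add_norm_rpow_neg n).const_mul _)
    (Filter.Eventually.of_forall fun ξ q _ => by
      have h1 : HasFDerivAt (fun q : VR n × VR n => -(Complex.I * (inner ℝ q.2 ξ : ℝ)))
          (∑ j, (-Complex.I * ξ j) • A' j) q := by
        have h0 : (fun q : VR n × VR n => -(Complex.I * (inner ℝ q.2 ξ : ℝ)))
            = ⇑(∑ j, (-Complex.I * ξ j) • A' j) := by
          ext q
          simp only [A', coordC, sum_apply, PiLp.inner_apply]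
          simp [Finset.mul_sum, mul_assoc]
        rw [h0]
        exact ContinuousLinearMap.hasFDerivAt _
      have h2 := h1.cexp.mul ((hd q.1 ξ).comp q hasFDerivAt_fst)
      refine h2.congr_fderiv ?_
      simp only [ContinuousLinearMap.finsetSum_comp, Finset.smul_sum, Finset.sum_add_distrib,
        smul_smul, ContinuousLinearMap.smul_comp]
      congr 1
      refine Finset.sum_congr rfl fun j _ => ?_
      congr 1
      simp only [e, Function.comp_apply]
      ring)
  refine key.congr_fderiv ?_
  rw [integral_finsetSum _ fun j _ => ((hinte (hH j)).smul_const _).add ((hinte (hG j)).smul_const _)]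
  refine Finset.sum_congr rfl fun j _ => ?_
  rw [integral_add ((hinte (hH j)).smul_const _) ((hinte (hG j)).smul_const _),
    integral_smul_const, integral_smul_const]
  rfl

/-- The first derivatives of a kernel are kernels of the same kind, so that it is smooth. -/
theorem Transform.contDiffOn_kernelOf [μ.IsHaarMeasure] (hf : P.IsSmooth f)
    (hint : ∀ F, P.Amplitude f F → Integrable F μ) {h : VR n → VR n → ℂ}
    (hh : P.Transform f μ h) : ContDiffOn ℝ ∞ (kernelOf h) (P.regularSet ×ˢ Set.univ) := by
  suffices ∀ k : ℕ, ∀ {h : VR n → VR n → ℂ}, P.Transform f μ h → ∀ p : VR n × VR n,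
      p.1 ∈ P.regularSet → ContDiffAt ℝ k (kernelOf h) p by
    exact contDiffOn_infty.2 fun k p hp => (this k hh p hp.1).contDiffWithinAt
  intro k
  induction k with
  | zero =>
    intro h hh p hp
    obtain ⟨H, hH, hd⟩ := hh.exists_hasFDerivAt_fst hint
    have hopen : IsOpen (Prod.fst ⁻¹' P.regularSet : Set (VR n × VR n)) :=
      P.isOpen_regularSet.preimage continuous_fst
    refine contDiffAt_zero.2 ⟨_, hopen.mem_nhds hp, fun q hq => ?_⟩
    exact (hh.hasFDerivAt_kernelOf hf hint hH hd hq).continuousAt.continuousWithinAt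
  | succ k ih =>
    intro h hh p hp
    obtain ⟨H, hH, hd⟩ := hh.exists_hasFDerivAt_fst hint
    have hopen : IsOpen (Prod.fst ⁻¹' P.regularSet : Set (VR n × VR n)) :=
      P.isOpen_regularSet.preimage continuous_fst
    refine contDiffAt_succ_iff_hasFDerivAt.2 ⟨_, ⟨_, hopen.mem_nhds hp, fun q hq =>
      hh.hasFDerivAt_kernelOf hf hint hH hd hq⟩, ?_⟩
    refine ContDiffAt.sum fun j _ => ContDiffAt.add ?_ ?_
    · exact (ih (hH j) p hp).smul contDiffAt_const
    · exact (ih (.smul _ _ (.mulXi j h hh)) p hp).smul contDiffAt_const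

end PrehomogeneousSpace

/-! ### Fourier inversion -/

section FourierInversion

variable {n : ℕ} {u : VR n → ℂ}

open FourierTransform in
/-- Comparison with Mathlib's normalization `∫ e^{-2πi y · ξ} u(y) dy`. -/
theorem fourierT_eq_fourier (u : VR n → ℂ) (ξ : VR n) :
    fourierT u ξ = 𝓕 u ((2 * Real.pi)⁻¹ • ξ) := by
  rw [Real.fourier_eq', fourierT]
  refine integral_congr_ae (Filter.Eventually.of_forall fun y => ?_)
  simp only [smul_eq_mul, inner_smul_right]
  congr 2
  push_cast
  field_simp

theorem integrable_fourierT (hu : ContDiff ℝ ∞ u) (hc : HasCompactSupport u) :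
    Integrable (fourierT u) := by
  have h := (FourierTransform.fourier (hc.toSchwartzMap hu)).integrable (μ := volume)
  rw [SchwartzMap.fourier_coe] at h
  have h2 := h.comp_smul (R := (2 * Real.pi)⁻¹) (by positivity)
  refine h2.congr (Filter.Eventually.of_forall fun ξ => ?_)
  rw [fourierT_eq_fourier]
  rfl

theorem fourierT_inversion (hu : ContDiff ℝ ∞ u) (hc : HasCompactSupport u) (y : VR n) :
    u y = ((2 * Real.pi : ℂ) ^ n)⁻¹ *
      ∫ ξ, Complex.exp (Complex.I * (inner ℝ y ξ : ℝ)) * fourierT u ξ := by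
  have hi := (FourierTransform.fourier (hc.toSchwartzMap hu)).integrable (μ := volume)
  rw [SchwartzMap.fourier_coe] at hi
  have h := congrFun (hu.continuous.fourierInv_fourier_eq (hu.continuous.integrable_of_hasCompactSupport hc) hi) y
  rw [← h, Real.fourierInv_eq']
  have hs := Measure.integral_comp_smul (volume : Measure (VR n))
    (fun w : VR n => Complex.exp ((2 * Real.pi * inner ℝ w y : ℝ) * Complex.I) •
      FourierTransform.fourier u w) (2 * Real.pi)⁻¹
  have h1 : ∀ ξ : VR n, Complex.exp (Complex.I * (inner ℝ y ξ : ℝ)) * fourierT u ξ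
      = Complex.exp ((2 * Real.pi * inner ℝ ((2 * Real.pi)⁻¹ • ξ) y : ℝ) * Complex.I) •
        FourierTransform.fourier u ((2 * Real.pi)⁻¹ • ξ) := by
    intro ξ
    rw [fourierT_eq_fourier, smul_eq_mul, inner_smul_left, real_inner_comm]
    congr 2
    push_cast
    simp
    field_simp
  simp only [h1, hs]
  have hpi : (0 : ℝ) < 2 * Real.pi := by positivity
  have h2 : |((2 * Real.pi)⁻¹ ^ n)⁻¹| = (2 * Real.pi) ^ n := by
    rw [inv_pow, inv_inv, abs_of_pos (by positivity)]
  have hn : Module.finrank ℝ (VR n) = n := finrank_euclideanSpace_fin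
  rw [hn, h2, Complex.real_smul]
  push_cast
  rw [inv_mul_cancel_left₀]
  exact pow_ne_zero _ (by exact_mod_cast hpi.ne')

end FourierInversion

/-- Fubini's theorem for a kernel `e` of modulus at most one. -/
theorem integral_mul_integral_swap {X Y : Type*} [MeasurableSpace X] [MeasurableSpace Y]
    {μ : Measure X} {ν : Measure Y} [SFinite μ] [SFinite ν] {a : X → ℂ} {b : Y → ℂ} {e : X → Y → ℂ}
    (ha : Integrable a μ) (hb : Integrable b ν)
    (he : AEStronglyMeasurable (Function.uncurry e) (μ.prod ν)) (he1 : ∀ x y, ‖e x y‖ ≤ 1) :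
    ∫ x, a x * ∫ y, e x y * b y ∂ν ∂μ = ∫ y, (∫ x, a x * e x y ∂μ) * b y ∂ν := by
  have hprod : Integrable (Function.uncurry fun x y => a x * (e x y * b y)) (μ.prod ν) := by
    refine ((ha.mul_prod hb).bdd_mul he (c := 1)
      (Filter.Eventually.of_forall fun p => he1 p.1 p.2)).congr
      (Filter.Eventually.of_forall fun p => ?_)
    simp only [Function.uncurry]
    ring
  simp only [← integral_const_mul]
  rw [integral_integral_swap hprod]
  simp only [← mul_assoc, integral_mul_const]

theorem IsCompact.eventually_forall_dist_lt {X Y E : Type*} [TopologicalSpace X] [TopologicalSpace Y]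
    [PseudoMetricSpace E] {F : X → Y → E} (hF : Continuous (Function.uncurry F)) {K : Set Y}
    (hK : IsCompact K) (x₀ : X) {ε : ℝ} (hε : 0 < ε) :
    ∀ᶠ x in 𝓝 x₀, ∀ y ∈ K, dist (F x y) (F x₀ y) < ε := by
  refine hK.eventually_forall_of_forall_eventually fun y _ => ?_
  have h : Continuous fun p : X × Y => dist (F p.1 p.2) (F x₀ p.2) :=
    hF.dist (hF.comp (continuous_const.prodMk continuous_snd))
  exact (h.tendsto (x₀, y)).eventually (gt_mem_nhds (by simpa using hε))

namespace ZeroAtInftyContinuousMap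

/-- Evaluation at a point, as a continuous linear form. -/
noncomputable def evalL {X : Type*} [TopologicalSpace X] (x : X) : C₀(X, ℂ) →L[ℂ] ℂ :=
  LinearMap.mkContinuous
    { toFun := fun u => u x
      map_add' := fun _ _ => rfl
      map_smul' := fun _ _ => rfl } 1 fun u => by
    rw [one_mul, ← norm_toBCF_eq_norm]
    exact u.toBCF.norm_coe_le_norm x

end ZeroAtInftyContinuousMap

namespace PrehomogeneousSpace

variable {N n : ℕ} {P : PrehomogeneousSpace N n} {f : P.G → ℂ}

/-! ### The operator -/

variable (P) in
theorem locallyCompactSpace_G : LocallyCompactSpace P.G :=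
  P.isClosedEmbedding_pair.locallyCompactSpace

variable (P) in
theorem continuous_act_uncurry : Continuous fun p : P.G × VR n => P.act p.1 p.2 := by
  refine (PiLp.continuous_toLp 2 _).comp (continuous_pi fun i => ?_)
  simp only [Matrix.mulVec, dotProduct]
  refine continuous_finsetSum _ fun j _ => ((P.continuous_realRep i j).comp continuous_fst).mul ?_
  fun_prop

variable (P) in
theorem continuous_act_inv_uncurry : Continuous fun p : P.G × VR n => P.act p.1⁻¹ p.2 := by
  refine (PiLp.continuous_toLp 2 _).comp (continuous_pi fun i => ?_)
  simp only [Matrix.mulVec, dotProduct]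
  refine continuous_finsetSum _ fun j _ =>
    (((P.continuous_realRep i j).comp continuous_inv).comp continuous_fst).mul ?_
  fun_prop

/-- The left regular representation is strongly continuous on the functions with compact support. -/
theorem continuous_leftRegular {φ : C₀(VR n, ℂ)} (hφ : HasCompactSupport φ) :
    Continuous fun g : P.G => P.leftRegular g φ := by
  have _ := P.locallyCompactSpace_G
  have hcont : Continuous fun p : P.G × VR n => φ (P.act p.1⁻¹ p.2) :=
    (map_continuous φ).comp P.continuous_act_inv_uncurry
  refine continuous_iff_continuousAt.2 fun g₀ => Metric.tendsto_nhds.2 fun ε hε => ?_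
  obtain ⟨Q, hQ, hQ₀⟩ := exists_compact_mem_nhds g₀
  -- the supports of the translates by the elements of `Q` lie in a common compact set
  let K : Set (VR n) := (fun p : P.G × VR n => P.act p.1 p.2) '' (Q ×ˢ tsupport φ)
  have hK : IsCompact K := (hQ.prod hφ).image P.continuous_act_uncurry
  have hout : ∀ g ∈ Q, ∀ m, m ∉ K → φ (P.act g⁻¹ m) = 0 := by
    intro g hg m hm
    by_contra hne
    exact hm ⟨(g, P.act g⁻¹ m), ⟨hg, subset_tsupport _ hne⟩, P.act_act_inv g m⟩
  have hin : ∀ᶠ g in 𝓝 g₀, ∀ m ∈ K, dist (φ (P.act g⁻¹ m)) (φ (P.act g₀⁻¹ m)) < ε / 2 :=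
    hK.eventually_forall_dist_lt (F := fun (g : P.G) (m : VR n) => φ (P.act g⁻¹ m)) hcont g₀
      (half_pos hε)
  filter_upwards [hin, hQ₀] with g hg hgQ
  refine lt_of_le_of_lt ?_ (half_lt_self hε)
  rw [← ZeroAtInftyContinuousMap.dist_toBCF_eq_dist]
  refine (BoundedContinuousFunction.dist_le (half_pos hε).le).2 fun m => ?_
  change dist (φ (P.act g⁻¹ m)) (φ (P.act g₀⁻¹ m)) ≤ ε / 2
  by_cases hm : m ∈ K
  · exact (hg m hm).le
  · rw [hout g hgQ m hm, hout g₀ (mem_of_mem_nhds hQ₀) m hm, dist_self]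
    exact (half_pos hε).le

theorem norm_leftRegular_le (g : P.G) (φ : C₀(VR n, ℂ)) : ‖P.leftRegular g φ‖ ≤ ‖φ‖ := by
  rw [← ZeroAtInftyContinuousMap.norm_toBCF_eq_norm, ← ZeroAtInftyContinuousMap.norm_toBCF_eq_norm]
  refine (BoundedContinuousFunction.norm_le (norm_nonneg _)).2 fun m => ?_
  exact φ.toBCF.norm_coe_le_norm (P.act g⁻¹ m)

variable [MeasurableSpace P.G] {μ : Measure P.G}

/-- The exponentials `e^{i m · ξ}` and `e^{-i m · ξ}`, from the phase and from the symbol, cancel. -/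
theorem integral_oscIntegrand (φ : VR n → ℂ) (m ξ : VR n) :
    ∫ m', oscIntegrand (P.symbol μ f) φ m m' ξ = P.fHat μ f m ξ * fourierT φ ξ := by
  rw [fourierT, ← integral_const_mul]
  refine integral_congr_ae (Filter.Eventually.of_forall fun m' => ?_)
  simp only [oscIntegrand, symbol, inner_sub_left, Complex.ofReal_sub, mul_sub]
  rw [sub_eq_add_neg, Complex.exp_add]
  have : Complex.exp (Complex.I * (inner ℝ m ξ : ℝ)) * Complex.exp (-(Complex.I * (inner ℝ m ξ : ℝ)))
      = 1 := by rw [← Complex.exp_add, add_neg_cancel, Complex.exp_zero]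
  linear_combination (Complex.exp (-(Complex.I * (inner ℝ m' ξ : ℝ))) * P.fHat μ f m ξ * φ m') * this

theorem psiOp_symbol (φ : VR n → ℂ) (m : VR n) : psiOp (P.symbol μ f) φ m
    = ((2 * Real.pi : ℂ) ^ n)⁻¹ * ∫ ξ, P.fHat μ f m ξ * fourierT φ ξ := by
  rw [psiOp]
  congr 1
  refine integral_congr_ae (Filter.Eventually.of_forall fun ξ => ?_)
  simp only [symbol]
  rw [← mul_assoc, ← Complex.exp_add, add_neg_cancel, Complex.exp_zero, one_mul]

variable [BorelSpace P.G]

/-- The Bochner integral that defines `π(f) φ` converges, and may be evaluated at a point. -/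
theorem piOp_apply (hfi : Integrable f μ) {φ : C₀(VR n, ℂ)} (hφ : HasCompactSupport φ) (m : VR n) :
    P.piOp μ f φ m = ∫ g, f g * φ (P.act g⁻¹ m) ∂μ := by
  have _ := P.secondCountableTopology_G
  have hi : Integrable (fun g => f g • P.leftRegular g φ) μ :=
    (hfi.norm.mul_const ‖φ‖).mono'
      (hfi.aestronglyMeasurable.smul (continuous_leftRegular hφ).aestronglyMeasurable)
      (Filter.Eventually.of_forall fun g => by
        rw [norm_smul]
        exact mul_le_mul_of_nonneg_left (norm_leftRegular_le g φ) (norm_nonneg _))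
  exact ((ZeroAtInftyContinuousMap.evalL m).integral_comp_comm hi).symm

/-- Fourier inversion for `u`, inserted in the integral for `π(f) u`. -/
theorem piOp_eq_integral_fHat_mul [SFinite μ] (hfi : Integrable f μ) {U : Set (VR n)} (u : TestFun U)
    (m : VR n) : P.piOp μ f u.toC0 m = ((2 * Real.pi : ℂ) ^ n)⁻¹ *
      ∫ ξ, P.fHat μ f m ξ * fourierT u.toFun ξ := by
  have _ := P.secondCountableTopology_G
  have hu := integrable_fourierT u.smooth u.compact
  rw [piOp_apply hfi (φ := u.toC0) u.compact]
  change ∫ g, f g * u.toFun (P.act g⁻¹ m) ∂μ = _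
  have hcont : Continuous (Function.uncurry fun (g : P.G) (ξ : VR n) =>
      Complex.exp (Complex.I * (inner ℝ (P.act g⁻¹ m) ξ : ℝ))) := by
    have h1 : Continuous fun p : P.G × VR n => P.act p.1⁻¹ m :=
      P.continuous_act_inv_uncurry.comp (continuous_fst.prodMk continuous_const)
    have h2 : Continuous fun p : P.G × VR n => (inner ℝ (P.act p.1⁻¹ m) p.2 : ℝ) :=
      h1.inner continuous_snd
    exact (by fun_prop : Continuous fun s : ℝ => Complex.exp (Complex.I * (s : ℂ))).comp h2
  simp only [fun g : P.G => fourierT_inversion u.smooth u.compact (P.act g⁻¹ m),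
    mul_left_comm (f _), integral_const_mul]
  congr 1
  exact integral_mul_integral_swap hfi hu hcont.aestronglyMeasurable
    fun g ξ => (norm_exp_I_mul_ofReal _).le

theorem integrable_fHat_mul_fourierT (hint : ∀ F, P.Amplitude f F → Integrable F μ)
    {U : Set (VR n)} (u : TestFun U) (m : VR n) :
    Integrable fun ξ => P.fHat μ f m ξ * fourierT u.toFun ξ := by
  have hT : P.Transform f μ fun m ξ => P.fHat μ f m ξ := .hat f (.base f .self)
  exact (integrable_fourierT u.smooth u.compact).bdd_mul
    (hT.continuous_snd hint m).aestronglyMeasurable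
    (Filter.Eventually.of_forall fun ξ => norm_fHat_le f m ξ)

theorem integral_fHat_mul_fourierT [μ.IsHaarMeasure] (hf : P.IsSmooth f)
    (hint : ∀ F, P.Amplitude f F → Integrable F μ) {U : Set (VR n)} (u : TestFun U) {m : VR n}
    (hm : m ∈ P.regularSet) : ∫ ξ, P.fHat μ f m ξ * fourierT u.toFun ξ
      = ∫ y, kernelOf (P.fHat μ f) (m, y) * u.toFun y := by
  have hT : P.Transform f μ fun m ξ => P.fHat μ f m ξ := .hat f (.base f .self)
  have hu : Integrable u.toFun := u.smooth.continuous.integrable_of_hasCompactSupport u.compact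
  have hc : Continuous (Function.uncurry fun ξ y : VR n =>
      Complex.exp (-(Complex.I * (inner ℝ y ξ : ℝ)))) := by
    unfold Function.uncurry
    fun_prop
  have h := integral_mul_integral_swap (hT.integrable hf hint hm) hu
    (μ := volume) (ν := volume) hc.aestronglyMeasurable fun ξ y => (norm_cexp_neg_I_mul_ofReal _).le
  refine h.trans ?_
  simp only [kernelOf, mul_comm]

theorem integrable_oscIntegrand [μ.IsHaarMeasure] (hf : P.IsSmooth f)
    (hint : ∀ F, P.Amplitude f F → Integrable F μ) {U : Set (VR n)} (u : TestFun U) {m : VR n}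
    (hm : m ∈ P.regularSet) : Integrable fun p : VR n × VR n =>
      oscIntegrand (P.symbol μ f) u.toFun m p.1 p.2 := by
  have hT : P.Transform f μ fun m ξ => P.fHat μ f m ξ := .hat f (.base f .self)
  have hu : Integrable u.toFun := u.smooth.continuous.integrable_of_hasCompactSupport u.compact
  have h1 := hu.mul_prod (hT.integrable hf hint hm)
  have hc : Continuous fun p : VR n × VR n => Complex.exp (Complex.I * (inner ℝ (m - p.1) p.2 : ℝ)) *
      Complex.exp (-(Complex.I * (inner ℝ m p.2 : ℝ))) := by fun_prop
  refine (h1.bdd_mul hc.aestronglyMeasurable (c := 1) (Filter.Eventually.of_forall fun p => by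
    rw [norm_mul, norm_cexp_neg_I_mul_ofReal, norm_exp_I_mul_ofReal, one_mul])).congr
    (Filter.Eventually.of_forall fun p => ?_)
  simp only [oscIntegrand, symbol]
  ring

end PrehomogeneousSpace

theorem theorem4p1 {N n : ℕ} (P : PrehomogeneousSpace N n)
    [MeasurableSpace P.G] [BorelSpace P.G] (μ : Measure P.G) [μ.IsHaarMeasure]
    (B : LinearMap.BilinForm ℝ (Matrix (Fin N) (Fin N) ℝ))
    (hB_symm : ∀ X Y, B X Y = B Y X) (hB_pos : ∀ X, X ≠ 0 → 0 < B X X)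
    (f : P.G → ℂ) (hf : P.RapidlyDecreasing B μ f) :
    -- `V_ℝ - S_ℝ` is open
    IsOpen P.regularSet ∧
    -- the formula for `π(f)`: the iterated integral converges at every point of `V_ℝ`, and the
    -- double integral converges absolutely at the points of `V_ℝ - S_ℝ`
    (∀ (φ : TestFun (Set.univ : Set (VR n))) (m : VR n),
      Integrable (fun ξ : VR n => ∫ m', oscIntegrand (P.symbol μ f) φ.toFun m m' ξ) ∧
      P.piOp μ f φ.toC0 m = ((2 * Real.pi : ℂ) ^ n)⁻¹ *
        ∫ ξ, ∫ m', oscIntegrand (P.symbol μ f) φ.toFun m m' ξ) ∧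
    (∀ (φ : TestFun (Set.univ : Set (VR n))), ∀ m ∈ P.regularSet,
      Integrable fun p : VR n × VR n => oscIntegrand (P.symbol μ f) φ.toFun m p.1 p.2) ∧
    -- the symbol is in `S^{-∞}((V_ℝ - S_ℝ) × V_ℝ^*)`
    (∀ l : ℝ, IsSymbol l P.regularSet (P.symbol μ f)) ∧
    -- on `V_ℝ - S_ℝ`, `π(f)` is in `L^{-∞}` and has a smooth kernel
    IsSmoothingPseudodiff P.regularSet (fun u m => P.piOp μ f u.toC0 m) ∧
    HasSmoothKernel P.regularSet (fun u m => P.piOp μ f u.toC0 m) := by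
  have _ := P.sigmaCompactSpace_G
  have hint : ∀ F, P.Amplitude f F → Integrable F μ := fun F hF =>
    hF.integrable hB_symm hB_pos hf
  have hfi : Integrable f μ := hint f (.base f .self)
  have hT : P.Transform f μ fun m ξ => P.fHat μ f m ξ := .hat f (.base f .self)
  have hsym : ∀ l : ℝ, IsSymbol l P.regularSet (P.symbol μ f) := fun l =>
    PrehomogeneousSpace.TwistedTransform.isSymbol hf.smooth hint ⟨_, hT, rfl⟩ l
  refine ⟨P.isOpen_regularSet, fun φ m => ?_, fun φ m hm =>
    PrehomogeneousSpace.integrable_oscIntegrand hf.smooth hint φ hm, hsym, fun l =>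
    ⟨P.symbol μ f, hsym l, fun u m _ => ?_⟩, ?_⟩
  · simp only [PrehomogeneousSpace.integral_oscIntegrand]
    exact ⟨PrehomogeneousSpace.integrable_fHat_mul_fourierT hint φ m,
      PrehomogeneousSpace.piOp_eq_integral_fHat_mul hfi φ m⟩
  · rw [PrehomogeneousSpace.psiOp_symbol]
    exact PrehomogeneousSpace.piOp_eq_integral_fHat_mul hfi u m
  · refine ⟨fun m m' => ((2 * Real.pi : ℂ) ^ n)⁻¹ *
      PrehomogeneousSpace.kernelOf (P.fHat μ f) (m, m'), ?_, fun u m hm => ?_⟩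
    · exact contDiffOn_const.mul ((hT.contDiffOn_kernelOf hf.smooth hint).mono
        (Set.prod_mono_right (Set.subset_univ _)))
    · simp only [mul_assoc]
      rw [PrehomogeneousSpace.piOp_eq_integral_fHat_mul hfi u m,
        PrehomogeneousSpace.integral_fHat_mul_fourierT hf.smooth hint u hm, integral_const_mul]
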